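/- For a graph $G$ with $n$ vertices and a linear order $\sigma=(v_1,\dots,v_n)$ of its vertices, let $mim(\sigma,G)$ be the maximum over $1\le i<n$ (and $0$ if $n=1$) of the maximum number of edges of an induced matching in the bipartite graph formed by the edges of $G$ with one endpoint in $\{v_1,\dots,v_i\}$ and the other in $\{v_{i+1},\dots,v_n\}$. The linear induced matching width $lmw(G)$ is the minimum of $mim(\sigma,G)$ over all linear orders $\sigma$ of the vertices. **Theorem.** Given any tree $T$, $lmw(T)$ can be computed in $O(n\log n)$ time, where $n$ is the number of nodes of $T$. More precisely, there are a program for a random access machine (registers and arrays of words; unit-cost addition, truncated subtraction, comparison, and indirect addressing) and a function $f(n)=O(n\log n)$ such that, for every tree $T$ with vertices $0,\dots,n-1$ given by adjacency lists (in any order), the program halts after at most $f(n)$ steps with output $lmw(T)$, and all numbers that occur are words of $O(\log n)$ bits (for $n\ge 2$; of $O(1)$ bits for $n=1$). -/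

import Mathlib

open Filter Asymptotics

namespace SimpleGraph

/-- `MIM(H)`: the maximum number of edges of an induced matching of `H`, that is, of a subgraph of
`H` which is a matching and which is induced by its vertices. -/
noncomputable def mim {V : Type*} (H : SimpleGraph V) : ℕ :=
  sSup {k : ℕ | ∃ M : H.Subgraph, M.IsMatching ∧ M.IsInduced ∧ M.edgeSet.ncard = k}

/-- A linear layout: `σ v` is the (zero-based) position of the vertex `v`. -/
abbrev Layout (V : Type*) [Fintype V] : Type _ := V ≃ Fin (Fintype.card V)

/-- The bipartite graph of the edges of `G` with one endpoint among the first `i` vertices of the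
layout `σ` and the other endpoint among the remaining vertices. -/
def cutGraph {V : Type*} [Fintype V] (G : SimpleGraph V) (σ : Layout V) (i : ℕ) : SimpleGraph V :=
  G.between {v | (σ v : ℕ) < i} {v | i ≤ (σ v : ℕ)}

/-- `mim(σ, G)`: the maximum, over all cuts `1 ≤ i < |V|` of the layout `σ`, of the maximum induced
matching of the cut; it is `0` if there is no cut. -/
noncomputable def layoutMim {V : Type*} [Fintype V] (G : SimpleGraph V) (σ : Layout V) : ℕ :=
  (Finset.Ico 1 (Fintype.card V)).sup fun i => (G.cutGraph σ i).mim

/-- `lmw(G)`, the linear induced matching width of `G`: the minimum of `mim(σ, G)` over all linear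
layouts `σ` of the vertices of `G`. -/
noncomputable def lmw {V : Type*} [Fintype V] (G : SimpleGraph V) : ℕ :=
  ⨅ σ : Layout V, G.layoutMim σ

/-- `adj` is an adjacency-list representation of `G`: the list `adj v` enumerates the neighbours of
`v`, in any order and without repetitions. -/
def IsAdjacencyList {n : ℕ} (G : SimpleGraph (Fin n)) (adj : Fin n → List (Fin n)) : Prop :=
  ∀ v, (adj v).Nodup ∧ ∀ u, u ∈ adj v ↔ G.Adj v u

end SimpleGraph

/-! A random access machine: finitely many registers and finitely many one-dimensional arrays of
words (a program mentions only finitely many), with addition, truncated subtraction, comparison,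
indirect addressing and structured control flow. Every elementary operation takes one step. -/
namespace RAM

/-- The contents of the registers and of the arrays. -/
structure State where
  reg : ℕ → ℕ
  arr : ℕ → ℕ → ℕ

/-- Arithmetic expressions; `get a e` is the entry of array `a` at the index `e`. -/
inductive Expr : Type
  | const (k : ℕ)
  | reg (r : ℕ)
  | get (a : ℕ) (i : Expr)
  | add (e₁ e₂ : Expr)
  | sub (e₁ e₂ : Expr)

namespace Expr

/-- The value of an expression (subtraction is truncated at `0`). -/
def eval (s : State) : Expr → ℕ
  | const k => k
  | reg r => s.reg r
  | get a i => s.arr a (i.eval s)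
  | add e₁ e₂ => e₁.eval s + e₂.eval s
  | sub e₁ e₂ => e₁.eval s - e₂.eval s

/-- The number of elementary operations in the evaluation of an expression. -/
def cost : Expr → ℕ
  | const _ => 1
  | reg _ => 1
  | get _ i => i.cost + 1
  | add e₁ e₂ => e₁.cost + e₂.cost + 1
  | sub e₁ e₂ => e₁.cost + e₂.cost + 1

/-- All values met during the evaluation (intermediate results, addresses, and the contents of
registers and array entries that are read) are words, that is, smaller than `W`. -/
def Fits (W : ℕ) (s : State) : Expr → Prop
  | const k => k < W
  | reg r => s.reg r < W
  | get a i => i.Fits W s ∧ s.arr a (i.eval s) < W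
  | add e₁ e₂ => e₁.Fits W s ∧ e₂.Fits W s ∧ e₁.eval s + e₂.eval s < W
  | sub e₁ e₂ => e₁.Fits W s ∧ e₂.Fits W s

end Expr

/-- Tests, used in branches and loops. -/
inductive Test : Type
  | lt (e₁ e₂ : Expr)
  | eq (e₁ e₂ : Expr)
  | not (b : Test)
  | and (b₁ b₂ : Test)

namespace Test

/-- The truth value of a test. -/
def Holds (s : State) : Test → Prop
  | lt e₁ e₂ => e₁.eval s < e₂.eval s
  | eq e₁ e₂ => e₁.eval s = e₂.eval s
  | not b => ¬ b.Holds s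
  | and b₁ b₂ => b₁.Holds s ∧ b₂.Holds s

/-- The number of elementary operations in the evaluation of a test. -/
def cost : Test → ℕ
  | lt e₁ e₂ => e₁.cost + e₂.cost + 1
  | eq e₁ e₂ => e₁.cost + e₂.cost + 1
  | not b => b.cost + 1
  | and b₁ b₂ => b₁.cost + b₂.cost + 1

/-- All values met during the evaluation of a test are words. -/
def Fits (W : ℕ) (s : State) : Test → Prop
  | lt e₁ e₂ => e₁.Fits W s ∧ e₂.Fits W s
  | eq e₁ e₂ => e₁.Fits W s ∧ e₂.Fits W s
  | not b => b.Fits W s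
  | and b₁ b₂ => b₁.Fits W s ∧ b₂.Fits W s

end Test

/-- Programs: `set r e` assigns to register `r`, `put a i e` assigns to the entry of array `a` at
index `i`, `branch b c d` is "if `b` then `c` else `d`", and `loop b c` is "while `b` do `c`". -/
inductive Program : Type
  | skip
  | set (r : ℕ) (e : Expr)
  | put (a : ℕ) (i e : Expr)
  | seq (c d : Program)
  | branch (b : Test) (c d : Program)
  | loop (b : Test) (c : Program)

/-- `Run W p s t s'`: on a machine whose words are the numbers smaller than `W`, the program `p`
started in the state `s` halts after exactly `t` steps in the state `s'`, and no word overflows. -/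
inductive Run (W : ℕ) : Program → State → ℕ → State → Prop
  | skip (s : State) : Run W .skip s 1 s
  | set (r : ℕ) (e : Expr) (s : State) : e.Fits W s →
      Run W (.set r e) s (e.cost + 1) ⟨Function.update s.reg r (e.eval s), s.arr⟩
  | put (a : ℕ) (i e : Expr) (s : State) : i.Fits W s → e.Fits W s →
      Run W (.put a i e) s (i.cost + e.cost + 1)
        ⟨s.reg, Function.update s.arr a (Function.update (s.arr a) (i.eval s) (e.eval s))⟩
  | seq {c d : Program} {s s₁ s₂ : State} {t₁ t₂ : ℕ} :
      Run W c s t₁ s₁ → Run W d s₁ t₂ s₂ → Run W (.seq c d) s (t₁ + t₂) s₂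
  | branch_true {b : Test} {c d : Program} {s s' : State} {t : ℕ} :
      b.Fits W s → b.Holds s → Run W c s t s' → Run W (.branch b c d) s (b.cost + t) s'
  | branch_false {b : Test} {c d : Program} {s s' : State} {t : ℕ} :
      b.Fits W s → ¬ b.Holds s → Run W d s t s' → Run W (.branch b c d) s (b.cost + t) s'
  | loop_true {b : Test} {c : Program} {s s₁ s₂ : State} {t₁ t₂ : ℕ} :
      b.Fits W s → b.Holds s → Run W c s t₁ s₁ → Run W (.loop b c) s₁ t₂ s₂ →
      Run W (.loop b c) s (b.cost + t₁ + t₂) s₂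
  | loop_false {b : Test} {c : Program} {s : State} :
      b.Fits W s → ¬ b.Holds s → Run W (.loop b c) s b.cost s

/-- The initial state for a graph with vertices `0, …, n - 1` given by adjacency lists. Register `0`
holds `n`, array `1` holds the concatenation of the lists `adj 0, …, adj (n - 1)`, and, for `v ≤ n`,
the entry `v` of array `0` is the total length of the lists `adj u` with `u < v`; so the list
`adj v` occupies in array `1` the positions from the entry `v` of array `0` up to, and excluding,
the entry `v + 1` of array `0`. Everything else is `0`. -/
def graphInput {n : ℕ} (adj : Fin n → List (Fin n)) : State where
  reg r := if r = 0 then n else 0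
  arr a i :=
    if a = 0 then (if i ≤ n then ((List.ofFn adj).take i).flatten.length else 0)
    else if a = 1 then ((List.ofFn adj).flatten.map Fin.val).getD i 0
    else 0

end RAM

/-!
Layouts are handled as sequences of vertices, and a matching of a cut as a set of pairs oriented
from the left to the right (`IsCutMatching`); `lmw_le_iff` links these to the definition of the
width.

**When is the width of a tree at most `k + 1`?** Exactly if some path of the tree is such that all
components outside its closed neighbourhood have width at most `k`. Such a path gives a layout:
every vertex of the path is followed by the layouts of the subtrees hanging off it, each of them
closed by its neighbour of the path vertex, so that the open edges at the path vertex and the edges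
at this neighbour exclude each other (`IsFan`, `cutsLE_path`). If there is no such path, then there
are three connected branches that meet in one vertex and contain mutually distant parts of width
more than `k`; the part whose critical cut is the median one sees an additional edge on the
connection between the other two (`not_lmwLE_of_tripod`).

**Labels.** A rooted tree is decomposed from the top level down: at level `k + 1` only the part that
is not yet settled by the higher levels matters, the residual tree, and how its path lies relative
to the root is recorded by an entry of the label, which is one of `0`, `1`, `2`, `4`, `5`
(`LevelSem`, `IsResidual`). The label of a tree depends only on the labels of the child subtrees of
the root, and at each level only on the number of nonzero entries, on the sum of the entries minus
one, and on whether the level below overflows (`TreeLabel.label`, `IsBranching.isResidual`). The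
width is the highest level with a nonzero entry at the root (`Rooted.lmw_eq`).

**Few levels.** A nonzero entry at level `k` accounts for `2 ^ k` vertices, and an overflow at level
`k` for `2 ^ (k + 1)` (`TreeLabel.sum_code_le`, `Rooted.sum_le_card`). So only the levels `k` with
`2 ^ k ≤ n` matter, and a label takes `O(log n)` words and `O(log n)` steps.

**The program.** No root has to be chosen: leaves are removed one after the other, and the label of
a removed leaf is added to the two accumulators per level of its only remaining neighbour
(`Elimination.step`). The last remaining vertex is the root. The degree and the sum of the remaining
neighbours of every vertex are maintained; for a leaf this sum is its neighbour. A pointer runs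
through all vertices, and a vertex before the pointer that becomes a leaf is removed at once, so no
queue is needed and there are at most `2 * n` rounds of `O(log n)` steps (`elimStep_spec`,
`lmwProgram_spec`).
-/

namespace SimpleGraph

variable {V : Type*} {G : SimpleGraph V}

/-- `G.IsCutMatching A B M`: the pairs in `M` are the edges, oriented from `A` to `B`, of an induced
matching of the bipartite graph of the edges of `G` between `A` and `B`. The second clause makes the
matching induced, and also forces distinct pairs to have distinct first and second components. -/
def IsCutMatching (G : SimpleGraph V) (A B : List V) (M : Finset (V × V)) : Prop :=
  (∀ e ∈ M, e.1 ∈ A ∧ e.2 ∈ B ∧ G.Adj e.1 e.2) ∧ ∀ e ∈ M, ∀ f ∈ M, G.Adj e.1 f.2 → e = f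

/-- All cuts of the sequence `l` of vertices have induced matchings with at most `k` edges only. -/
def CutsLE (G : SimpleGraph V) (k : ℕ) (l : List V) : Prop :=
  ∀ A B M, l = A ++ B → G.IsCutMatching A B M → M.card ≤ k

/-- The subgraph of `G` induced on `S` has linear induced matching width at most `k`. -/
def LmwLE (G : SimpleGraph V) (S : Finset V) (k : ℕ) : Prop :=
  ∃ l : List V, l.Nodup ∧ (∀ v, v ∈ l ↔ v ∈ S) ∧ G.CutsLE k l

/-- A set of vertices is connected if every splitting of it into two nonempty parts is crossed by an
edge. (The empty set counts as connected.) -/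
def ConnOn (G : SimpleGraph V) (C : Set V) : Prop :=
  ∀ A : Set V, (∃ a ∈ C, a ∈ A) → (∃ b ∈ C, b ∉ A) → ∃ a ∈ C, ∃ b ∈ C, a ∈ A ∧ b ∉ A ∧ G.Adj a b

/-! ### Cut matchings and layouts -/

lemma IsCutMatching.restrict {A B A' B' : List V} {M : Finset (V × V)}
    (h : G.IsCutMatching A B M) (hM : ∀ e ∈ M, e.1 ∈ A' ∧ e.2 ∈ B') :
    G.IsCutMatching A' B' M :=
  ⟨fun e he => ⟨(hM e he).1, (hM e he).2, (h.1 e he).2.2⟩, h.2⟩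

lemma IsCutMatching.subset {A B : List V} {M N : Finset (V × V)}
    (h : G.IsCutMatching A B M) (hN : N ⊆ M) : G.IsCutMatching A B N :=
  ⟨fun e he => h.1 e (hN he), fun e he f hf => h.2 e (hN he) f (hN hf)⟩

lemma IsCutMatching.card_le_one {A B : List V} {M : Finset (V × V)} (h : G.IsCutMatching A B M)
    (v : V) (hv : ∀ e ∈ M, e.1 = v) : M.card ≤ 1 := by
  refine Finset.card_le_one.2 fun e he f hf => ?_
  refine h.2 e he f hf ?_
  rw [hv e he, ← hv f hf]
  exact (h.1 f hf).2.2

lemma IsCutMatching.card_le_one' {A B : List V} {M : Finset (V × V)} (h : G.IsCutMatching A B M)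
    (v : V) (hv : ∀ e ∈ M, e.2 = v) : M.card ≤ 1 := by
  refine Finset.card_le_one.2 fun e he f hf => ?_
  refine h.2 e he f hf ?_
  rw [hv f hf, ← hv e he]
  exact (h.1 e he).2.2

lemma IsCutMatching.swap {A B : List V} {M : Finset (V × V)} (h : G.IsCutMatching A B M) :
    G.IsCutMatching B A (M.map (Equiv.prodComm V V).toEmbedding) := by
  constructor
  · intro e he
    simp only [Finset.mem_map, Equiv.coe_toEmbedding, Equiv.prodComm_apply] at he
    obtain ⟨f, hf, rfl⟩ := he
    exact ⟨(h.1 f hf).2.1, (h.1 f hf).1, (h.1 f hf).2.2.symm⟩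
  · intro e he f hf hef
    simp only [Finset.mem_map, Equiv.coe_toEmbedding, Equiv.prodComm_apply] at he hf
    obtain ⟨e, he, rfl⟩ := he
    obtain ⟨f, hf, rfl⟩ := hf
    rw [h.2 f hf e he hef.symm]

lemma CutsLE.reverse {k : ℕ} {l : List V} (h : G.CutsLE k l) : G.CutsLE k l.reverse := by
  intro A B M hl hM
  have := h B.reverse A.reverse (M.map (Equiv.prodComm V V).toEmbedding)
    (by rw [← List.reverse_append, ← hl, List.reverse_reverse])
    (hM.swap.restrict fun e he => by simpa using ⟨(hM.swap.1 e he).1, (hM.swap.1 e he).2.1⟩)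
  simpa using this

lemma CutsLE.filter {k : ℕ} {l : List V} (h : G.CutsLE k l) (p : V → Bool) :
    G.CutsLE k (l.filter p) := by
  intro A B M hl hM
  obtain ⟨A', B', rfl, rfl, rfl⟩ := List.filter_eq_append_iff.1 hl
  exact h A' B' M rfl (hM.restrict fun e he =>
    ⟨List.mem_of_mem_filter (hM.1 e he).1, List.mem_of_mem_filter (hM.1 e he).2.1⟩)

lemma CutsLE.mono {j k : ℕ} (hjk : j ≤ k) {l : List V} (h : G.CutsLE j l) : G.CutsLE k l :=
  fun A B M hl hM => (h A B M hl hM).trans hjk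

lemma cutsLE_nil (k : ℕ) : G.CutsLE k [] := by
  intro A B M hl hM
  obtain ⟨rfl, rfl⟩ := List.append_eq_nil_iff.1 hl.symm
  have : M = ∅ := Finset.eq_empty_of_forall_notMem fun e he => by simpa using (hM.1 e he).1
  simp [this]

lemma CutsLE.append {k : ℕ} {l₁ l₂ : List V} (h₁ : G.CutsLE k l₁) (h₂ : G.CutsLE k l₂)
    (h : ∀ x ∈ l₁, ∀ y ∈ l₂, ¬ G.Adj x y) : G.CutsLE k (l₁ ++ l₂) := by
  intro A B M hl hM
  rcases List.append_eq_append_iff.1 hl with ⟨C, rfl, rfl⟩ | ⟨C, rfl, rfl⟩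
  · refine h₂ C B M rfl (hM.restrict fun e he => ?_)
    obtain ⟨h1, h2, h3⟩ := hM.1 e he
    rcases List.mem_append.1 h1 with h1 | h1
    · exact absurd h3 (h _ h1 _ (by simp [h2]))
    · exact ⟨h1, h2⟩
  · refine h₁ A C M rfl (hM.restrict fun e he => ?_)
    obtain ⟨h1, h2, h3⟩ := hM.1 e he
    rcases List.mem_append.1 h2 with h2 | h2
    · exact ⟨h1, h2⟩
    · exact absurd h3 (h _ (by simp [h1]) _ h2)

lemma cutsLE_zero_singleton (v : V) : G.CutsLE 0 [v] := by
  intro A B M hl hM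
  have : M = ∅ := by
    refine Finset.eq_empty_of_forall_notMem fun e he => ?_
    obtain ⟨h1, h2, h3⟩ := hM.1 e he
    have h1' : e.1 ∈ [v] := by rw [hl]; simp [h1]
    have h2' : e.2 ∈ [v] := by rw [hl]; simp [h2]
    rw [List.mem_singleton] at h1' h2'
    exact h3.ne (h1'.trans h2'.symm)
  simp [this]

lemma cutsLE_pair (k : ℕ) (v w : V) : G.CutsLE (k + 1) [v, w] := by
  intro A B M hl hM
  refine (?_ : M.card ≤ 1).trans (by omega)
  rcases A with _ | ⟨a, _ | ⟨a', A⟩⟩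
  · have : M = ∅ := Finset.eq_empty_of_forall_notMem fun e he => by simpa using (hM.1 e he).1
    simp [this]
  · exact hM.card_le_one a fun e he => by simpa using (hM.1 e he).1
  · obtain rfl : B = [] := by simp at hl; tauto
    have : M = ∅ := Finset.eq_empty_of_forall_notMem fun e he => by simpa using (hM.1 e he).2.1
    simp [this]

lemma LmwLE.mono {j k : ℕ} (hjk : j ≤ k) {S : Finset V} (h : G.LmwLE S j) : G.LmwLE S k :=
  let ⟨l, h1, h2, h3⟩ := h; ⟨l, h1, h2, h3.mono hjk⟩

lemma LmwLE.subset {k : ℕ} {S T : Finset V} (h : G.LmwLE T k) (hST : S ⊆ T) : G.LmwLE S k := by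
  classical
  obtain ⟨l, h1, h2, h3⟩ := h
  refine ⟨l.filter (· ∈ S), h1.filter _, fun v => ?_, h3.filter _⟩
  simp only [List.mem_filter, h2, decide_eq_true_eq]
  exact ⟨And.right, fun h => ⟨hST h, h⟩⟩

lemma lmwLE_empty (k : ℕ) : G.LmwLE ∅ k := ⟨[], by simp, by simp, cutsLE_nil k⟩

lemma lmwLE_singleton (v : V) (k : ℕ) : G.LmwLE {v} k :=
  ⟨[v], by simp, by simp, (cutsLE_zero_singleton v).mono (Nat.zero_le k)⟩

lemma LmwLE.union [DecidableEq V] {k : ℕ} {S T : Finset V} (hS : G.LmwLE S k) (hT : G.LmwLE T k)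
    (hd : Disjoint S T) (h : ∀ x ∈ S, ∀ y ∈ T, ¬ G.Adj x y) : G.LmwLE (S ∪ T) k := by
  obtain ⟨l, h1, h2, h3⟩ := hS
  obtain ⟨l', h1', h2', h3'⟩ := hT
  refine ⟨l ++ l', List.nodup_append'.2 ⟨h1, h1', fun v hv hv' => ?_⟩, fun v => by simp [h2, h2'],
    h3.append h3' fun x hx y hy => h x ((h2 x).1 hx) y ((h2' y).1 hy)⟩
  exact Finset.disjoint_left.1 hd ((h2 v).1 hv) ((h2' v).1 hv')

lemma LmwLE.biUnion [DecidableEq V] {ι : Type*} {k : ℕ} (J : Finset ι) (R : ι → Finset V)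
    (hR : ∀ i ∈ J, G.LmwLE (R i) k) (hd : ∀ i j, i ≠ j → Disjoint (R i) (R j))
    (h : ∀ i j, i ≠ j → ∀ x ∈ R i, ∀ y ∈ R j, ¬ G.Adj x y) : G.LmwLE (J.biUnion R) k := by
  classical
  induction J using Finset.induction_on with
  | empty => simpa using lmwLE_empty k
  | insert i J hi ih =>
    rw [Finset.biUnion_insert]
    refine (hR i (by simp)).union (ih fun j hj => hR j (by simp [hj])) ?_ ?_
    · exact (Finset.disjoint_biUnion_right _ _ _).2 fun j hj => hd i j fun h => hi (h ▸ hj)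
    · intro x hx y hy
      obtain ⟨j, hj, hy⟩ := Finset.mem_biUnion.1 hy
      exact h i j (fun h => hi (h ▸ hj)) x hx y hy

/-! ### Fans and the layout along a path -/

/-- A sequence `h` that can be placed right after `r` in a layout while edges from `r` to later
vertices are still open: each of its cuts has matchings of at most `k + 1` edges, and of at most `k`
edges if the matching stays compatible with an open edge of `r`. -/
def IsFan (G : SimpleGraph V) (k : ℕ) (r : V) (h : List V) : Prop :=
  ∀ A B M, h = A ++ B → G.IsCutMatching A B M →
    M.card ≤ k + 1 ∧ ((∀ e ∈ M, ¬ G.Adj r e.2) → M.card ≤ k)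

lemma isFan_nil (k : ℕ) (r : V) : G.IsFan k r [] := fun A B M h hM =>
  have := cutsLE_nil (G := G) 0 A B M h hM
  ⟨by omega, fun _ => by omega⟩

lemma IsFan.append {k : ℕ} {r : V} {l₁ l₂ : List V} (h₁ : G.IsFan k r l₁) (h₂ : G.IsFan k r l₂)
    (h : ∀ x ∈ l₁, ∀ y ∈ l₂, ¬ G.Adj x y) : G.IsFan k r (l₁ ++ l₂) := by
  intro A B M hl hM
  rcases List.append_eq_append_iff.1 hl with ⟨C, rfl, rfl⟩ | ⟨C, rfl, rfl⟩
  · refine h₂ C B M rfl (hM.restrict fun e he => ?_)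
    obtain ⟨h1, h2, h3⟩ := hM.1 e he
    rcases List.mem_append.1 h1 with h1 | h1
    · exact absurd h3 (h _ h1 _ (by simp [h2]))
    · exact ⟨h1, h2⟩
  · refine h₁ A C M rfl (hM.restrict fun e he => ?_)
    obtain ⟨h1, h2, h3⟩ := hM.1 e he
    rcases List.mem_append.1 h2 with h2 | h2
    · exact ⟨h1, h2⟩
    · exact absurd h3 (h _ (by simp [h1]) _ h2)

/-- Placing a vertex `v` at the end adds at most one matching edge, namely an edge at `v`. -/
lemma CutsLE.concat_aux {k : ℕ} {v : V} {l : List V} (h : G.CutsLE k l) {A B : List V}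
    {M : Finset (V × V)} (hl : l ++ [v] = A ++ B) (hM : G.IsCutMatching A B M) :
    M.card ≤ k + 1 ∧ ((∀ e ∈ M, e.2 ≠ v) → M.card ≤ k) := by
  classical
  rcases List.eq_nil_or_concat' B with rfl | ⟨B', w, rfl⟩
  · have : M = ∅ := Finset.eq_empty_of_forall_notMem fun e he => by simpa using (hM.1 e he).2.1
    simp [this]
  · rw [← List.append_assoc] at hl
    obtain ⟨rfl, hw⟩ := List.append_inj' hl rfl
    obtain rfl : v = w := by simpa using hw
    have h1 : (M.filter fun e => e.2 ≠ v).card ≤ k := by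
      refine h A B' _ rfl ((hM.subset (Finset.filter_subset _ _)).restrict fun e he => ?_)
      rw [Finset.mem_filter] at he
      have := hM.1 e he.1
      simp only [List.mem_append, List.mem_singleton, he.2, or_false] at this
      exact ⟨this.1, this.2.1⟩
    have h2 : (M.filter fun e => ¬ e.2 ≠ v).card ≤ 1 :=
      (hM.subset (Finset.filter_subset _ _)).card_le_one' v fun e he => by
        simpa using (Finset.mem_filter.1 he).2
    have h3 := Finset.card_filter_add_card_filter_not (s := M) (fun e => e.2 ≠ v)
    refine ⟨by omega, fun h4 => ?_⟩
    rwa [Finset.filter_true_of_mem h4] at h1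

lemma CutsLE.concat {k : ℕ} {l : List V} (h : G.CutsLE k l) (v : V) :
    G.CutsLE (k + 1) (l ++ [v]) :=
  fun _ _ _ hl hM => (h.concat_aux hl hM).1

/-- A neighbour `v` of `r` placed after a layout of width at most `k` forms a fan: edges at `v`
exclude edges at `r`. -/
lemma CutsLE.isFan {k : ℕ} {r v : V} {l : List V} (h : G.CutsLE k l) (hv : G.Adj r v) :
    G.IsFan k r (l ++ [v]) :=
  fun _ _ _ hl hM => ⟨(h.concat_aux hl hM).1,
    fun hr => (h.concat_aux hl hM).2 fun e he hev => hr e he (hev ▸ hv)⟩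

/-- The layout of a tree along a path through `r`: the part before `r`, then `r` and the subtrees
hanging off `r`, then the part after `r`. -/
lemma cutsLE_path {k : ℕ} {r : V} {l₁ h l₂ : List V} (h₁ : G.CutsLE (k + 1) (r :: l₁))
    (hh : G.IsFan k r h) (h₂ : G.CutsLE (k + 1) (r :: l₂))
    (h1h : ∀ x ∈ l₁, ∀ y ∈ h, ¬ G.Adj x y) (h12 : ∀ x ∈ l₁, ∀ y ∈ l₂, ¬ G.Adj x y)
    (hh2 : ∀ x ∈ h, ∀ y ∈ l₂, ¬ G.Adj x y) :
    G.CutsLE (k + 1) (l₁.reverse ++ r :: (h ++ l₂)) := by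
  classical
  have key : ∀ A C M, l₁.reverse = A ++ C → G.IsCutMatching A (C ++ r :: (h ++ l₂)) M →
      M.card ≤ k + 1 := by
    intro A C M hl hM
    refine h₁.reverse A (C ++ [r]) M (by simp [hl]) (hM.restrict fun e he => ?_)
    obtain ⟨e1, e2, e3⟩ := hM.1 e he
    have e1' : e.1 ∈ l₁ := by rw [← List.mem_reverse, hl]; simp [e1]
    simp only [List.mem_append, List.mem_cons] at e2
    rcases e2 with e2 | e2 | e2 | e2
    · exact ⟨e1, by simp [e2]⟩
    · exact ⟨e1, by simp [e2]⟩
    · exact absurd e3 (h1h _ e1' _ e2)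
    · exact absurd e3 (h12 _ e1' _ e2)
  intro A B M hl hM
  rcases List.append_eq_append_iff.1 hl with ⟨C, rfl, hC⟩ | ⟨C, hA, rfl⟩
  swap
  · exact key A C M hA hM
  rcases C with _ | ⟨c, C⟩
  · refine key l₁.reverse [] M (by simp) ?_
    simpa [hC] using hM
  rw [List.cons_append, List.cons.injEq] at hC
  obtain ⟨rfl, hC⟩ := hC
  rcases List.append_eq_append_iff.1 hC with ⟨D, rfl, rfl⟩ | ⟨D, rfl, rfl⟩
  · refine h₂ (r :: D) B M rfl (hM.restrict fun e he => ?_)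
    obtain ⟨e1, e2, e3⟩ := hM.1 e he
    simp only [List.mem_append, List.mem_cons, List.mem_reverse] at e1
    rcases e1 with e1 | e1 | e1 | e1
    · exact absurd e3 (h12 _ e1 _ (by simp [e2]))
    · exact ⟨by simp [e1], e2⟩
    · exact absurd e3 (hh2 _ e1 _ (by simp [e2]))
    · exact ⟨by simp [e1], e2⟩
  · have hM' : ∀ e ∈ M, e.1 = r ∨ e.1 ∈ C ∧ e.2 ∈ D := by
      intro e he
      obtain ⟨e1, e2, e3⟩ := hM.1 e he
      simp only [List.mem_append, List.mem_cons, List.mem_reverse] at e1 e2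
      rcases e1 with e1 | e1 | e1
      · rcases e2 with e2 | e2
        · exact absurd e3 (h1h _ e1 _ (by simp [e2]))
        · exact absurd e3 (h12 _ e1 _ e2)
      · exact .inl e1
      · rcases e2 with e2 | e2
        · exact .inr ⟨e1, e2⟩
        · exact absurd e3 (hh2 _ (by simp [e1]) _ e2)
    have hN : G.IsCutMatching C D (M.filter fun e => e.1 ≠ r) := by
      refine (hM.subset (Finset.filter_subset _ _)).restrict fun e he => ?_
      rw [Finset.mem_filter] at he
      exact (hM' e he.1).resolve_left he.2
    have h2 : (M.filter fun e => ¬ e.1 ≠ r).card ≤ 1 :=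
      (hM.subset (Finset.filter_subset _ _)).card_le_one r fun e he => by
        simpa using (Finset.mem_filter.1 he).2
    have h3 := Finset.card_filter_add_card_filter_not (s := M) (fun e => e.1 ≠ r)
    obtain ⟨f1, f2⟩ := hh C D _ rfl hN
    by_cases hr : ∃ f ∈ M, f.1 = r
    · obtain ⟨f, hf, hfr⟩ := hr
      have := f2 fun e he hre => by
        rw [Finset.mem_filter] at he
        have := hM.2 f hf e he.1 (by rw [hfr]; exact hre)
        exact he.2 (this ▸ hfr)
      omega
    · have : M.filter (fun e => ¬ e.1 ≠ r) = ∅ :=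
        Finset.filter_eq_empty_iff.2 fun e he her => hr ⟨e, he, not_not.1 her⟩
      rw [this, Finset.card_empty] at h3
      omega

/-! ### Connected sets and the obstruction -/

lemma ConnOn.union {C D : Set V} (hC : G.ConnOn C) (hD : G.ConnOn D) {x : V} (hxC : x ∈ C)
    (hxD : x ∈ D) : G.ConnOn (C ∪ D) := by
  intro A ⟨a, ha, haA⟩ ⟨b, hb, hbA⟩
  have lift : ∀ E ⊆ C ∪ D, (∃ a ∈ E, ∃ b ∈ E, a ∈ A ∧ b ∉ A ∧ G.Adj a b) →
      ∃ a ∈ C ∪ D, ∃ b ∈ C ∪ D, a ∈ A ∧ b ∉ A ∧ G.Adj a b :=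
    fun E hE ⟨a, ha, b, hb, h⟩ => ⟨a, hE ha, b, hE hb, h⟩
  by_cases hx : x ∈ A
  · rcases hb with hb | hb
    · exact lift C Set.subset_union_left (hC A ⟨x, hxC, hx⟩ ⟨b, hb, hbA⟩)
    · exact lift D Set.subset_union_right (hD A ⟨x, hxD, hx⟩ ⟨b, hb, hbA⟩)
  · rcases ha with ha | ha
    · exact lift C Set.subset_union_left (hC A ⟨a, ha, haA⟩ ⟨x, hxC, hx⟩)
    · exact lift D Set.subset_union_right (hD A ⟨a, ha, haA⟩ ⟨x, hxD, hx⟩)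

lemma connOn_singleton (v : V) : G.ConnOn {v} := by
  rintro A ⟨a, rfl, ha⟩ ⟨b, rfl, hb⟩
  exact absurd ha hb

lemma connOn_pair {v w : V} (h : G.Adj v w) : G.ConnOn {v, w} := by
  rintro A ⟨a, ha, haA⟩ ⟨b, hb, hbA⟩
  rcases ha with rfl | rfl <;> rcases hb with rfl | rfl
  · exact absurd haA hbA
  · exact ⟨a, by simp, b, by simp, haA, hbA, h⟩
  · exact ⟨a, by simp, b, by simp, haA, hbA, h.symm⟩
  · exact absurd haA hbA

lemma ConnOn.insert {C : Set V} (hC : G.ConnOn C) {x y : V} (hx : x ∈ C) (h : G.Adj x y) :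
    G.ConnOn (insert y C) := by
  have := (connOn_pair h).union hC (x := x) (by simp) hx
  convert this using 1
  ext z
  simp only [Set.mem_insert_iff, Set.mem_union, Set.mem_singleton_iff]
  constructor
  · tauto
  · rintro ((rfl | h) | h)
    · exact .inr hx
    · exact .inl h
    · exact .inr h

/-- A layout in which `T` has width more than `k` has a cut with more than `k` matching edges
inside `T`. -/
lemma exists_cut_of_not_lmwLE {k : ℕ} {T : Finset V} (hT : ¬ G.LmwLE T k) {l : List V}
    (hl : l.Nodup) (hTl : ∀ v ∈ T, v ∈ l) :
    ∃ A B M, l = A ++ B ∧ G.IsCutMatching A B M ∧ k < M.card ∧ ∀ e ∈ M, e.1 ∈ T ∧ e.2 ∈ T := by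
  classical
  by_contra! hcon
  refine hT ⟨l.filter (· ∈ T), hl.filter _, fun v => ?_, fun A B M hAB hM => ?_⟩
  · simpa using hTl v
  · by_contra! hk
    obtain ⟨A', B', rfl, rfl, rfl⟩ := List.filter_eq_append_iff.1 hAB
    obtain ⟨e, he, hne⟩ := hcon A' B' M rfl (hM.restrict fun e he =>
      ⟨List.mem_of_mem_filter (hM.1 e he).1, List.mem_of_mem_filter (hM.1 e he).2.1⟩) hk
    have := hM.1 e he
    simp only [List.mem_filter, decide_eq_true_eq] at this
    exact hne this.1.2 this.2.1.2

/-- If the median cut of `T₂` lies between cuts of `T₁` and `T₃`, the connection from `T₁` to `T₃`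
through `x` contributes one more matching edge. -/
lemma exists_larger_matching {k : ℕ} {x : V} {B₁ B₃ T₁ T₂ T₃ : Finset V}
    (hB₁ : G.ConnOn (B₁ : Set V)) (hB₃ : G.ConnOn (B₃ : Set V)) (hx₁ : x ∈ B₁) (hx₃ : x ∈ B₃)
    (hT₁ : T₁ ⊆ B₁) (hT₃ : T₃ ⊆ B₃)
    (h₁₂ : ∀ u ∈ B₁, ∀ v ∈ T₂, ¬ G.Adj u v) (h₃₂ : ∀ u ∈ B₃, ∀ v ∈ T₂, ¬ G.Adj u v)
    {l : List V} (hl : l.Nodup) (hBl : ∀ v, v ∈ B₁ ∨ v ∈ B₃ → v ∈ l) {A B : List V}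
    {M : Finset (V × V)} (hAB : l = A ++ B) (hM : G.IsCutMatching A B M)
    (hMT : ∀ e ∈ M, e.1 ∈ T₂ ∧ e.2 ∈ T₂) (hk : k < M.card)
    (h1 : ∃ a ∈ T₁, a ∈ A) (h3 : ∃ b ∈ T₃, b ∈ B) : ¬ G.CutsLE (k + 1) l := by
  classical
  intro hcut
  subst hAB
  have hdisj : ∀ v, v ∈ A → v ∈ B → False := fun v hA hB =>
    (List.nodup_append'.1 hl).2.2 hA hB
  obtain ⟨a, ha, haA⟩ := h1
  obtain ⟨b, hb, hbB⟩ := h3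
  obtain ⟨c, hc, d, hd, hcA, hdA, hcd⟩ := hB₁.union hB₃ hx₁ hx₃ {v | v ∈ A}
    ⟨a, .inl (hT₁ ha), haA⟩ ⟨b, .inr (hT₃ hb), fun h => hdisj _ h hbB⟩
  have hc2 : ∀ v ∈ T₂, ¬ G.Adj c v := fun v hv => hc.elim (h₁₂ c · v hv) (h₃₂ c · v hv)
  have hd2 : ∀ v ∈ T₂, ¬ G.Adj d v := fun v hv => hd.elim (h₁₂ d · v hv) (h₃₂ d · v hv)
  have hdB : d ∈ B := (List.mem_append.1 (hBl d hd)).resolve_left hdA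
  have hcdM : (c, d) ∉ M := fun h => hc2 _ (hMT _ h).2 hcd
  have := hcut A B (insert (c, d) M) rfl ⟨?_, ?_⟩
  · rw [Finset.card_insert_of_notMem hcdM] at this
    omega
  · intro e he
    rcases Finset.mem_insert.1 he with rfl | he
    · exact ⟨hcA, hdB, hcd⟩
    · exact hM.1 e he
  · intro e he f hf hef
    rcases Finset.mem_insert.1 he with rfl | he <;> rcases Finset.mem_insert.1 hf with rfl | hf
    · rfl
    · exact absurd hef (hc2 _ (hMT f hf).2)
    · exact absurd hef.symm (hd2 _ (hMT e he).1)
    · exact hM.2 e he f hf hef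

/-- Three connected branches meeting in `x` that contain mutually distant sets of width more than
`k` force width more than `k + 1`. -/
lemma not_lmwLE_of_tripod {k : ℕ} {x : V} {S : Finset V} {B T : Fin 3 → Finset V}
    (hB : ∀ i, G.ConnOn (B i : Set V)) (hx : ∀ i, x ∈ B i) (hTB : ∀ i, T i ⊆ B i)
    (hBS : ∀ i, B i ⊆ S) (hsep : ∀ i j, i ≠ j → ∀ u ∈ B i, ∀ v ∈ T j, ¬ G.Adj u v)
    (hT : ∀ i, ¬ G.LmwLE (T i) k) : ¬ G.LmwLE S (k + 1) := by
  rintro ⟨l, hl, hlS, hcut⟩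
  have hBl : ∀ i, ∀ v ∈ B i, v ∈ l := fun i v hv => (hlS v).2 (hBS i hv)
  choose A C M hAC hM hk hMT using fun i =>
    exists_cut_of_not_lmwLE (hT i) hl fun v hv => hBl i v (hTB i hv)
  have hne : ∀ i, ∃ e, e ∈ M i := fun i => Finset.card_pos.1 (by have := hk i; omega)
  -- a cut further to the right has a longer left part
  have hsub : ∀ i j, (A i).length ≤ (A j).length → A i ⊆ A j ∧ C j ⊆ C i := by
    intro i j hij
    rcases List.append_eq_append_iff.1 ((hAC i).symm.trans (hAC j)) with ⟨D, h1, h2⟩ | ⟨D, h1, h2⟩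
    · rw [h1, h2]; simp
    · obtain rfl : D = [] := by
        rw [h1, List.length_append] at hij
        exact List.length_eq_zero_iff.1 (by omega)
      simp at h1 h2
      rw [h1, h2]; simp
  have key : ∀ i j m : Fin 3, i ≠ j → m ≠ j → (A i).length ≤ (A j).length →
      (A j).length ≤ (A m).length → False := by
    intro i j m hij hmj h1 h2
    obtain ⟨e, he⟩ := hne i
    obtain ⟨f, hf⟩ := hne m
    exact exists_larger_matching (hB i) (hB m) (hx i) (hx m) (hTB i) (hTB m) (hsep i j hij)
      (hsep m j hmj) hl (fun v hv => hv.elim (hBl i v) (hBl m v)) (hAC j) (hM j) (hMT j) (hk j)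
      ⟨e.1, (hMT i e he).1, (hsub i j h1).1 ((hM i).1 e he).1⟩
      ⟨f.2, (hMT m f hf).2, (hsub j m h2).2 ((hM m).1 f hf).2.1⟩ hcut
  have k1 := key 0 1 2 (by decide) (by decide)
  have k2 := key 2 1 0 (by decide) (by decide)
  have k3 := key 1 0 2 (by decide) (by decide)
  have k4 := key 2 0 1 (by decide) (by decide)
  have k5 := key 0 2 1 (by decide) (by decide)
  have k6 := key 1 2 0 (by decide) (by decide)
  rcases le_total (A 0).length (A 1).length with h | h <;>
    rcases le_total (A 1).length (A 2).length with h' | h' <;>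
    rcases le_total (A 0).length (A 2).length with h'' | h'' <;> tauto

/-- A set that contains both ends of an edge does not have width `0`. -/
lemma not_lmwLE_zero {S : Finset V} {u v : V} (hu : u ∈ S) (hv : v ∈ S) (huv : G.Adj u v) :
    ¬ G.LmwLE S 0 := by
  rintro ⟨l, hl, hlS, hcut⟩
  have key : ∀ u v : V, G.Adj u v → ∀ A B, l = A ++ B → u ∈ A → v ∈ B → False := by
    intro u v huv A B hAB hA hB
    have := hcut A B {(u, v)} hAB ⟨by simp [hA, hB, huv], by simp⟩
    simp at this
  obtain ⟨A, B, hAB⟩ := List.append_of_mem ((hlS u).2 hu)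
  have hvl := (hlS v).2 hv
  rw [hAB] at hvl
  simp only [List.mem_append, List.mem_cons] at hvl
  rcases hvl with h | h | h
  · exact key v u huv.symm A (u :: B) hAB h (by simp)
  · exact huv.ne h.symm
  · exact key u v huv (A ++ [u]) B (by simp [hAB]) (by simp) h

end SimpleGraph

/-! ### Labels of rooted trees -/

namespace TreeLabel

/-- The entry of a label at a positive level, when `c` tells whether the level below overflows, `m`
children have a nonzero entry at this level, and the sum of (entry minus one) over these children is
`s`. The entries are `0`, `1`, `2`, `4`, `5`; as `3` does not occur, the pair `(m, s)` decides the
case: for `s ≤ 2` there are exactly `s` children with entry `2` and none with a larger one, and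
`m = 1` with `s = 3` or `s = 4` is a single child with entry `4` or `5`. In the remaining case the
level overflows. -/
def levelCode (c : Bool) (m s : ℕ) : ℕ :=
  if m = 0 then (if c then 1 else 0)
  else if s ≤ 1 then 2
  else if s = 2 then 4
  else if m = 1 ∧ s = 3 then 5
  else if m = 1 ∧ s = 4 ∧ c = false then 5
  else 0

/-- Whether a positive level overflows; the arguments are those of `levelCode`. -/
def levelCarry (c : Bool) (m s : ℕ) : Bool :=
  decide (m ≠ 0 ∧ 3 ≤ s ∧ ¬ (m = 1 ∧ s = 3) ∧ ¬ (m = 1 ∧ s = 4 ∧ c = false))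

/-- Whether level `k` overflows, that is, the part of the tree seen at level `k` has width more
than `k`. -/
def carry (m s : ℕ → ℕ) : ℕ → Bool
  | 0 => decide (m 0 ≠ 0)
  | k + 1 => levelCarry (carry m s k) (m (k + 1)) (s (k + 1))

/-- The entry of the label at level `k`, before the entries that a higher level makes irrelevant are
deleted. -/
def code (m s : ℕ → ℕ) : ℕ → ℕ
  | 0 => if m 0 = 0 then 1 else 0
  | k + 1 => levelCode (carry m s k) (m (k + 1)) (s (k + 1))

/-- Level `k + 1` does not make the levels up to `k` irrelevant. -/
def Keeps (m s : ℕ → ℕ) (k : ℕ) : Prop :=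
  carry m s k = false ∧ (m (k + 1) = 0 ∨ m (k + 1) = 1 ∧ s (k + 1) = 4)

/-- No level above `k` makes level `k` irrelevant. -/
def Alive (m s : ℕ → ℕ) (k : ℕ) : Prop := ∀ j, k ≤ j → Keeps m s j

open Classical in
/-- The label of a rooted tree in terms of the labels of the children of the root: `m k` is the
number of children with a nonzero entry at level `k`, and `s k` is the sum of (entry minus one) over
them. -/
noncomputable def label (m s : ℕ → ℕ) (k : ℕ) : ℕ := if Alive m s k then code m s k else 0

lemma alive_iff {m s : ℕ → ℕ} {k : ℕ} : Alive m s k ↔ Keeps m s k ∧ Alive m s (k + 1) := by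
  refine ⟨fun h => ⟨h k le_rfl, fun j hj => h j (by omega)⟩, fun h j hj => ?_⟩
  rcases hj.eq_or_lt with rfl | hj
  · exact h.1
  · exact h.2 j hj

section Cases

variable {ι : Type*} [Fintype ι] {f : ι → ℕ}

/-- The number of nonzero entries. -/
def total (f : ι → ℕ) : ℕ := ∑ i, if f i = 0 then 0 else 1

/-- The sum of (entry minus one) over the nonzero entries. -/
def weight (f : ι → ℕ) : ℕ := ∑ i, (f i - 1)

lemma total_eq_zero (h : total f = 0) (i : ι) : f i = 0 := by
  have := Finset.sum_eq_zero_iff.1 h i (Finset.mem_univ i)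
  by_contra hi
  simp [hi] at this

lemma total_eq_card [DecidableEq ι] : total f = (Finset.univ.filter fun i => f i ≠ 0).card := by
  rw [total, Finset.card_filter]
  exact Finset.sum_congr rfl fun i _ => by by_cases h : f i = 0 <;> simp [h]

lemma exists_of_total_ne_zero (h : total f ≠ 0) : ∃ i, f i ≠ 0 := by
  by_contra! h'
  exact h (by simp [total, h'])

lemma exists_of_total_eq_one (h : total f = 1) :
    ∃ i, f i = weight f + 1 ∧ ∀ j, j ≠ i → f j = 0 := by
  classical
  rw [total_eq_card] at h
  obtain ⟨i, hi⟩ := Finset.card_eq_one.1 h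
  have hj : ∀ j, j ≠ i → f j = 0 := fun j hj => by
    by_contra hne
    have : j ∈ ({i} : Finset ι) := hi ▸ by simp [hne]
    exact hj (by simpa using this)
  have hi0 : f i ≠ 0 := by
    have : i ∈ Finset.univ.filter fun i => f i ≠ 0 := hi ▸ by simp
    simpa using this
  refine ⟨i, ?_, hj⟩
  rw [weight, Finset.sum_eq_single i (fun j _ hji => by simp [hj j hji]) (by simp)]
  omega

lemma le_weight (f : ι → ℕ) (i : ι) : f i - 1 ≤ weight f :=
  Finset.single_le_sum (f := fun i => f i - 1) (fun _ _ => Nat.zero_le _) (Finset.mem_univ i)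

lemma weight_eq_card [DecidableEq ι] (h : ∀ i, f i ≤ 2) :
    weight f = (Finset.univ.filter fun i => f i = 2).card := by
  rw [weight, Finset.card_filter]
  refine Finset.sum_congr rfl fun i _ => ?_
  have := h i
  split_ifs <;> omega

lemma le_two_of_weight_le (hf : ∀ i, f i ≠ 3) (h : weight f ≤ 2) (i : ι) : f i ≤ 2 := by
  have := le_weight f i
  have := hf i
  omega

lemma cases_of_two_le_total (hf : ∀ i, f i ≠ 3) (h2 : 2 ≤ total f) :
    (∃ i j, i ≠ j ∧ 4 ≤ f i ∧ f j ≠ 0) ∨ ∀ i, f i ≤ 2 := by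
  classical
  by_cases h : ∀ i, f i ≤ 2
  · exact .inr h
  push Not at h
  obtain ⟨i, hi⟩ := h
  rw [total_eq_card] at h2
  obtain ⟨j, hj, hji⟩ := Finset.exists_mem_ne (Nat.lt_of_succ_le h2) i
  have := hf i
  exact .inl ⟨i, j, hji.symm, by omega, by simpa using hj⟩

end Cases

end TreeLabel

namespace SimpleGraph

open TreeLabel

variable {V : Type*} [DecidableEq V] {G : SimpleGraph V}

/-- The meaning of the entry `c` at level `k + 1` of the label of a tree with vertex set `S` and
root `r`. Here `R` and `R'` are the residual trees at the levels `k` and `k + 1`; the width of `R'`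
is at most `k + 1`, and it is more than `k` unless `c = 0`. For `c ≠ 0`, consider a path of `R'`
such that the components outside its closed neighbourhood have width at most `k`: for `c = 1` the
vertex `r` may be a side neighbour of a path that lies outside the tree, for `c = 2` the path may
start in `r`, for `c = 4` it has to pass through `r`, and for `c = 5` it avoids `r`, and only `R`
matters for whatever is attached at `r`. Every case is recorded by what it implies for layouts of
larger sets. -/
def LevelSem (G : SimpleGraph V) (S : Finset V) (r : V) (R R' : Finset V) (k : ℕ) : ℕ → Prop
  | 0 => R' = R
  | 1 => G.LmwLE (R'.erase r) k ∧ ¬ G.LmwLE R' k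
  | 2 => (∃ l : List V, l.Nodup ∧ (∀ v, v ∈ l ↔ v ∈ R') ∧ G.CutsLE (k + 1) l ∧
        ∀ p, p ∉ S → G.CutsLE (k + 1) (p :: l)) ∧
      ∃ T ⊆ R', r ∉ T ∧ G.ConnOn (insert r (T : Set V)) ∧ ¬ G.LmwLE T k
  | 4 => (∃ a b : List V, (a ++ b).Nodup ∧ (∀ v, v ∈ a ++ b ↔ v ∈ R') ∧
        ∀ g : List V, (∀ v ∈ g, v ∉ S) → G.IsFan k r g → G.CutsLE (k + 1) (a ++ (g ++ b))) ∧
      ¬ G.LmwLE R' k ∧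
      ∀ p Y, p ∉ S → Disjoint Y S → G.Adj r p → (∀ y ∈ Y, ∀ x ∈ S, ¬ G.Adj x y) →
        G.ConnOn (insert p (Y : Set V)) → ¬ G.LmwLE Y k → ¬ G.LmwLE (R' ∪ insert p Y) (k + 1)
  | 5 => (∀ Y, Disjoint Y S → G.LmwLE (R ∪ Y) k → G.LmwLE (R' ∪ Y) (k + 1)) ∧
      ¬ G.LmwLE R' k ∧
      ∀ Y, Disjoint Y S → G.ConnOn (insert r (Y : Set V)) → ¬ G.LmwLE (R ∪ Y) k →
        ¬ G.LmwLE (R' ∪ Y) (k + 1)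
  | _ => False

/-- `R k` is the residual tree at level `k` of the tree with vertex set `S`, root `r` and label `a`:
what remains of it after deletion of the subtrees accounted for at the levels above `k`. -/
structure IsResidual (G : SimpleGraph V) (S : Finset V) (r : V) (a : ℕ → ℕ)
    (R : ℕ → Finset V) : Prop where
  subset : ∀ k, R k ⊆ S
  conn : ∀ k, R k = ∅ ∨ r ∈ R k ∧ G.ConnOn (R k : Set V)
  eventually : ∃ K, ∀ k, K ≤ k → R k = S
  zero : a 0 = 0 ∧ R 0 = ∅ ∨ a 0 = 1 ∧ R 0 = {r}
  succ : ∀ k, G.LevelSem S r (R k) (R (k + 1)) k (a (k + 1))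

lemma LevelSem.ne_three {S : Finset V} {r : V} {R R' : Finset V} {k c : ℕ}
    (h : G.LevelSem S r R R' k c) : c ≠ 3 := by
  rintro rfl; exact h

lemma LevelSem.le_five {S : Finset V} {r : V} {R R' : Finset V} {k c : ℕ}
    (h : G.LevelSem S r R R' k c) : c ≤ 5 := by
  by_contra! hc
  obtain ⟨c, rfl⟩ := Nat.exists_eq_add_of_lt hc
  rw [show 5 + c + 1 = c + 6 by ring] at h
  exact h

lemma LevelSem.not_lmwLE {S : Finset V} {r : V} {R R' : Finset V} {k c : ℕ}
    (h : G.LevelSem S r R R' k c) (hc : c ≠ 0) : ¬ G.LmwLE R' k := by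
  have h3 := h.ne_three
  have h5 := h.le_five
  obtain rfl | rfl | rfl | rfl : c = 1 ∨ c = 2 ∨ c = 4 ∨ c = 5 := by omega
  · exact h.2
  · obtain ⟨T, hT, -, -, hT'⟩ := h.2
    exact fun hW => hT' (hW.subset hT)
  · exact h.2.1
  · exact h.2.1

namespace IsResidual

variable {S : Finset V} {r : V} {a : ℕ → ℕ} {R : ℕ → Finset V}

lemma lmwLE (h : G.IsResidual S r a R) (k : ℕ) : G.LmwLE (R k) k := by
  induction k with
  | zero =>
    rcases h.zero with ⟨-, h⟩ | ⟨-, h⟩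
    · rw [h]; exact lmwLE_empty 0
    · rw [h]; exact lmwLE_singleton r 0
  | succ k ih =>
    have hk := h.succ k
    have h3 := hk.ne_three
    have h5 := hk.le_five
    obtain hc | hc | hc | hc | hc : a (k + 1) = 0 ∨ a (k + 1) = 1 ∨ a (k + 1) = 2 ∨
      a (k + 1) = 4 ∨ a (k + 1) = 5 := by omega
    all_goals rw [hc] at hk
    · rw [show R (k + 1) = R k from hk]
      exact ih.mono (Nat.le_succ k)
    · obtain ⟨⟨l, h1, h2, h3⟩, -⟩ := hk
      rcases h.conn (k + 1) with hR | ⟨hr, -⟩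
      · rw [hR]; exact lmwLE_empty _
      · refine ⟨l ++ [r], List.nodup_append'.2 ⟨h1, by simp, ?_⟩, fun v => ?_, h3.concat r⟩
        · simp [List.disjoint_singleton, h2]
        · by_cases hv : v = r <;> simp [h2, hv, hr]
    · obtain ⟨⟨l, h1, h2, h3, -⟩, -⟩ := hk
      exact ⟨l, h1, h2, h3⟩
    · obtain ⟨⟨a, b, h1, h2, h3⟩, -⟩ := hk
      exact ⟨a ++ b, h1, h2, by simpa using h3 [] (by simp) (isFan_nil k r)⟩
    · simpa using hk.1 ∅ (by simp) (by simpa using ih)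

lemma not_lmwLE (h : G.IsResidual S r a R) {k : ℕ} (hk : a (k + 1) ≠ 0) :
    ¬ G.LmwLE (R (k + 1)) k := (h.succ k).not_lmwLE hk

lemma conn_of_ne_zero (h : G.IsResidual S r a R) {k : ℕ} (hk : a k ≠ 0) :
    r ∈ R k ∧ G.ConnOn (R k : Set V) := by
  refine (h.conn k).resolve_left fun h0 => ?_
  cases k with
  | zero =>
    rcases h.zero with h | h
    · exact hk h.1
    · rw [h.2] at h0; simp at h0
  | succ k => exact h.not_lmwLE hk (h0 ▸ lmwLE_empty k)

/-- A child whose residual tree minus the root has width at most `k` can be laid out as a fan. -/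
lemma exists_fan (h : G.IsResidual S r a R) {k : ℕ} (hk : a (k + 1) ≤ 1) {p : V}
    (hp : G.Adj p r) : ∃ g : List V, g.Nodup ∧ (∀ v, v ∈ g ↔ v ∈ R (k + 1)) ∧ G.IsFan k p g := by
  have hW : G.LmwLE ((R (k + 1)).erase r) k := by
    have hs := h.succ k
    obtain hc | hc : a (k + 1) = 0 ∨ a (k + 1) = 1 := by omega
    all_goals rw [hc] at hs
    · rw [show R (k + 1) = R k from hs]
      exact (h.lmwLE k).subset (Finset.erase_subset _ _)
    · exact hs.1
  rcases h.conn (k + 1) with hR | ⟨hr, -⟩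
  · exact ⟨[], by simp, by simp [hR], isFan_nil k p⟩
  · obtain ⟨l, h1, h2, h3⟩ := hW
    refine ⟨l ++ [r], List.nodup_append'.2 ⟨h1, by simp, ?_⟩, fun v => ?_, h3.isFan hp⟩
    · simp [List.disjoint_singleton, h2]
    · by_cases hv : v = r <;> simp [h2, hv, hr]

end IsResidual

end SimpleGraph

namespace SimpleGraph
open TreeLabel
variable {V : Type*} [DecidableEq V] {G : SimpleGraph V}

/-! ### Combining the labels of the children -/

/-- The tree with vertex set `S` and root `r` has the children `c i`, whose subtrees have vertex
sets `C i`, labels `a i` and residual trees `R i`. The clause `only` says that the subtree of `c i`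
is attached to the rest of the whole graph `G` by the edge to `r` only. -/
structure IsBranching (G : SimpleGraph V) (S : Finset V) (r : V) {ι : Type} [Fintype ι]
    (C : ι → Finset V) (c : ι → V) (a : ι → ℕ → ℕ) (R : ι → ℕ → Finset V) : Prop where
  residual : ∀ i, G.IsResidual (C i) (c i) (a i) (R i)
  disj : ∀ i j, i ≠ j → Disjoint (C i) (C j)
  root_notMem : ∀ i, r ∉ C i
  adj : ∀ i, G.Adj r (c i)
  only : ∀ i, ∀ x ∈ C i, ∀ y, y ∉ C i → G.Adj x y → x = c i ∧ y = r
  cover : S = insert r (Finset.univ.biUnion C)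

namespace IsBranching

variable {S : Finset V} {r : V} {ι : Type} [Fintype ι] {C : ι → Finset V} {c : ι → V}
  {a : ι → ℕ → ℕ} {R : ι → ℕ → Finset V}

/-- The root with the residual trees of its children at level `k`. -/
def union (r : V) (R : ι → ℕ → Finset V) (k : ℕ) : Finset V :=
  insert r (Finset.univ.biUnion fun i => R i k)

lemma mem_union {k : ℕ} {v : V} : v ∈ union r R k ↔ v = r ∨ ∃ i, v ∈ R i k := by
  simp [union]

variable (h : G.IsBranching S r C c a R)

include h

lemma child_subset (i : ι) : C i ⊆ S := by
  rw [h.cover]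
  exact (Finset.subset_biUnion_of_mem C (Finset.mem_univ i)).trans (Finset.subset_insert _ _)

lemma sep {i j : ι} (hij : i ≠ j) {x y : V} (hx : x ∈ C i) (hy : y ∈ C j) : ¬ G.Adj x y := by
  intro hxy
  have hy' : y ∉ C i := fun hy' => Finset.disjoint_left.1 (h.disj i j hij) hy' hy
  exact h.root_notMem j ((h.only i x hx y hy' hxy).2 ▸ hy)

lemma ne_three (i : ι) (k : ℕ) : a i (k + 1) ≠ 3 := ((h.residual i).succ k).ne_three

lemma union_subset (k : ℕ) : union r R k ⊆ S := by
  intro v hv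
  rcases mem_union.1 hv with rfl | ⟨i, hi⟩
  · rw [h.cover]; simp
  · exact h.child_subset i ((h.residual i).subset k hi)

lemma conn_subfamily (k : ℕ) (J : Finset ι) :
    G.ConnOn (insert r (J.biUnion fun i => R i k : Finset V) : Set V) := by
  classical
  induction J using Finset.induction_on with
  | empty => simpa using connOn_singleton r
  | insert i J hi ih =>
    rcases (h.residual i).conn k with h0 | ⟨h1, h2⟩
    · simpa [Finset.biUnion_insert, h0] using ih
    · have := (h2.insert h1 (h.adj i).symm).union ih (x := r) (by simp) (by simp)
      convert this using 1
      ext v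
      simp only [Finset.biUnion_insert, Finset.coe_union, Set.mem_insert_iff, Set.mem_union]
      tauto

lemma conn_union (k : ℕ) : G.ConnOn (union r R k : Set V) := by
  simpa [union] using h.conn_subfamily k Finset.univ

/-- The residual trees of several children can be laid out together as a fan. -/
lemma exists_fan {k : ℕ} (J : Finset ι) (hJ : ∀ i ∈ J, a i (k + 1) ≤ 1) :
    ∃ g : List V, g.Nodup ∧ (∀ v, v ∈ g ↔ ∃ i ∈ J, v ∈ R i (k + 1)) ∧ G.IsFan k r g := by
  classical
  induction J using Finset.induction_on with
  | empty => exact ⟨[], by simp, by simp, isFan_nil k r⟩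
  | insert i J hi ih =>
    obtain ⟨g, g1, g2, g3⟩ := ih fun j hj => hJ j (by simp [hj])
    obtain ⟨l, l1, l2, l3⟩ := (h.residual i).exists_fan (hJ i (by simp)) (h.adj i)
    have hne : ∀ j ∈ J, i ≠ j := fun j hj hij => hi (hij ▸ hj)
    refine ⟨l ++ g, List.nodup_append'.2 ⟨l1, g1, fun v hv hv' => ?_⟩, fun v => ?_,
      l3.append g3 fun x hx y hy => ?_⟩
    · obtain ⟨j, hj, hv'⟩ := (g2 v).1 hv'
      exact Finset.disjoint_left.1 (h.disj i j (hne j hj)) ((h.residual i).subset _ ((l2 v).1 hv))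
        ((h.residual j).subset _ hv')
    · simp [l2, g2]
    · obtain ⟨j, hj, hy⟩ := (g2 y).1 hy
      exact h.sep (hne j hj) ((h.residual i).subset _ ((l2 x).1 hx)) ((h.residual j).subset _ hy)

lemma union_eq_of_total_eq_zero {k : ℕ} (hm : total (fun i => a i (k + 1)) = 0) :
    union r R (k + 1) = union r R k := by
  unfold union
  congr 1
  refine Finset.biUnion_congr rfl fun i _ => ?_
  have := (h.residual i).succ k
  rw [total_eq_zero hm i] at this
  exact this

lemma adj_root_eq {i : ι} {u v : V} (hu : u ∉ C i) (hv : v ∈ C i) (huv : G.Adj u v) :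
    v = c i := (h.only i v hv u hu huv.symm).1

/-- A child with entry `2` contributes a branch of the obstruction at the root. -/
lemma exists_branch {i : ι} {k : ℕ} (hi : a i (k + 1) = 2) :
    ∃ T ⊆ R i (k + 1), c i ∉ T ∧ G.ConnOn (insert r (insert (c i) T) : Finset V) ∧
      ¬ G.LmwLE T k := by
  have := (h.residual i).succ k
  rw [hi] at this
  obtain ⟨-, T, hT, hc, hconn, hT'⟩ := this
  refine ⟨T, hT, hc, ?_, hT'⟩
  simpa using hconn.insert (x := c i) (y := r) (by simp) (h.adj i).symm

lemma branch_subset {i : ι} {k : ℕ} {T : Finset V} (hT : T ⊆ R i (k + 1)) {v : V} (hv : v ∈ T) :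
    v ∈ C i := (h.residual i).subset _ (hT hv)

/-- Overflow by a child with entry `4` or `5` and another child with a nonzero entry. -/
lemma not_lmwLE_of_four_le {i j : ι} (hij : i ≠ j) {k : ℕ} (hi : 4 ≤ a i (k + 1))
    (hj : a j (k + 1) ≠ 0) : ¬ G.LmwLE (union r R (k + 1)) (k + 1) := by
  have hs := (h.residual i).succ k
  have h5 := hs.le_five
  obtain ⟨hcj, hconn⟩ := (h.residual j).conn_of_ne_zero hj
  have hRj := (h.residual j).not_lmwLE hj
  have hconn' := hconn.insert hcj (h.adj j).symm
  have hdisj : Disjoint (R j (k + 1)) (C i) :=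
    (h.disj j i hij.symm).mono_left ((h.residual j).subset _)
  have hsub : R i (k + 1) ∪ insert r (R j (k + 1)) ⊆ union r R (k + 1) := by
    intro v hv
    rw [Finset.mem_union, Finset.mem_insert] at hv
    rw [mem_union]
    rcases hv with hv | rfl | hv
    · exact .inr ⟨i, hv⟩
    · exact .inl rfl
    · exact .inr ⟨j, hv⟩
  obtain hc | hc : a i (k + 1) = 4 ∨ a i (k + 1) = 5 := by omega
  all_goals rw [hc] at hs
  · have := hs.2.2 r (R j (k + 1)) (h.root_notMem i) hdisj (h.adj i).symm
      (fun y hy x hx => h.sep hij hx ((h.residual j).subset _ hy)) hconn' hRj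
    exact fun hW => this (hW.subset hsub)
  · have := hs.2.2 (insert r (R j (k + 1)))
      (Finset.disjoint_insert_left.2 ⟨h.root_notMem i, hdisj⟩)
      (by rw [Finset.coe_insert]; exact hconn'.insert (by simp) (h.adj i))
      (fun hW => hRj (hW.subset (by
        intro v hv; simp [hv])))
    exact fun hW => this (hW.subset hsub)

/-- Overflow by three children with entry `2`. -/
lemma not_lmwLE_of_three {k : ℕ} {i : Fin 3 → ι} (hinj : Function.Injective i)
    (hi : ∀ j, a (i j) (k + 1) = 2) : ¬ G.LmwLE (union r R (k + 1)) (k + 1) := by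
  choose T hT hcT hconn hW using fun j => h.exists_branch (hi j)
  refine not_lmwLE_of_tripod (x := r) (B := fun j => insert r (insert (c (i j)) (T j))) (T := T)
    hconn (by simp) (fun j v hv => by simp [hv]) ?_ ?_ hW
  · intro j v hv
    rw [mem_union]
    simp only [Finset.mem_insert] at hv
    rcases hv with rfl | rfl | hv
    · exact .inl rfl
    · exact .inr ⟨i j, ((h.residual (i j)).conn_of_ne_zero (by rw [hi j]; norm_num)).1⟩
    · exact .inr ⟨i j, hT j hv⟩
  · intro j m hjm u hu v hv huv
    have hne : i j ≠ i m := fun h => hjm (hinj h)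
    refine hcT m (h.adj_root_eq (i := i m) ?_ (h.branch_subset (hT m) hv) huv ▸ hv)
    simp only [Finset.mem_insert] at hu
    have hmem : ∀ u ∈ C (i j), u ∉ C (i m) := fun u hu =>
      Finset.disjoint_left.1 (h.disj _ _ hne) hu
    rcases hu with rfl | rfl | hu
    · exact h.root_notMem _
    · exact hmem _ ((h.residual (i j)).subset _
        ((h.residual (i j)).conn_of_ne_zero (by rw [hi j]; norm_num)).1)
    · exact hmem _ (h.branch_subset (hT j) hu)

/-- Overflow by a child with entry `5` when the level below overflows as well. -/
lemma not_lmwLE_of_five {i : ι} {k : ℕ} (hi : a i (k + 1) = 5)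
    (hj : ∀ j, j ≠ i → a j (k + 1) = 0) (hW : ¬ G.LmwLE (union r R k) k) :
    ¬ G.LmwLE (union r R (k + 1)) (k + 1) := by
  classical
  have hs := (h.residual i).succ k
  rw [hi] at hs
  have hcov : ∀ v ∈ union r R k, v ∈ R i k ∪
      insert r ((Finset.univ.erase i).biUnion fun j => R j k) := by
    intro v hv
    rw [mem_union] at hv
    rw [Finset.mem_union, Finset.mem_insert, Finset.mem_biUnion]
    rcases hv with rfl | ⟨j, hv⟩
    · exact .inr (.inl rfl)
    · by_cases hji : j = i
      · exact .inl (hji ▸ hv)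
      · exact .inr (.inr ⟨j, by simp [hji], hv⟩)
  have := hs.2.2 (insert r ((Finset.univ.erase i).biUnion fun j => R j k)) ?_ ?_
    fun hW' => hW (hW'.subset hcov)
  · refine fun hW' => this (hW'.subset fun v hv => ?_)
    rw [Finset.mem_union, Finset.mem_insert, Finset.mem_biUnion] at hv
    rw [mem_union]
    rcases hv with hv | hv | ⟨j, hj', hv⟩
    · exact .inr ⟨i, hv⟩
    · exact .inl hv
    · have := (h.residual j).succ k
      rw [hj j (Finset.ne_of_mem_erase hj')] at this
      exact .inr ⟨j, (show R j (k + 1) = R j k from this) ▸ hv⟩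
  · refine Finset.disjoint_insert_left.2 ⟨h.root_notMem i, ?_⟩
    refine (Finset.disjoint_biUnion_left _ _ _).2 fun j hj' => ?_
    exact (h.disj j i (Finset.ne_of_mem_erase hj')).mono_left ((h.residual j).subset _)
  · rw [Finset.coe_insert]
    exact (h.conn_subfamily k _).insert (by simp) (h.adj i)

lemma not_lmwLE_of_carry (k : ℕ)
    (hk : carry (fun k => total fun i => a i k) (fun k => weight fun i => a i k) k = true) :
    ¬ G.LmwLE (union r R k) k := by
  induction k with
  | zero =>
    have h0 : total (fun i => a i 0) ≠ 0 := by simpa [carry] using hk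
    obtain ⟨i, hi⟩ := exists_of_total_ne_zero h0
    exact not_lmwLE_zero (mem_union.2 (.inl rfl))
      (mem_union.2 (.inr ⟨i, ((h.residual i).conn_of_ne_zero hi).1⟩)) (h.adj i)
  | succ k ih =>
    simp only [carry, levelCarry, decide_eq_true_eq] at hk
    obtain ⟨h0, h3, h13, h14⟩ := hk
    by_cases h1 : total (fun i => a i (k + 1)) = 1
    · obtain ⟨i, hi, hj⟩ := exists_of_total_eq_one h1
      have h5 := ((h.residual i).succ k).le_five
      have h4 : weight (fun i => a i (k + 1)) = 4 := by
        have : weight (fun i => a i (k + 1)) ≠ 3 := fun h => h13 ⟨h1, h⟩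
        omega
      refine h.not_lmwLE_of_five (by omega) hj (ih ?_)
      by_contra hc
      exact h14 ⟨h1, h4, by simpa using hc⟩
    · classical
      rcases cases_of_two_le_total (fun i => h.ne_three i k) (by omega) with
        ⟨i, j, hij, hi, hj⟩ | hle
      · exact h.not_lmwLE_of_four_le hij hi hj
      · rw [weight_eq_card hle] at h3
        obtain ⟨s, hs, hs3⟩ := Finset.exists_subset_card_eq h3
        have e := (Finset.equivFinOfCardEq hs3).symm
        exact h.not_lmwLE_of_three (i := fun j => (e j : ι))
          (Subtype.val_injective.comp e.injective)
          fun j => (Finset.mem_filter.1 (hs (e j).2)).2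

/-! ### Layouts of the combined tree -/

variable (hS : ∀ x ∈ S, ∀ y, y ∉ S → G.Adj x y → x = r)

lemma exists_leg {i : ι} {k : ℕ} (hi : a i (k + 1) = 2) :
    ∃ l : List V, l.Nodup ∧ (∀ v, v ∈ l ↔ v ∈ R i (k + 1)) ∧ G.CutsLE (k + 1) (r :: l) := by
  have := (h.residual i).succ k
  rw [hi] at this
  obtain ⟨⟨l, h1, h2, -, h3⟩, -⟩ := this
  exact ⟨l, h1, h2, h3 r (h.root_notMem i)⟩

include hS

/-- If at most one child requires the path to continue into it, the path may start at the root. -/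
lemma levelSem_two {k : ℕ} (h0 : total (fun i => a i (k + 1)) ≠ 0)
    (h1 : weight (fun i => a i (k + 1)) ≤ 1) (Q : Finset V) :
    G.LevelSem S r Q (union r R (k + 1)) k 2 := by
  classical
  have hle := le_two_of_weight_le (fun i => h.ne_three i k) (by omega)
  have hcard := weight_eq_card hle
  constructor
  · obtain ⟨g, g1, g2, g3⟩ := h.exists_fan (k := k) (Finset.univ.filter fun i => a i (k + 1) ≠ 2)
      fun i hi => by
        have := hle i
        have := (Finset.mem_filter.1 hi).2
        omega
    have hgS : ∀ v ∈ g, v ∈ S ∧ v ≠ r := fun v hv => by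
      obtain ⟨i, -, hi⟩ := (g2 v).1 hv
      have := (h.residual i).subset _ hi
      exact ⟨h.child_subset i this, fun hr => h.root_notMem i (hr ▸ this)⟩
    -- the layout of the child into which the path continues, if there is one
    obtain ⟨l, l1, l2, l3⟩ : ∃ l : List V, l.Nodup ∧
        (∀ v, v ∈ l ↔ ∃ i, a i (k + 1) = 2 ∧ v ∈ R i (k + 1)) ∧ G.CutsLE (k + 1) (r :: l) := by
      by_cases hex : ∃ i, a i (k + 1) = 2
      · obtain ⟨i, hi⟩ := hex
        obtain ⟨l, l1, l2, l3⟩ := h.exists_leg hi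
        refine ⟨l, l1, fun v => (l2 v).trans ⟨fun hv => ⟨i, hi, hv⟩, ?_⟩, l3⟩
        rintro ⟨j, hj, hv⟩
        rwa [Finset.card_le_one.1 (hcard ▸ h1) i (by simp [hi]) j (by simp [hj])]
      · push Not at hex
        exact ⟨[], by simp, by simp [hex], (cutsLE_zero_singleton r).mono (Nat.zero_le _)⟩
    have hlS : ∀ v ∈ l, v ∈ S ∧ v ≠ r := fun v hv => by
      obtain ⟨i, -, hi⟩ := (l2 v).1 hv
      have := (h.residual i).subset _ hi
      exact ⟨h.child_subset i this, fun hr => h.root_notMem i (hr ▸ this)⟩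
    have hgl : ∀ x ∈ g, ∀ y ∈ l, x ≠ y ∧ ¬ G.Adj x y := by
      intro x hx y hy
      obtain ⟨i, hi, hx⟩ := (g2 x).1 hx
      obtain ⟨j, hj, hy⟩ := (l2 y).1 hy
      have hij : i ≠ j := by rintro rfl; exact (Finset.mem_filter.1 hi).2 hj
      have hx' := (h.residual i).subset _ hx
      have hy' := (h.residual j).subset _ hy
      exact ⟨fun hxy => Finset.disjoint_left.1 (h.disj i j hij) hx' (hxy ▸ hy'),
        h.sep hij hx' hy'⟩
    refine ⟨r :: (g ++ l), ?_, fun v => ?_, ?_, fun p hp => ?_⟩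
    · rw [List.nodup_cons, List.nodup_append']
      refine ⟨fun hr => ?_, g1, l1, fun v hv hv' => (hgl v hv v hv').1 rfl⟩
      rcases List.mem_append.1 hr with hr | hr
      · exact (hgS r hr).2 rfl
      · exact (hlS r hr).2 rfl
    · rw [mem_union, List.mem_cons, List.mem_append, g2, l2]
      simp only [Finset.mem_filter, Finset.mem_univ, true_and]
      refine or_congr_right ⟨?_, ?_⟩
      · rintro (⟨i, -, hv⟩ | ⟨i, -, hv⟩) <;> exact ⟨i, hv⟩
      · rintro ⟨i, hv⟩
        by_cases hi : a i (k + 1) = 2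
        · exact .inr ⟨i, hi, hv⟩
        · exact .inl ⟨i, hi, hv⟩
    · exact cutsLE_path (l₁ := []) ((cutsLE_zero_singleton r).mono (Nat.zero_le _)) g3 l3
        (by simp) (by simp) fun x hx y hy => (hgl x hx y hy).2
    · have hpS : ∀ x ∈ S, x ≠ r → ¬ G.Adj p x := fun x hx hxr hpx =>
        hxr (hS x hx p hp hpx.symm)
      exact cutsLE_path (l₁ := [p]) (cutsLE_pair k r p) g3 l3
        (fun x hx y hy => List.mem_singleton.1 hx ▸ hpS y (hgS y hy).1 (hgS y hy).2)
        (fun x hx y hy => List.mem_singleton.1 hx ▸ hpS y (hlS y hy).1 (hlS y hy).2)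
        fun x hx y hy => (hgl x hx y hy).2
  · obtain ⟨i, hi⟩ := exists_of_total_ne_zero h0
    obtain ⟨hc, hconn⟩ := (h.residual i).conn_of_ne_zero hi
    refine ⟨R i (k + 1), fun v hv => mem_union.2 (.inr ⟨i, hv⟩),
      fun hr => h.root_notMem i ((h.residual i).subset _ hr), hconn.insert hc (h.adj i).symm,
      (h.residual i).not_lmwLE hi⟩

/-- If two children require the path to continue into them, the path passes through the root. -/
lemma levelSem_four {k : ℕ} (h2 : weight (fun i => a i (k + 1)) = 2) (Q : Finset V) :
    G.LevelSem S r Q (union r R (k + 1)) k 4 := by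
  classical
  have hle := le_two_of_weight_le (fun i => h.ne_three i k) h2.le
  have hcard := (weight_eq_card hle).symm.trans h2
  obtain ⟨i, j, hij, hfil⟩ := Finset.card_eq_two.1 hcard
  have hmem : ∀ m, a m (k + 1) = 2 ↔ m = i ∨ m = j := fun m => by
    have := congrArg (m ∈ ·) hfil
    simpa using this
  have hi : a i (k + 1) = 2 := (hmem i).2 (.inl rfl)
  have hj : a j (k + 1) = 2 := (hmem j).2 (.inr rfl)
  have hinS : ∀ m, ∀ v ∈ R m (k + 1), v ∈ S ∧ v ≠ r := fun m v hv => by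
    have := (h.residual m).subset _ hv
    exact ⟨h.child_subset m this, fun hr => h.root_notMem m (hr ▸ this)⟩
  have hsep : ∀ m n, m ≠ n → ∀ x ∈ R m (k + 1), ∀ y ∈ R n (k + 1), x ≠ y ∧ ¬ G.Adj x y := by
    intro m n hmn x hx y hy
    have hx' := (h.residual m).subset _ hx
    have hy' := (h.residual n).subset _ hy
    exact ⟨fun hxy => Finset.disjoint_left.1 (h.disj m n hmn) hx' (hxy ▸ hy'), h.sep hmn hx' hy'⟩
  refine ⟨?_, ?_, ?_⟩
  · obtain ⟨g, g1, g2, g3⟩ := h.exists_fan (k := k) (Finset.univ.filter fun i => a i (k + 1) ≠ 2)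
      fun i hi => by
        have := hle i
        have := (Finset.mem_filter.1 hi).2
        omega
    simp only [Finset.mem_filter, Finset.mem_univ, true_and] at g2
    obtain ⟨l, l1, l2, l3⟩ := h.exists_leg hi
    obtain ⟨l', l1', l2', l3'⟩ := h.exists_leg hj
    have hgl : ∀ x ∈ g, ∀ m, a m (k + 1) = 2 → ∀ y ∈ R m (k + 1), x ≠ y ∧ ¬ G.Adj x y := by
      intro x hx m hm y hy
      obtain ⟨n, hn, hx⟩ := (g2 x).1 hx
      exact hsep n m (by rintro rfl; exact hn hm) x hx y hy
    refine ⟨l'.reverse ++ r :: g, l, ?_, fun v => ?_, fun f hf hfan => ?_⟩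
    · rw [List.append_assoc, List.cons_append, List.nodup_append', List.nodup_cons,
        List.nodup_append', List.nodup_reverse]
      refine ⟨l1', ⟨fun hr => ?_, g1, l1, fun v hv hv' => (hgl v hv i hi v ((l2 v).1 hv')).1 rfl⟩,
        fun v hv hv' => ?_⟩
      · rw [List.mem_append, g2, l2] at hr
        rcases hr with ⟨m, -, hr⟩ | hr
        · exact (hinS m r hr).2 rfl
        · exact (hinS i r hr).2 rfl
      · rw [List.mem_reverse, l2'] at hv
        rw [List.mem_cons, List.mem_append, l2] at hv'
        rcases hv' with rfl | hv' | hv'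
        · exact (hinS j v hv).2 rfl
        · exact (hgl v hv' j hj v hv).1 rfl
        · exact (hsep i j hij v hv' v hv).1 rfl
    · rw [mem_union, List.mem_append, List.mem_append, List.mem_cons, List.mem_reverse, l2, l2', g2]
      constructor
      · rintro ((hv | rfl | ⟨m, -, hv⟩) | hv)
        · exact .inr ⟨j, hv⟩
        · exact .inl rfl
        · exact .inr ⟨m, hv⟩
        · exact .inr ⟨i, hv⟩
      · rintro (rfl | ⟨m, hv⟩)
        · exact .inl (.inr (.inl rfl))
        · by_cases hm : a m (k + 1) = 2
          · rcases (hmem m).1 hm with rfl | rfl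
            · exact .inr hv
            · exact .inl (.inl hv)
          · exact .inl (.inr (.inr ⟨m, hm, hv⟩))
    · have hfS : ∀ m, ∀ x ∈ R m (k + 1), ∀ y ∈ f, ¬ G.Adj x y := fun m x hx y hy hxy =>
        (hinS m x hx).2 (hS x (hinS m x hx).1 y (hf y hy) hxy)
      have := cutsLE_path (l₁ := l') (h := g ++ f) (l₂ := l) l3'
        (g3.append hfan fun x hx y hy => by
          obtain ⟨m, -, hx⟩ := (g2 x).1 hx
          exact hfS m x hx y hy) l3 ?_ ?_ ?_
      · simpa using this
      · intro x hx y hy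
        rw [l2'] at hx
        rcases List.mem_append.1 hy with hy | hy
        · exact fun hxy => (hgl y hy j hj x hx).2 hxy.symm
        · exact hfS j x hx y hy
      · intro x hx y hy
        exact (hsep j i hij.symm x ((l2' x).1 hx) y ((l2 y).1 hy)).2
      · intro x hx y hy
        rw [l2] at hy
        rcases List.mem_append.1 hx with hx | hx
        · exact (hgl x hx i hi y hy).2
        · exact fun hxy => hfS i y hy x hx hxy.symm
  · exact fun hW => (h.residual i).not_lmwLE (k := k) (by rw [hi]; norm_num)
      (hW.subset fun v hv => mem_union.2 (.inr ⟨i, hv⟩))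
  · intro p Y hp hY hrp hYS hconn hWY
    obtain ⟨T, hT, hcT, hTconn, hTW⟩ := h.exists_branch hi
    obtain ⟨T', hT', hcT', hTconn', hTW'⟩ := h.exists_branch hj
    have hcS : ∀ m, a m (k + 1) = 2 → c m ∈ R m (k + 1) := fun m hm =>
      ((h.residual m).conn_of_ne_zero (k := k + 1) (by rw [hm]; norm_num)).1
    have hbr : ∀ m, a m (k + 1) = 2 → ∀ U ⊆ R m (k + 1), ∀ v ∈ insert r (insert (c m) U),
        v ∈ union r R (k + 1) := by
      intro m hm U hU v hv
      simp only [Finset.mem_insert] at hv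
      rw [mem_union]
      rcases hv with rfl | rfl | hv
      · exact .inl rfl
      · exact .inr ⟨m, hcS m hm⟩
      · exact .inr ⟨m, hU hv⟩
    -- no vertex outside the subtree of a child is adjacent to the branch inside it
    have hout : ∀ m, ∀ U ⊆ R m (k + 1), c m ∉ U → ∀ u, u ∉ C m → ∀ v ∈ U, ¬ G.Adj u v :=
      fun m U hU hcU u hu v hv huv =>
        hcU (h.adj_root_eq hu (h.branch_subset hU hv) huv ▸ hv)
    have hbrC : ∀ m n, m ≠ n → a m (k + 1) = 2 → ∀ U ⊆ R m (k + 1),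
        ∀ v ∈ insert r (insert (c m) U), v ∉ C n := by
      intro m n hmn hm U hU v hv
      simp only [Finset.mem_insert] at hv
      have hd : ∀ u ∈ C m, u ∉ C n := fun u hu =>
        Finset.disjoint_left.1 (h.disj m n hmn) hu
      rcases hv with rfl | rfl | hv
      · exact h.root_notMem n
      · exact hd _ ((h.residual m).subset _ (hcS m hm))
      · exact hd _ (h.branch_subset hU hv)
    have hpC : ∀ m, ∀ v ∈ insert r (insert p Y), v ∉ C m := by
      intro m v hv hvC
      simp only [Finset.mem_insert] at hv
      have hvS := h.child_subset m hvC
      rcases hv with rfl | rfl | hv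
      · exact h.root_notMem m hvC
      · exact hp hvS
      · exact Finset.disjoint_left.1 hY hv hvS
    have hYbr : ∀ v ∈ union r R (k + 1), ∀ y ∈ Y, ¬ G.Adj v y := fun v hv y hy =>
      hYS y hy v (h.union_subset _ hv)
    refine not_lmwLE_of_tripod (x := r)
      (B := ![insert r (insert (c i) T), insert r (insert (c j) T'), insert r (insert p Y)])
      (T := ![T, T', Y]) ?_ ?_ ?_ ?_ ?_ ?_
    · intro m
      fin_cases m
      · exact hTconn
      · exact hTconn'
      · have := hconn.insert (x := p) (y := r) (by simp) hrp.symm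
        simpa using this
    · intro m; fin_cases m <;> simp
    · intro m v hv
      fin_cases m <;> simp at hv ⊢ <;> simp [hv]
    · intro m v hv
      rw [Finset.mem_union]
      fin_cases m
      · exact .inl (hbr i hi T hT v hv)
      · exact .inl (hbr j hj T' hT' v hv)
      · rcases Finset.mem_insert.1 hv with rfl | hv
        · exact .inl (mem_union.2 (.inl rfl))
        · exact .inr hv
    · intro m n hmn u hu v hv
      fin_cases m <;> fin_cases n
      · exact absurd rfl hmn
      · exact hout j T' hT' hcT' u (hbrC i j hij hi T hT u hu) v hv
      · exact hYbr u (hbr i hi T hT u hu) v hv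
      · exact hout i T hT hcT u (hbrC j i hij.symm hj T' hT' u hu) v hv
      · exact absurd rfl hmn
      · exact hYbr u (hbr j hj T' hT' u hu) v hv
      · exact hout i T hT hcT u (hpC i u hu) v hv
      · exact hout j T' hT' hcT' u (hpC j u hu) v hv
      · exact absurd rfl hmn
    · intro m
      fin_cases m
      · exact hTW
      · exact hTW'
      · exact hWY

end IsBranching
end SimpleGraph

namespace SimpleGraph
open TreeLabel
variable {V : Type*} [DecidableEq V] {G : SimpleGraph V}
namespace IsBranching

variable {S : Finset V} {r : V} {ι : Type} [Fintype ι] {C : ι → Finset V} {c : ι → V}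
  {a : ι → ℕ → ℕ} {R : ι → ℕ → Finset V} (h : G.IsBranching S r C c a R)
  (hS : ∀ x ∈ S, ∀ y, y ∉ S → G.Adj x y → x = r)

include h

lemma residual_eq_of_eq_zero {i : ι} {k : ℕ} (hi : a i (k + 1) = 0) : R i (k + 1) = R i k := by
  have := (h.residual i).succ k
  rw [hi] at this
  exact this

/-- Without nonzero entries of the children, an overflow of the level below leaves a tree all of
whose child subtrees have small width. -/
lemma levelSem_one {k : ℕ} (hm : total (fun i => a i (k + 1)) = 0)
    (hW : ¬ G.LmwLE (union r R k) k) (Q : Finset V) :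
    G.LevelSem S r Q (union r R (k + 1)) k 1 := by
  rw [h.union_eq_of_total_eq_zero hm]
  refine ⟨(LmwLE.biUnion Finset.univ (fun i => R i k) (fun i _ => (h.residual i).lmwLE k)
    (fun i j hij => (h.disj i j hij).mono ((h.residual i).subset k) ((h.residual j).subset k))
    fun i j hij x hx y hy => h.sep hij ((h.residual i).subset k hx)
      ((h.residual j).subset k hy)).subset fun v hv => ?_, hW⟩
  rw [Finset.mem_erase, mem_union] at hv
  obtain ⟨i, hi⟩ := hv.2.resolve_left hv.1
  exact Finset.mem_biUnion.2 ⟨i, Finset.mem_univ i, hi⟩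

include hS in
/-- If the path has to pass through a child, it avoids the root, and everything beyond the root
hangs off that child. -/
lemma levelSem_five_of_four {k : ℕ} {i : ι} (hi : a i (k + 1) = 4)
    (hj : ∀ j, j ≠ i → a j (k + 1) = 0) : G.LevelSem S r ∅ (union r R (k + 1)) k 5 := by
  classical
  have hs := (h.residual i).succ k
  rw [hi] at hs
  obtain ⟨⟨l₁, l₂, hnd, hl, hfan⟩, hW, hobs⟩ := hs
  have hRS : ∀ j, ∀ v ∈ R j (k + 1), v ∈ S ∧ v ≠ r := fun j v hv =>
    ⟨h.child_subset j ((h.residual j).subset _ hv),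
      fun hr => h.root_notMem j (hr ▸ (h.residual j).subset _ hv)⟩
  have hrS : r ∈ S := by rw [h.cover]; simp
  refine ⟨fun Y hY hYk => ?_, fun hW' => hW (hW'.subset fun v hv => mem_union.2 (.inr ⟨i, hv⟩)),
    fun Y hY hconn hYW => ?_⟩
  · -- the subtrees of the other children and `Y` form the part hanging off at `r`
    have hU : G.LmwLE ((Finset.univ.erase i).biUnion (fun j => R j (k + 1)) ∪ Y) k := by
      refine (LmwLE.biUnion _ _ (fun j hji => ?_) (fun m n hmn => ?_) fun m n hmn x hx y hy =>
        ?_).union (by simpa using hYk) ?_ ?_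
      · rw [h.residual_eq_of_eq_zero (hj j (Finset.ne_of_mem_erase hji))]
        exact (h.residual j).lmwLE k
      · exact (h.disj m n hmn).mono ((h.residual m).subset _) ((h.residual n).subset _)
      · exact h.sep hmn ((h.residual m).subset _ hx) ((h.residual n).subset _ hy)
      · refine (Finset.disjoint_biUnion_left _ _ _).2 fun j _ => ?_
        exact Finset.disjoint_left.2 fun v hv hvY =>
          Finset.disjoint_left.1 hY hvY (hRS j v hv).1
      · intro x hx y hy hxy
        obtain ⟨j, -, hx⟩ := Finset.mem_biUnion.1 hx
        exact (hRS j x hx).2 (hS x (hRS j x hx).1 y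
          (fun hyS => Finset.disjoint_left.1 hY hy hyS) hxy)
    obtain ⟨g, g1, g2, g3⟩ := hU
    have hgC : ∀ v ∈ g, v ∉ C i ∧ v ≠ r := by
      intro v hv
      rw [g2, Finset.mem_union, Finset.mem_biUnion] at hv
      rcases hv with ⟨j, hji, hv⟩ | hv
      · exact ⟨Finset.disjoint_left.1 (h.disj j i (Finset.ne_of_mem_erase hji))
          ((h.residual j).subset _ hv), (hRS j v hv).2⟩
      · exact ⟨fun hvC => Finset.disjoint_left.1 hY hv (h.child_subset i hvC),
          fun hr => Finset.disjoint_left.1 hY hv (hr ▸ hrS)⟩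
    have hcut := hfan (g ++ [r]) (fun v hv => by
      rcases List.mem_append.1 hv with hv | hv
      · exact (hgC v hv).1
      · rw [List.mem_singleton.1 hv]; exact h.root_notMem i) (g3.isFan (h.adj i).symm)
    have hlC : ∀ v, v ∈ l₁ ++ l₂ → v ∉ g ∧ v ≠ r := fun v hv =>
      ⟨fun hvg => (hgC v hvg).1 ((h.residual i).subset _ ((hl v).1 hv)),
        (hRS i v ((hl v).1 hv)).2⟩
    refine ⟨l₁ ++ ((g ++ [r]) ++ l₂), ?_, fun v => ?_, hcut⟩
    · rw [List.nodup_append', List.nodup_append', List.nodup_append']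
      rw [List.nodup_append'] at hnd
      refine ⟨hnd.1, ⟨⟨g1, by simp, fun v hv hv' => (hgC v hv).2 (by simpa using hv')⟩, hnd.2.1,
        fun v hv hv' => ?_⟩, fun v hv hv' => ?_⟩
      · have := hlC v (by simp [hv'])
        simp [this] at hv
      · have := hlC v (by simp [hv])
        simp only [List.mem_append, List.mem_singleton, this, or_self, false_or] at hv'
        exact hnd.2.2 hv hv'
    · have hl' := hl v
      simp only [List.mem_append] at hl'
      simp only [List.mem_append, List.mem_singleton, g2, Finset.mem_union, Finset.mem_biUnion,
        mem_union, Finset.mem_erase, Finset.mem_univ, and_true]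
      constructor
      · rintro (hv | ((⟨j, -, hv⟩ | hv) | hv) | hv)
        · exact .inl (.inr ⟨i, hl'.1 (.inl hv)⟩)
        · exact .inl (.inr ⟨j, hv⟩)
        · exact .inr hv
        · exact .inl (.inl hv)
        · exact .inl (.inr ⟨i, hl'.1 (.inr hv)⟩)
      · rintro ((hv | ⟨j, hv⟩) | hv)
        · exact .inr (.inl (.inr hv))
        · by_cases hji : j = i
          · subst hji
            rcases hl'.2 hv with hv | hv
            · exact .inl hv
            · exact .inr (.inr hv)
          · exact .inr (.inl (.inl (.inl ⟨j, hji, hv⟩)))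
        · exact .inr (.inl (.inl (.inr hv)))
  · rw [Finset.empty_union] at hYW
    have := hobs r Y (h.root_notMem i) (hY.mono_right (h.child_subset i)) (h.adj i).symm
      (fun y hy x hx hxy => ?_) hconn hYW
    · refine fun hW' => this (hW'.subset fun v hv => ?_)
      rw [Finset.mem_union, Finset.mem_insert] at hv
      rw [Finset.mem_union, mem_union]
      rcases hv with hv | hv | hv
      · exact .inl (.inr ⟨i, hv⟩)
      · exact .inl (.inl hv)
      · exact .inr hv
    · have hyS := Finset.disjoint_left.1 hY hy
      have := (h.only i x hx y (fun hyC => hyS (h.child_subset i hyC)) hxy).2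
      exact hyS (this ▸ hrS)

/-- A path inside the subtree of a child leaves the root to the residual tree of the lower level. -/
lemma levelSem_five_of_five {k : ℕ} {i : ι} (hi : a i (k + 1) = 5)
    (hj : ∀ j, j ≠ i → a j (k + 1) = 0) :
    G.LevelSem S r (union r R k) (union r R (k + 1)) k 5 := by
  classical
  have hs := (h.residual i).succ k
  rw [hi] at hs
  obtain ⟨hup, hW, hobs⟩ := hs
  have hrS : r ∈ S := by rw [h.cover]; simp
  -- the rest of the tree, seen from the child
  set Z := insert r ((Finset.univ.erase i).biUnion fun j => R j k) with hZ
  have hmemZ : ∀ v, v ∈ Z ↔ v = r ∨ ∃ j, j ≠ i ∧ v ∈ R j k := by simp [hZ]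
  have hRk : union r R k = R i k ∪ Z := by
    ext v
    rw [Finset.mem_union, hmemZ, mem_union]
    constructor
    · rintro (hv | ⟨j, hv⟩)
      · exact .inr (.inl hv)
      · by_cases hji : j = i
        · exact .inl (hji ▸ hv)
        · exact .inr (.inr ⟨j, hji, hv⟩)
    · rintro (hv | hv | ⟨j, -, hv⟩)
      · exact .inr ⟨i, hv⟩
      · exact .inl hv
      · exact .inr ⟨j, hv⟩
  have hRk' : union r R (k + 1) = R i (k + 1) ∪ Z := by
    ext v
    rw [Finset.mem_union, hmemZ, mem_union]
    constructor
    · rintro (hv | ⟨j, hv⟩)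
      · exact .inr (.inl hv)
      · by_cases hji : j = i
        · exact .inl (hji ▸ hv)
        · exact .inr (.inr ⟨j, hji, by rwa [← h.residual_eq_of_eq_zero (hj j hji)]⟩)
    · rintro (hv | hv | ⟨j, hji, hv⟩)
      · exact .inr ⟨i, hv⟩
      · exact .inl hv
      · exact .inr ⟨j, by rwa [h.residual_eq_of_eq_zero (hj j hji)]⟩
  have hdisj : ∀ Y, Disjoint Y S → Disjoint (Z ∪ Y) (C i) := by
    intro Y hY
    refine Finset.disjoint_left.2 fun v hv hvC => ?_
    rw [Finset.mem_union, hmemZ] at hv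
    rcases hv with (rfl | ⟨j, hji, hv⟩) | hv
    · exact h.root_notMem i hvC
    · exact Finset.disjoint_left.1 (h.disj j i hji) ((h.residual j).subset _ hv) hvC
    · exact Finset.disjoint_left.1 hY hv (h.child_subset i hvC)
  refine ⟨fun Y hY hYW => ?_, ?_, fun Y hY hconn hYW => ?_⟩
  · rw [hRk']
    rw [hRk] at hYW
    rw [Finset.union_assoc] at hYW ⊢
    exact hup _ (hdisj Y hY) hYW
  · exact fun hW' => hW (hW'.subset fun v hv => mem_union.2 (.inr ⟨i, hv⟩))
  · rw [hRk']
    rw [hRk] at hYW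
    rw [Finset.union_assoc] at hYW ⊢
    refine hobs _ (hdisj Y hY) ?_ hYW
    have hZr : G.ConnOn (Z : Set V) := by
      rw [hZ, Finset.coe_insert]
      exact h.conn_subfamily k _
    have hr : r ∈ (Z : Set V) := by simp [hZ]
    have := (hZr.union hconn hr (by simp)).insert (y := c i) (.inl hr) (h.adj i)
    convert this using 1
    ext v
    simp only [Finset.coe_union, Set.mem_insert_iff, Set.mem_union]
    constructor
    · tauto
    · rintro (hv | hv | rfl | hv)
      · exact .inl hv
      · exact .inr (.inl hv)
      · exact .inr (.inl hr)
      · exact .inr (.inr hv)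

open Classical in
include hS in
/-- The label of a tree computed from the labels of the child subtrees is correct. -/
theorem isResidual {m s : ℕ → ℕ} (hm : ∀ k, m k = total fun i => a i k)
    (hs : ∀ k, s k = weight fun i => a i k) :
    G.IsResidual S r (label m s) fun k => if Alive m s k then union r R k else ∅ := by
  obtain rfl : m = fun k => total fun i => a i k := funext hm
  obtain rfl : s = fun k => weight fun i => a i k := funext hs
  set m : ℕ → ℕ := fun k => total fun i => a i k with hmdef
  set s : ℕ → ℕ := fun k => weight fun i => a i k with hsdef
  refine ⟨fun k => ?_, fun k => ?_, ?_, ?_, fun k => ?_⟩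
  · split_ifs
    · exact h.union_subset k
    · simp
  · split_ifs
    · exact .inr ⟨mem_union.2 (.inl rfl), h.conn_union k⟩
    · exact .inl rfl
  · choose K hK using fun i => (h.residual i).eventually
    have hsup : ∀ i k, Finset.univ.sup K ≤ k → R i k = C i := fun i k hk =>
      hK i k ((Finset.le_sup (Finset.mem_univ i)).trans hk)
    -- above the level where all children are exhausted their entries vanish
    have hzero : ∀ k, Finset.univ.sup K ≤ k → m (k + 1) = 0 := by
      intro k hk
      have : ∀ i, a i (k + 1) = 0 := fun i => by
        by_contra hi
        refine (h.residual i).not_lmwLE hi ?_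
        rw [hsup i (k + 1) (by omega), ← hsup i k hk]
        exact (h.residual i).lmwLE k
      simp [hmdef, total, this]
    have hcarry : ∀ k, Finset.univ.sup K ≤ k → carry m s (k + 1) = false := fun k hk => by
      simp [carry, levelCarry, hzero k hk]
    refine ⟨Finset.univ.sup K + 1, fun k hk => ?_⟩
    have : Alive m s k := fun j hj => by
      obtain ⟨j, rfl⟩ : ∃ j', j = j' + 1 := ⟨j - 1, by omega⟩
      exact ⟨hcarry j (by omega), .inl (hzero _ (by omega))⟩
    rw [if_pos this, h.cover, union]
    congr 1
    exact Finset.biUnion_congr rfl fun i _ => hsup i k (by omega)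
  · by_cases h0 : Alive m s 0
    · have hm0 : m 0 = 0 := by
        have := (h0 0 le_rfl).1
        simpa [carry] using this
      refine .inr ⟨by simp [label, h0, code, hm0], ?_⟩
      rw [if_pos h0, union]
      have : Finset.univ.biUnion (fun i => R i 0) = ∅ := by
        refine Finset.eq_empty_of_forall_notMem fun v hv => ?_
        obtain ⟨i, -, hv⟩ := Finset.mem_biUnion.1 hv
        rcases (h.residual i).zero with h1 | h1
        · rw [h1.2] at hv; simp at hv
        · rw [total_eq_zero hm0 i] at h1; simp at h1
      rw [this, insert_empty_eq]
    · exact .inl ⟨by simp [label, h0], by rw [if_neg h0]⟩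
  · by_cases hal : Alive m s (k + 1)
    swap
    · have hal' : ¬ Alive m s k := fun h' => hal (alive_iff.1 h').2
      rw [if_neg hal, if_neg hal']
      simp only [label, if_neg hal]
      exact rfl
    rw [if_pos hal]
    simp only [label, if_pos hal, code, levelCode]
    have hnc : carry m s (k + 1) = false := (hal (k + 1) le_rfl).1
    simp only [carry, levelCarry, decide_eq_false_iff_not, not_and] at hnc
    have hkeep : Alive m s k ↔ Keeps m s k := by rw [alive_iff]; simp [hal]
    obtain ⟨Q, hQ, hQ1, hQ2⟩ : ∃ Q, Q = (if Alive m s k then union r R k else ∅) ∧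
        (Keeps m s k → Q = union r R k) ∧ (¬ Keeps m s k → Q = ∅) :=
      ⟨_, rfl, fun hk => if_pos (hkeep.2 hk), fun hk => if_neg (hk ∘ hkeep.1)⟩
    rw [← hQ]
    split_ifs with h0 hc h1 h2 h3 h4
    · exact h.levelSem_one h0 (h.not_lmwLE_of_carry k hc) _
    · rw [hQ1 ⟨by simpa using hc, .inl h0⟩]
      exact h.union_eq_of_total_eq_zero h0
    · exact h.levelSem_two hS h0 h1 _
    · exact h.levelSem_four hS h2 _
    · obtain ⟨i, hi, hj⟩ := exists_of_total_eq_one h3.1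
      have hi4 : a i (k + 1) = 4 := by rw [hi]; exact congrArg (· + 1) h3.2
      rw [hQ2 fun hk => by have := hk.2; omega]
      exact h.levelSem_five_of_four hS hi4 hj
    · obtain ⟨i, hi, hj⟩ := exists_of_total_eq_one h4.1
      have hi5 : a i (k + 1) = 5 := by rw [hi]; exact congrArg (· + 1) h4.2.1
      rw [hQ1 ⟨h4.2.2, .inr ⟨h4.1, h4.2.1⟩⟩]
      exact h.levelSem_five_of_five hi5 hj
    · exact absurd (hnc h0 (by omega) fun h1 h3' => h3 ⟨h1, h3'⟩) (by tauto)
end IsBranching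
end SimpleGraph

namespace TreeLabel

/-! ### Sizes and levels -/

/-- Nonzero entries are at most five, so every one of them adds at most four to the weight. -/
def Bounded (m s : ℕ → ℕ) : Prop := ∀ k, s k ≤ 4 * m k

/-- A level that produces a nonzero entry or an overflow is fed by children with nonzero entries or
by an overflow of the level below; an overflow needs two such sources. -/
lemma two_mul_carry_add_code {c : Bool} {m s : ℕ} (h : s ≤ 4 * m) :
    2 * (levelCarry c m s).toNat + (if levelCode c m s = 0 then 0 else 1) ≤ m + c.toNat := by
  by_cases h0 : m = 0
  · cases c <;> simp [levelCarry, levelCode, h0]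
  by_cases hc : levelCarry c m s = true
  · have hc' := hc
    simp only [levelCarry, decide_eq_true_eq] at hc'
    obtain ⟨-, h3, h13, h14⟩ := hc'
    have h5 : levelCode c m s = 0 := by
      simp only [levelCode, if_neg h0, if_neg h13, if_neg h14]
      rw [if_neg (by omega), if_neg (by omega)]
    have h6 : 2 ≤ m + c.toNat := by
      cases c
      · simp at h14 ⊢; omega
      · simp; omega
    simpa [hc, h5] using h6
  · rw [Bool.not_eq_true] at hc
    rw [hc, Bool.toNat_false]
    split_ifs <;> omega

lemma code_ne_zero_of_not_keeps {m s : ℕ → ℕ} {k : ℕ} (hk : ¬ Keeps m s k)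
    (hc : carry m s (k + 1) = false) : code m s (k + 1) ≠ 0 := by
  simp only [carry, levelCarry, decide_eq_false_iff_not] at hc
  simp only [code, levelCode]
  simp only [Keeps, not_and, not_or] at hk
  split_ifs with h0 h1 h2 h3 h4 h5
  · simp
  · exact absurd h0 (hk (by simpa using h1)).1
  · norm_num
  · norm_num
  · norm_num
  · norm_num
  · exact absurd ⟨h0, by omega, h4, h5⟩ hc

/-- The binary value of the part of the label below level `N` is controlled by the sizes: a nonzero
entry at level `k` stands for `2 ^ k` vertices, an overflow at level `k` for `2 ^ (k + 1)`. -/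
lemma sum_code_le {m s : ℕ → ℕ} (h : Bounded m s) (N : ℕ) :
    (∑ k ∈ Finset.range (N + 1), (if code m s k = 0 then 0 else 2 ^ k)) +
      2 ^ (N + 1) * (carry m s N).toNat ≤ 1 + ∑ k ∈ Finset.range (N + 1), m k * 2 ^ k := by
  induction N with
  | zero =>
    by_cases h0 : m 0 = 0
    · simp [code, carry, h0]
    · simp [code, carry, h0]; omega
  | succ N ih =>
    rw [Finset.sum_range_succ, Finset.sum_range_succ (fun k => m k * 2 ^ k)]
    have h1 := two_mul_carry_add_code (c := carry m s N) (h (N + 1))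
    have h2 := Nat.mul_le_mul_left (2 ^ (N + 1)) h1
    have h3 : (if code m s (N + 1) = 0 then 0 else 2 ^ (N + 1)) =
        2 ^ (N + 1) * (if levelCode (carry m s N) (m (N + 1)) (s (N + 1)) = 0 then 0 else 1) := by
      rw [code]; split_ifs <;> simp
    have h4 : 2 ^ (N + 1 + 1) * (carry m s (N + 1)).toNat =
        2 ^ (N + 1) * (2 * (levelCarry (carry m s N) (m (N + 1)) (s (N + 1))).toNat) := by
      rw [carry]; ring
    rw [h3, h4]
    nlinarith

end TreeLabel

namespace SimpleGraph
open TreeLabel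
variable {V : Type*} [DecidableEq V] {G : SimpleGraph V}

/-- `S` is the vertex set of a tree with root `r` composed from single vertices by attaching, one
after the other, complete child subtrees at the root. The sequences `m` and `s` collect the labels
of the child subtrees of the root; the last condition on a child subtree says that it has no further
edges in `G`. -/
inductive Rooted (G : SimpleGraph V) : Finset V → V → (ℕ → ℕ) → (ℕ → ℕ) → Prop
  | single (v : V) : Rooted G {v} v (fun _ => 0) (fun _ => 0)
  | graft {S S' : Finset V} {r r' : V} {m s m' s' : ℕ → ℕ} :
      Rooted G S r m s → Rooted G S' r' m' s' → Disjoint S S' → G.Adj r r' →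
      (∀ x ∈ S', ∀ y, y ∉ S' → G.Adj x y → x = r' ∧ y = r) →
      Rooted G (S ∪ S') r (fun k => m k + if label m' s' k = 0 then 0 else 1)
        (fun k => s k + (label m' s' k - 1))

namespace Rooted

variable {S : Finset V} {r : V} {m s : ℕ → ℕ}

lemma root_mem (h : G.Rooted S r m s) : r ∈ S := by
  induction h with
  | single v => simp
  | graft _ _ _ _ _ ih _ => exact Finset.mem_union_left _ ih

lemma exists_isBranching (h : G.Rooted S r m s) :
    ∃ (ι : Type) (_ : Fintype ι) (C : ι → Finset V) (c : ι → V) (a : ι → ℕ → ℕ)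
      (R : ι → ℕ → Finset V), G.IsBranching S r C c a R ∧ (∀ k, m k = total fun i => a i k) ∧
      ∀ k, s k = weight fun i => a i k := by
  induction h with
  | single v =>
    exact ⟨Empty, inferInstance, fun _ => ∅, fun _ => v, fun _ _ => 0, fun _ _ => ∅,
      ⟨by simp, by simp, by simp, by simp, by simp, by simp⟩, by simp [total], by simp [weight]⟩
  | @graft S S' r r' m s m' s' h h' hd hadj honly ih ih' =>
    obtain ⟨ι, _, C, c, a, R, hB, hm, hs⟩ := ih
    obtain ⟨ι', _, C', c', a', R', hB', hm', hs'⟩ := ih'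
    obtain ⟨R₀, hres⟩ : ∃ R₀, G.IsResidual S' r' (label m' s') R₀ :=
      ⟨_, hB'.isResidual (fun x hx y hy hxy => (honly x hx y hy hxy).1) hm' hs'⟩
    have hdC : ∀ i, Disjoint (C i) S' := fun i => hd.mono_left (hB.child_subset i)
    refine ⟨Option ι, inferInstance, fun i => i.elim S' C, fun i => i.elim r' c,
      fun i => i.elim (label m' s') a, fun i => i.elim R₀ R,
      ⟨?_, ?_, ?_, ?_, ?_, ?_⟩, fun k => ?_, fun k => ?_⟩
    · rintro (_ | i)
      · exact hres
      · exact hB.residual i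
    · rintro (_ | i) (_ | j) hij
      · exact absurd rfl hij
      · exact (hdC j).symm
      · exact hdC i
      · exact hB.disj i j (by simpa using hij)
    · rintro (_ | i)
      · exact Finset.disjoint_left.1 hd h.root_mem
      · exact hB.root_notMem i
    · rintro (_ | i)
      · exact hadj
      · exact hB.adj i
    · rintro (_ | i)
      · exact honly
      · exact hB.only i
    · rw [hB.cover]
      ext v
      simp [Finset.mem_biUnion, Option.exists, or_comm]
    · change m k + _ = _
      rw [total, Fintype.sum_option, hm, add_comm]
      rfl
    · change s k + _ = _
      rw [weight, Fintype.sum_option, hs, add_comm]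
      rfl

lemma bounded (h : G.Rooted S r m s) : Bounded m s := by
  obtain ⟨ι, _, C, c, a, R, hB, hm, hs⟩ := h.exists_isBranching
  intro k
  rw [hm, hs, total, weight, Finset.mul_sum]
  refine Finset.sum_le_sum fun i _ => ?_
  have : a i k ≤ 5 := by
    cases k with
    | zero => rcases (hB.residual i).zero with h | h <;> omega
    | succ k => exact ((hB.residual i).succ k).le_five
  split_ifs <;> omega

lemma sum_le_card (h : G.Rooted S r m s) (N : ℕ) :
    1 + ∑ k ∈ Finset.range N, m k * 2 ^ k ≤ S.card := by
  induction h with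
  | single v => simp
  | @graft S S' r r' m s m' s' h h' hd hadj honly ih ih' =>
    rw [Finset.card_union_of_disjoint hd]
    have h1 : ∑ k ∈ Finset.range N, (if label m' s' k = 0 then 0 else 2 ^ k) ≤ S'.card := by
      refine le_trans ?_ ih'
      cases N with
      | zero => simp
      | succ N =>
        refine le_trans (Finset.sum_le_sum fun k _ => ?_)
          ((Nat.le_add_right _ _).trans (sum_code_le h'.bounded N))
        unfold label
        split_ifs <;> simp_all
    have h2 : ∑ k ∈ Finset.range N, (m k + if label m' s' k = 0 then 0 else 1) * 2 ^ k =
        ∑ k ∈ Finset.range N, m k * 2 ^ k +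
          ∑ k ∈ Finset.range N, (if label m' s' k = 0 then 0 else 2 ^ k) := by
      rw [← Finset.sum_add_distrib]
      refine Finset.sum_congr rfl fun k _ => ?_
      split_ifs <;> ring
    rw [h2]
    omega

lemma mul_two_pow_le (h : G.Rooted S r m s) (k : ℕ) : m k * 2 ^ k ≤ S.card := by
  refine le_trans ?_ ((Nat.le_add_left _ _).trans (h.sum_le_card (k + 1)))
  exact Finset.single_le_sum (f := fun k => m k * 2 ^ k) (fun _ _ => Nat.zero_le _)
    (Finset.self_mem_range_succ k)

lemma le_card (h : G.Rooted S r m s) (k : ℕ) : m k ≤ S.card :=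
  (Nat.le_mul_of_pos_right _ (by positivity)).trans (h.mul_two_pow_le k)

lemma eq_zero_of_lt (h : G.Rooted S r m s) {k : ℕ} (hk : S.card < 2 ^ k) : m k = 0 := by
  by_contra h0
  have := h.mul_two_pow_le k
  have := Nat.le_mul_of_pos_left (2 ^ k) (Nat.pos_of_ne_zero h0)
  omega

lemma carry_eq_false (h : G.Rooted S r m s) {k : ℕ} (hk : S.card < 2 ^ (k + 1)) :
    carry m s k = false := by
  by_contra hc
  have h1 := (sum_code_le h.bounded k).trans (h.sum_le_card (k + 1))
  rw [Bool.not_eq_false] at hc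
  simp [hc] at h1
  omega

lemma code_eq_zero (h : G.Rooted S r m s) {k : ℕ} (hk : S.card < 2 ^ k) : code m s k = 0 := by
  cases k with
  | zero =>
    have := Finset.card_pos.2 ⟨r, h.root_mem⟩
    omega
  | succ k => simp [code, levelCode, h.eq_zero_of_lt hk, h.carry_eq_false hk]

/-- Only finitely many levels matter. -/
lemma alive_iff_lt (h : G.Rooted S r m s) {L : ℕ} (hL : S.card < 2 ^ L) (k : ℕ) :
    Alive m s k ↔ ∀ j, k ≤ j → j + 1 < L → Keeps m s j := by
  refine ⟨fun hk j hj _ => hk j hj, fun hk j hj => ?_⟩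
  by_cases hjL : j + 1 < L
  · exact hk j hj hjL
  · have : S.card < 2 ^ (j + 1) := hL.trans_le (Nat.pow_le_pow_right (by norm_num) (by omega))
    exact ⟨h.carry_eq_false this, .inl (h.eq_zero_of_lt this)⟩

lemma exists_isResidual (h : G.Rooted S r m s)
    (hS : ∀ x ∈ S, ∀ y, y ∉ S → G.Adj x y → x = r) : ∃ R, G.IsResidual S r (label m s) R := by
  obtain ⟨ι, _, C, c, a, R, hB, hm, hs⟩ := h.exists_isBranching
  exact ⟨_, hB.isResidual hS hm hs⟩

lemma exists_code_ne_zero (h : G.Rooted S r m s)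
    (hS : ∀ x ∈ S, ∀ y, y ∉ S → G.Adj x y → x = r) : ∃ k, code m s k ≠ 0 := by
  by_contra! h0
  obtain ⟨R, hR⟩ := h.exists_isResidual hS
  have hl : ∀ k, label m s k = 0 := fun k => by simp [label, h0]
  have hR0 : ∀ k, R k = ∅ := by
    intro k
    induction k with
    | zero =>
      have := hR.zero
      rw [hl 0] at this
      simpa using this
    | succ k ih =>
      have := hR.succ k
      rw [hl (k + 1)] at this
      exact Eq.trans this ih
  obtain ⟨K, hK⟩ := hR.eventually
  have := h.root_mem
  rw [← hK K le_rfl, hR0] at this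
  simp at this

/-- The width is the highest level with a nonzero entry. -/
theorem lmwLE_iff (h : G.Rooted S r m s) (hS : ∀ x ∈ S, ∀ y, y ∉ S → G.Adj x y → x = r) {K : ℕ}
    (hK : code m s K ≠ 0) (hK' : ∀ k, K < k → code m s k = 0) (k : ℕ) :
    G.LmwLE S k ↔ K ≤ k := by
  obtain ⟨R, hR⟩ := h.exists_isResidual hS
  -- a level above `K` that makes lower levels irrelevant would have a nonzero entry
  have halive : ∀ j, K ≤ j → Alive m s j := by
    intro j hj
    by_cases hjc : S.card ≤ j
    · refine (h.alive_iff_lt (L := j) (hjc.trans_lt j.lt_two_pow_self) j).2 fun i hi hi' => ?_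
      omega
    · refine Nat.decreasingInduction' (n := S.card) (m := j)
        (P := Alive m s) (fun i _ hi ih => alive_iff.2 ⟨?_, ih⟩) (by omega) ?_
      · by_contra hne
        exact code_ne_zero_of_not_keeps hne (ih (i + 1) le_rfl).1 (hK' (i + 1) (by omega))
      · refine (h.alive_iff_lt (L := S.card) S.card.lt_two_pow_self _).2 fun i hi hi' => ?_
        omega
  have hlab : ∀ j, K ≤ j → label m s j = code m s j := fun j hj => if_pos (halive j hj)
  have hconst : ∀ j, K ≤ j → R j = R K := by
    intro j hj
    induction j, hj using Nat.le_induction with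
    | base => rfl
    | succ j hj ih =>
      have := hR.succ j
      rw [hlab _ (by omega), hK' _ (by omega)] at this
      exact Eq.trans this ih
  have hRK : R K = S := by
    obtain ⟨K₀, hK₀⟩ := hR.eventually
    rw [← hconst (max K K₀) (le_max_left _ _), hK₀ _ (le_max_right _ _)]
  refine ⟨fun hW => ?_, fun hk => (hRK ▸ hR.lmwLE K).mono hk⟩
  by_contra! hlt
  obtain ⟨K, rfl⟩ : ∃ K', K = K' + 1 := ⟨K - 1, by omega⟩
  exact hR.not_lmwLE (by rwa [hlab _ le_rfl]) (hRK ▸ hW.mono (by omega))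

end Rooted
end SimpleGraph

namespace SimpleGraph
variable {V : Type*} {G : SimpleGraph V}

/-! ### Sequences of vertices and linear layouts -/

lemma mim_le_of_forall [Finite V] {H : SimpleGraph V} {k : ℕ}
    (h : ∀ M : H.Subgraph, M.IsMatching → M.IsInduced → M.edgeSet.ncard ≤ k) : H.mim ≤ k := by
  refine csSup_le' ?_
  rintro _ ⟨M, h1, h2, rfl⟩
  exact h M h1 h2

lemma le_mim [Finite V] {H : SimpleGraph V} (M : H.Subgraph) (h1 : M.IsMatching)
    (h2 : M.IsInduced) : M.edgeSet.ncard ≤ H.mim := by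
  refine le_csSup ⟨Nat.card (Sym2 V), ?_⟩ ⟨M, h1, h2, rfl⟩
  rintro _ ⟨M, -, -, rfl⟩
  exact Set.ncard_le_card _

/-- An induced matching of the cut graph gives a cut matching with as many edges. -/
lemma exists_isCutMatching [Finite V] {A B : List V} {X Y : Set V} (hX : ∀ v, v ∈ X ↔ v ∈ A)
    (hY : ∀ v, v ∈ Y ↔ v ∈ B) {M : (G.between X Y).Subgraph} (h1 : M.IsMatching)
    (h2 : M.IsInduced) : ∃ N, G.IsCutMatching A B N ∧ M.edgeSet.ncard ≤ N.card := by
  classical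
  have := Fintype.ofFinite V
  refine ⟨Finset.univ.filter fun e => e.1 ∈ A ∧ e.2 ∈ B ∧ M.Adj e.1 e.2, ⟨?_, ?_⟩, ?_⟩
  · intro e he
    obtain ⟨-, h3, h4, h5⟩ := Finset.mem_filter.1 he
    exact ⟨h3, h4, (between_adj .. |>.1 h5.adj_sub).1⟩
  · intro e he f hf hef
    obtain ⟨-, e1, e2, e3⟩ := Finset.mem_filter.1 he
    obtain ⟨-, f1, f2, f3⟩ := Finset.mem_filter.1 hf
    have hadj : M.Adj e.1 f.2 := h2 e3.fst_mem f3.snd_mem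
      (between_adj .. |>.2 ⟨hef, .inl ⟨(hX _).2 e1, (hY _).2 f2⟩⟩)
    have h3 : f.2 = e.2 := h1.eq_of_adj_left hadj e3
    have h4 : e.1 = f.1 := h1.eq_of_adj_right hadj f3
    exact Prod.ext h4 h3.symm
  · have hsub : M.edgeSet ⊆ (fun e : V × V => s(e.1, e.2)) ''
        ((Finset.univ.filter fun e : V × V => e.1 ∈ A ∧ e.2 ∈ B ∧ M.Adj e.1 e.2 :
          Finset (V × V)) : Set (V × V)) := by
      intro e he
      induction e using Sym2.ind with
      | _ x y =>
        have hxy : M.Adj x y := he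
        rcases (between_adj .. |>.1 hxy.adj_sub).2 with ⟨hx, hy⟩ | ⟨hx, hy⟩
        · exact ⟨(x, y), by simpa using ⟨(hX _).1 hx, (hY _).1 hy, hxy⟩, rfl⟩
        · exact ⟨(y, x), by simpa using ⟨(hX _).1 hy, (hY _).1 hx, hxy.symm⟩, Sym2.eq_swap⟩
    refine (Set.ncard_le_ncard hsub).trans ((Set.ncard_image_le).trans ?_)
    rw [Set.ncard_coe_finset]

/-- A cut matching is an induced matching of the cut graph. -/
lemma IsCutMatching.card_le_mim [Finite V] {A B : List V} {X Y : Set V} (hX : ∀ v, v ∈ X ↔ v ∈ A)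
    (hY : ∀ v, v ∈ Y ↔ v ∈ B) (hAB : ∀ v ∈ A, v ∉ B) {N : Finset (V × V)}
    (hN : G.IsCutMatching A B N) : N.card ≤ (G.between X Y).mim := by
  have hadj : ∀ x y, (x, y) ∈ N → (G.between X Y).Adj x y := fun x y h =>
    between_adj .. |>.2 ⟨(hN.1 _ h).2.2, .inl ⟨(hX _).2 (hN.1 _ h).1, (hY _).2 (hN.1 _ h).2.1⟩⟩
  have hfun : ∀ x y z, (x, y) ∈ N → (x, z) ∈ N → y = z := fun x y z h h' =>
    congrArg Prod.snd (hN.2 _ h _ h' (hN.1 _ h').2.2)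
  have hfun' : ∀ x y z, (y, x) ∈ N → (z, x) ∈ N → y = z := fun x y z h h' =>
    congrArg Prod.fst (hN.2 _ h _ h' (hN.1 _ h).2.2)
  have hmix : ∀ x y z, (x, y) ∈ N → (z, x) ∈ N → False := fun x y z h h' =>
    hAB x (hN.1 _ h).1 (hN.1 _ h').2.1
  let M : (G.between X Y).Subgraph :=
    { verts := {v | ∃ w, (v, w) ∈ N ∨ (w, v) ∈ N}
      Adj := fun x y => (x, y) ∈ N ∨ (y, x) ∈ N
      adj_sub := fun {x y} h => h.elim (hadj x y) fun h => (hadj y x h).symm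
      edge_vert := fun {x y} h => ⟨y, h⟩
      symm := ⟨fun x y h => h.symm⟩ }
  have h1 : M.IsMatching := by
    rintro x ⟨y, hy⟩
    refine ⟨y, hy, ?_⟩
    rintro z (hz | hz) <;> rcases hy with hy | hy
    · exact hfun x z y hz hy
    · exact (hmix x z y hz hy).elim
    · exact (hmix x y z hy hz).elim
    · exact hfun' x z y hz hy
  have h2 : M.IsInduced := by
    have key : ∀ x y, (∃ w, (x, w) ∈ N ∨ (w, x) ∈ N) → (∃ w, (y, w) ∈ N ∨ (w, y) ∈ N) →
        G.Adj x y → x ∈ X → y ∈ Y → (x, y) ∈ N := by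
      rintro x y ⟨w, hw⟩ ⟨z, hz⟩ hxy hx hy
      rw [hX] at hx
      rw [hY] at hy
      have hw : (x, w) ∈ N := hw.resolve_right fun h => hAB x hx (hN.1 _ h).2.1
      have hz : (z, y) ∈ N := hz.resolve_left fun h => hAB y (hN.1 _ h).1 hy
      have := hN.2 _ hw _ hz hxy
      rw [Prod.mk.injEq] at this
      exact this.2 ▸ hw
    intro x hx y hy hxy
    obtain ⟨h, ⟨h3, h4⟩ | ⟨h3, h4⟩⟩ := between_adj .. |>.1 hxy
    · exact .inl (key x y hx hy h h3 h4)
    · exact .inr (key y x hy hx h.symm h4 h3)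
  refine le_trans ?_ (le_mim M h1 h2)
  have himg : (fun e : V × V => s(e.1, e.2)) '' (N : Set (V × V)) ⊆ M.edgeSet := by
    rintro _ ⟨⟨x, y⟩, h, rfl⟩
    exact Or.inl h
  refine le_trans ?_ (Set.ncard_le_ncard himg)
  rw [Set.InjOn.ncard_image, Set.ncard_coe_finset]
  rintro ⟨x, y⟩ h ⟨x', y'⟩ h' heq
  rcases Sym2.eq_iff.1 heq with ⟨rfl, rfl⟩ | ⟨rfl, rfl⟩
  · rfl
  · exact (hmix _ _ _ h h').elim

theorem lmw_le_iff [Fintype V] (G : SimpleGraph V) (k : ℕ) :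
    G.lmw ≤ k ↔ G.LmwLE Finset.univ k := by
  classical
  constructor
  · intro h
    have : Nonempty (Layout V) := ⟨Fintype.equivFin V⟩
    obtain ⟨σ, hσ⟩ := ciInf_mem fun σ : Layout V => G.layoutMim σ
    rw [lmw, ← hσ] at h
    refine ⟨List.ofFn σ.symm, List.nodup_ofFn.2 σ.symm.injective, fun v => ?_,
      fun A B M hAB hM => ?_⟩
    · simpa using ⟨σ v, by simp⟩
    rcases M.eq_empty_or_nonempty with rfl | ⟨e, he⟩
    · simp
    have hlen : A.length + B.length = Fintype.card V := by
      rw [← List.length_append, ← hAB, List.length_ofFn]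
    have hA : ∀ v, v ∈ A ↔ (σ v : ℕ) < A.length := by
      intro v
      rw [← List.take_left (l₁ := A) (l₂ := B), ← hAB, List.mem_take_iff_getElem]
      constructor
      · rintro ⟨i, hi, rfl⟩
        simp at hi ⊢
        omega
      · intro hv
        refine ⟨σ v, ?_, by simp⟩
        simpa using hv
    have hnd : (A ++ B).Nodup := hAB ▸ List.nodup_ofFn.2 σ.symm.injective
    have hB : ∀ v, v ∈ B ↔ A.length ≤ (σ v : ℕ) := by
      intro v
      have hv : v ∈ A ++ B := hAB ▸ by simpa using ⟨σ v, by simp⟩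
      rw [← not_lt, ← hA]
      exact ⟨fun h h' => (List.nodup_append'.1 hnd).2.2 h' h,
        fun h => (List.mem_append.1 hv).resolve_left h⟩
    refine le_trans ?_ h
    have hi : A.length ∈ Finset.Ico 1 (Fintype.card V) := by
      have h1 := List.length_pos_of_mem (hM.1 e he).1
      have h2 := List.length_pos_of_mem (hM.1 e he).2.1
      rw [Finset.mem_Ico]; omega
    refine le_trans ?_ (Finset.le_sup (f := fun i => (G.cutGraph σ i).mim) hi)
    exact hM.card_le_mim (fun v => (hA v).symm) (fun v => (hB v).symm)
      fun v h h' => (List.nodup_append'.1 hnd).2.2 h h'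
  · rintro ⟨l, h1, h2, h3⟩
    have h2' : ∀ v, v ∈ l := fun v => (h2 v).2 (Finset.mem_univ v)
    have hcard : l.length = Fintype.card V := by
      rw [← List.toFinset_card_of_nodup h1]
      congr 1
      ext v; simp [h2']
    let σ : Layout V := ((List.Nodup.getEquivOfForallMemList l h1 h2').symm.trans (finCongr hcard))
    have hσ : ∀ v, ((σ v : ℕ)) = l.idxOf v := fun v => rfl
    refine (ciInf_le' _ σ).trans (Finset.sup_le fun i hi => mim_le_of_forall fun M hM hM' => ?_)
    have hX : ∀ v, v ∈ {v | (σ v : ℕ) < i} ↔ v ∈ l.take i := by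
      intro v
      rw [Set.mem_ofPred_eq, hσ, List.mem_take_iff_idxOf_lt (h2' v)]
    have hY : ∀ v, v ∈ {v | i ≤ (σ v : ℕ)} ↔ v ∈ l.drop i := by
      intro v
      have hv := h2' v
      rw [← List.take_append_drop i l, List.mem_append] at hv
      rw [Set.mem_ofPred_eq, ← not_lt]
      have := hX v
      rw [Set.mem_ofPred_eq] at this
      rw [this]
      exact ⟨fun h => hv.resolve_left h, fun h h' =>
        (List.nodup_append'.1 (by rwa [List.take_append_drop i l])).2.2 h' h⟩
    obtain ⟨N, hN, hN'⟩ := exists_isCutMatching hX hY hM hM'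
    exact hN'.trans (h3 _ _ N (List.take_append_drop i l).symm hN)

end SimpleGraph

namespace SimpleGraph
open TreeLabel
variable {V : Type*} [DecidableEq V] {G : SimpleGraph V}

/-! ### Elimination of leaves -/

lemma Connected.connOn_univ {V : Type*} {G : SimpleGraph V} (h : G.Connected) :
    G.ConnOn Set.univ := by
  rintro A ⟨a, -, ha⟩ ⟨b, -, hb⟩
  obtain ⟨w⟩ := h.preconnected a b
  obtain ⟨d, -, hd1, hd2⟩ := w.exists_boundary_dart A ha hb
  exact ⟨d.fst, trivial, d.snd, trivial, hd1, hd2, d.adj⟩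

/-- The neighbours of `v` in `A`. -/
noncomputable def nbrs {V : Type*} (G : SimpleGraph V) (A : Finset V) (v : V) : Finset V :=
  open Classical in A.filter (G.Adj v)

lemma mem_nbrs {V : Type*} {G : SimpleGraph V} {A : Finset V} {v w : V} :
    w ∈ G.nbrs A v ↔ w ∈ A ∧ G.Adj v w := by
  simp [nbrs]

lemma nbrs_erase {A : Finset V} (u v : V) : G.nbrs (A.erase v) u = (G.nbrs A u).erase v := by
  ext w; simp only [mem_nbrs, Finset.mem_erase, and_assoc]

/-- A stage of the elimination of leaves of the tree `G`: `A` is the set of the remaining vertices,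
and `F u` is the vertex set of the tree with root `u` that has been absorbed by `u`. -/
structure Elimination (G : SimpleGraph V) (A : Finset V) (F : V → Finset V)
    (m s : V → ℕ → ℕ) : Prop where
  rooted : ∀ u ∈ A, G.Rooted (F u) u (m u) (s u)
  disj : ∀ u ∈ A, ∀ w ∈ A, u ≠ w → Disjoint (F u) (F w)
  only : ∀ u ∈ A, ∀ x ∈ F u, ∀ y, y ∉ F u → G.Adj x y → x = u ∧ y ∈ A
  cover : ∀ x, ∃ u ∈ A, x ∈ F u
  conn : G.ConnOn (A : Set V)
  deg : ∑ u ∈ A, (G.nbrs A u).card + 2 = 2 * A.card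

namespace Elimination

lemma init [Fintype V] (h : G.IsTree) :
    G.Elimination Finset.univ (fun u => {u}) (fun _ _ => 0) (fun _ _ => 0) where
  rooted u _ := .single u
  disj u _ w _ huw := by simpa using huw
  only u _ x hx y _ _ := by simpa using hx
  cover x := ⟨x, by simp⟩
  conn := by simpa using h.connected.connOn_univ
  deg := by
    classical
    have h1 := G.sum_degrees_eq_twice_card_edges
    have h2 := h.card_edgeFinset
    have h3 : ∀ u, (G.nbrs Finset.univ u).card = G.degree u := fun u => by
      rw [← card_neighborFinset_eq_degree]
      congr 1
      ext w; simp [mem_nbrs]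
    simp only [h3, h1, Finset.card_univ]
    omega

variable {A : Finset V} {F : V → Finset V} {m s : V → ℕ → ℕ}

lemma exists_leaf (h : G.Elimination A F m s) (hA : 2 ≤ A.card) :
    ∃ v ∈ A, (G.nbrs A v).card = 1 := by
  by_contra! hne
  have h2 : ∀ u ∈ A, 2 ≤ (G.nbrs A u).card := by
    intro u hu
    obtain ⟨w, hw, hwu⟩ := Finset.exists_mem_ne (Nat.lt_of_succ_le hA) u
    obtain ⟨a, -, b, hb, rfl, -, hab⟩ := h.conn {u} ⟨u, hu, rfl⟩ ⟨w, hw, hwu⟩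
    have : 0 < (G.nbrs A a).card := Finset.card_pos.2 ⟨b, mem_nbrs.2 ⟨hb, hab⟩⟩
    have := hne a hu
    omega
  have := Finset.sum_le_sum h2
  rw [Finset.sum_const, smul_eq_mul] at this
  have := h.deg
  omega

lemma nbrs_erase_eq {v p : V} (hv : G.nbrs A v = {p}) {u : V} (hu : u ∈ A) (hup : u ≠ p) :
    G.nbrs (A.erase v) u = G.nbrs A u := by
  rw [nbrs_erase, Finset.erase_eq_of_notMem]
  intro hvu
  have : u ∈ G.nbrs A v := mem_nbrs.2 ⟨hu, (mem_nbrs.1 hvu).2.symm⟩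
  rw [hv] at this
  exact hup (by simpa using this)

lemma mem_nbrs_of_eq {V : Type*} {G : SimpleGraph V} {A : Finset V} {v p : V}
    (hv : G.nbrs A v = {p}) (hvA : v ∈ A) : v ∈ G.nbrs A p := by
  have hp : p ∈ G.nbrs A v := by rw [hv]; simp
  exact mem_nbrs.2 ⟨hvA, (mem_nbrs.1 hp).2.symm⟩

/-- The leaf `v` with the neighbour `p` is absorbed by `p`. -/
lemma step (h : G.Elimination A F m s) {v p : V} (hvA : v ∈ A) (hv : G.nbrs A v = {p}) :
    G.Elimination (A.erase v) (Function.update F p (F p ∪ F v))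
      (Function.update m p fun k => m p k + if label (m v) (s v) k = 0 then 0 else 1)
      (Function.update s p fun k => s p k + (label (m v) (s v) k - 1)) := by
  have hp : p ∈ A ∧ G.Adj v p := mem_nbrs.1 (by rw [hv]; simp)
  have hpv : p ≠ v := hp.2.ne'
  have hvp : ∀ y ∈ A, G.Adj v y → y = p := fun y hy hvy => by
    have : y ∈ G.nbrs A v := mem_nbrs.2 ⟨hy, hvy⟩
    simpa [hv] using this
  have honly : ∀ x ∈ F v, ∀ y, y ∉ F v → G.Adj x y → x = v ∧ y = p := fun x hx y hy hxy => by
    obtain ⟨rfl, hyA⟩ := h.only v hvA x hx y hy hxy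
    exact ⟨rfl, hvp y hyA hxy⟩
  refine ⟨fun u hu => ?_, fun u hu w hw huw => ?_, fun u hu x hx y hy hxy => ?_, fun x => ?_,
    ?_, ?_⟩
  · obtain ⟨huv, huA⟩ := Finset.mem_erase.1 hu
    by_cases hup : u = p
    · subst hup
      simp only [Function.update_self]
      exact .graft (h.rooted u huA) (h.rooted v hvA) (h.disj u huA v hvA huv) hp.2.symm honly
    · simp only [Function.update_of_ne hup]
      exact h.rooted u huA
  · obtain ⟨huv, huA⟩ := Finset.mem_erase.1 hu
    obtain ⟨hwv, hwA⟩ := Finset.mem_erase.1 hw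
    by_cases hup : u = p
    · subst hup
      rw [Function.update_self, Function.update_of_ne huw.symm]
      exact Finset.disjoint_union_left.2 ⟨h.disj _ huA _ hwA huw, h.disj _ hvA _ hwA hwv.symm⟩
    · by_cases hwp : w = p
      · subst hwp
        rw [Function.update_self, Function.update_of_ne huw]
        exact Finset.disjoint_union_right.2 ⟨h.disj _ huA _ hwA huw, h.disj _ huA _ hvA huv⟩
      · rw [Function.update_of_ne hup, Function.update_of_ne hwp]
        exact h.disj _ huA _ hwA huw
  · obtain ⟨huv, huA⟩ := Finset.mem_erase.1 hu
    by_cases hup : u = p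
    · subst hup
      rw [Function.update_self, Finset.mem_union] at hx hy
      push Not at hy
      rcases hx with hx | hx
      · obtain ⟨rfl, hyA⟩ := h.only u huA x hx y hy.1 hxy
        refine ⟨rfl, Finset.mem_erase.2 ⟨?_, hyA⟩⟩
        rintro rfl
        exact hy.2 (h.rooted y hvA).root_mem
      · obtain ⟨rfl, rfl⟩ := honly x hx y hy.2 hxy
        exact absurd (h.rooted y huA).root_mem hy.1
    · rw [Function.update_of_ne hup] at hx hy
      obtain ⟨rfl, hyA⟩ := h.only u huA x hx y hy hxy
      refine ⟨rfl, Finset.mem_erase.2 ⟨?_, hyA⟩⟩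
      rintro rfl
      exact hup (hvp x huA hxy.symm)
  · obtain ⟨u, huA, hxu⟩ := h.cover x
    by_cases huv : u = v
    · subst huv
      exact ⟨p, Finset.mem_erase.2 ⟨hpv, hp.1⟩, by simp [hxu]⟩
    · refine ⟨u, Finset.mem_erase.2 ⟨huv, huA⟩, ?_⟩
      by_cases hup : u = p
      · subst hup; simp [hxu]
      · rwa [Function.update_of_ne hup]
  · -- a crossing edge at the leaf leads to its neighbour, so it can be avoided
    intro B ⟨a, ha, haB⟩ ⟨b, hb, hbB⟩
    simp only [Finset.coe_erase, Set.mem_sdiff, Finset.mem_coe, Set.mem_singleton_iff] at ha hb ⊢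
    obtain ⟨x, hx, y, hy, hxB, hyB, hxy⟩ := h.conn {z | if z = v then p ∈ B else z ∈ B}
      ⟨a, ha.1, by simpa [ha.2] using haB⟩ ⟨b, hb.1, by simpa [hb.2] using hbB⟩
    rw [Set.mem_ofPred_eq] at hxB hyB
    by_cases hxv : x = v
    · subst hxv
      obtain rfl := hvp y hy hxy
      simp [hpv] at hxB hyB
      exact absurd hxB hyB
    · by_cases hyv : y = v
      · subst hyv
        obtain rfl := hvp x hx hxy.symm
        simp [hpv] at hxB hyB
        exact absurd hxB hyB
      · rw [if_neg hxv] at hxB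
        rw [if_neg hyv] at hyB
        exact ⟨x, ⟨hx, hxv⟩, y, ⟨hy, hyv⟩, hxB, hyB, hxy⟩
  · have hpA : p ∈ A.erase v := Finset.mem_erase.2 ⟨hpv, hp.1⟩
    have h1 := h.deg
    rw [← Finset.add_sum_erase _ _ hvA, ← Finset.add_sum_erase _ _ hpA, hv,
      Finset.card_singleton] at h1
    rw [← Finset.add_sum_erase _ _ hpA, nbrs_erase, Finset.card_erase_of_mem
      (mem_nbrs_of_eq hv hvA), Finset.card_erase_of_mem hvA]
    have h2 : ∑ u ∈ (A.erase v).erase p, (G.nbrs (A.erase v) u).card =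
        ∑ u ∈ (A.erase v).erase p, (G.nbrs A u).card :=
      Finset.sum_congr rfl fun u hu => by
        rw [nbrs_erase_eq hv (Finset.mem_of_mem_erase (Finset.mem_of_mem_erase hu))
          (Finset.ne_of_mem_erase hu)]
    have h3 : 0 < (G.nbrs A p).card := Finset.card_pos.2 ⟨v, mem_nbrs_of_eq hv hvA⟩
    have h4 : 0 < A.card := Finset.card_pos.2 ⟨v, hvA⟩
    rw [h2]
    omega

/-- At the end of the elimination the root has absorbed the whole tree. -/
lemma rooted_univ [Fintype V] {p : V} (h : G.Elimination {p} F m s) :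
    G.Rooted Finset.univ p (m p) (s p) := by
  have : F p = Finset.univ := by
    ext x
    obtain ⟨u, hu, hx⟩ := h.cover x
    simpa [Finset.mem_singleton.1 hu] using hx
  exact this ▸ h.rooted p (by simp)

end Elimination

/-- The width of a tree is the highest level with a nonzero entry at the root. -/
theorem Rooted.lmw_eq [Fintype V] {r : V} {m s : ℕ → ℕ} (h : G.Rooted Finset.univ r m s) {K : ℕ}
    (hK : code m s K ≠ 0) (hK' : ∀ k, K < k → code m s k = 0) : G.lmw = K := by
  have hiff : ∀ k, G.lmw ≤ k ↔ K ≤ k := fun k =>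
    (lmw_le_iff G k).trans (h.lmwLE_iff (fun x _ y hy _ => absurd (Finset.mem_univ y) hy) hK hK' k)
  exact le_antisymm ((hiff K).2 le_rfl) ((hiff _).1 le_rfl)

end SimpleGraph

namespace RAM

/-! ### Total correctness of programs with time bounds -/

/-- Started in `s`, the program `p` halts within `t` steps in a state with `Q`, without overflow. -/
def Exec (W : ℕ) (p : Program) (s : State) (t : ℕ) (Q : State → Prop) : Prop :=
  ∃ t' s', t' ≤ t ∧ Run W p s t' s' ∧ Q s'

variable {W : ℕ}

lemma Exec.mono {p : Program} {s : State} {t t' : ℕ} {Q Q' : State → Prop} (h : Exec W p s t Q)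
    (ht : t ≤ t') (hQ : ∀ s', Q s' → Q' s') : Exec W p s t' Q' :=
  let ⟨u, s', h1, h2, h3⟩ := h; ⟨u, s', h1.trans ht, h2, hQ s' h3⟩

lemma Exec.seq {c d : Program} {s : State} {t₁ t₂ : ℕ} {Q Q' : State → Prop}
    (hc : Exec W c s t₁ Q) (hd : ∀ s', Q s' → Exec W d s' t₂ Q') :
    Exec W (.seq c d) s (t₁ + t₂) Q' := by
  obtain ⟨u₁, s₁, h1, h2, h3⟩ := hc
  obtain ⟨u₂, s₂, h4, h5, h6⟩ := hd s₁ h3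
  exact ⟨u₁ + u₂, s₂, by omega, .seq h2 h5, h6⟩

lemma Exec.branch {b : Test} {c d : Program} {s : State} {t : ℕ} {Q : State → Prop}
    (hb : b.Fits W s) (hc : b.Holds s → Exec W c s t Q) (hd : ¬ b.Holds s → Exec W d s t Q) :
    Exec W (.branch b c d) s (b.cost + t) Q := by
  by_cases h : b.Holds s
  · obtain ⟨u, s', h1, h2, h3⟩ := hc h
    exact ⟨b.cost + u, s', by omega, .branch_true hb h h2, h3⟩
  · obtain ⟨u, s', h1, h2, h3⟩ := hd h
    exact ⟨b.cost + u, s', by omega, .branch_false hb h h2, h3⟩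

/-- A loop whose body takes at most `t` steps and decreases the index `N` of the invariant `I N`. -/
lemma Exec.loop_of_index {b : Test} {c : Program} {t : ℕ} (I : ℕ → State → Prop)
    (hb : ∀ N s, I N s → b.Fits W s)
    (hc : ∀ N s, I N s → b.Holds s → Exec W c s t fun s' => ∃ N', N' < N ∧ I N' s')
    {N : ℕ} {s : State} (hs : I N s) :
    Exec W (.loop b c) s (N * (b.cost + t) + b.cost) fun s' => (∃ N', I N' s') ∧ ¬ b.Holds s' := by
  induction N using Nat.strong_induction_on generalizing s with
  | _ N ih =>
    by_cases h : b.Holds s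
    · obtain ⟨u, s₁, h1, h2, N₁, h3, h4⟩ := hc N s hs h
      obtain ⟨u', s₂, h5, h6, h7⟩ := ih N₁ h3 h4
      refine ⟨b.cost + u + u', s₂, ?_, .loop_true (hb N s hs) h h2 h6, h7⟩
      obtain ⟨N', rfl⟩ : ∃ N', N = N' + 1 := ⟨N - 1, by omega⟩
      have : N₁ * (b.cost + t) ≤ N' * (b.cost + t) := Nat.mul_le_mul_right _ (by omega)
      rw [Nat.add_mul]
      omega
    · exact ⟨b.cost, s, by omega, .loop_false (hb N s hs) h, ⟨N, hs⟩, h⟩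

/-- A loop with the invariant `I` whose body takes at most `t` steps and decreases `μ`. -/
lemma Exec.loop {b : Test} {c : Program} {t : ℕ} (I : State → Prop) (μ : State → ℕ)
    (hb : ∀ s, I s → b.Fits W s)
    (hc : ∀ s, I s → b.Holds s → Exec W c s t fun s' => I s' ∧ μ s' < μ s) {s : State} (hs : I s) :
    Exec W (.loop b c) s (μ s * (b.cost + t) + b.cost) fun s' => I s' ∧ ¬ b.Holds s' :=
  (Exec.loop_of_index (fun N s => I s ∧ μ s = N) (fun _ s h => hb s h.1)
    (fun _ s h hs => (hc s h.1 hs).mono le_rfl fun s' h' => ⟨μ s', h.2 ▸ h'.2, h'.1, rfl⟩)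
    ⟨hs, rfl⟩).mono le_rfl fun _ ⟨⟨_, h, _⟩, h'⟩ => ⟨h, h'⟩

/-- The largest number of steps of a program without loops. -/
def Program.maxCost : Program → ℕ
  | skip => 1
  | set _ e => e.cost + 1
  | put _ i e => i.cost + e.cost + 1
  | seq c d => c.maxCost + d.maxCost
  | branch b c d => b.cost + max c.maxCost d.maxCost
  | loop _ _ => 0

/-- The weakest precondition of a program without loops: no overflow occurs and `Q` holds at the
end. -/
def Program.wp (W : ℕ) : Program → State → (State → Prop) → Prop
  | skip, s, Q => Q s
  | set r e, s, Q => e.Fits W s ∧ Q ⟨Function.update s.reg r (e.eval s), s.arr⟩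
  | put a i e, s, Q => i.Fits W s ∧ e.Fits W s ∧
      Q ⟨s.reg, Function.update s.arr a (Function.update (s.arr a) (i.eval s) (e.eval s))⟩
  | seq c d, s, Q => c.wp W s fun s' => d.wp W s' Q
  | branch b c d, s, Q => b.Fits W s ∧ (b.Holds s → c.wp W s Q) ∧ (¬ b.Holds s → d.wp W s Q)
  | loop _ _, _, _ => False

lemma Exec.of_wp {p : Program} {s : State} {Q : State → Prop} (h : p.wp W s Q) :
    Exec W p s p.maxCost Q := by
  induction p generalizing s Q with
  | skip => exact ⟨1, s, le_rfl, .skip s, h⟩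
  | set r e => exact ⟨_, _, le_rfl, .set r e s h.1, h.2⟩
  | put a i e => exact ⟨_, _, le_rfl, .put a i e s h.1 h.2.1, h.2.2⟩
  | seq c d hc hd => exact (hc h).seq fun s' hs' => hd hs'
  | branch b c d hc hd =>
    exact Exec.branch h.1 (fun hb => (hc (h.2.1 hb)).mono (le_max_left _ _) fun _ h => h)
      fun hb => (hd (h.2.2 hb)).mono (le_max_right _ _) fun _ h => h
  | loop b c _ => exact h.elim

end RAM

namespace RAM
open TreeLabel RAM.Expr RAM.Test RAM.Program

/-! ### Computing the label of a vertex -/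

/-- The case distinction at a positive level. The accumulators of the vertex at the level are in the
registers `10` and `11`, the carry in register `7`, and the level in register `6`. The entry of the
label is left in register `12`, and register `8` is set to the level if it makes the lower levels
irrelevant. -/
def levelCases : Program :=
  branch (eq (reg 10) (const 0))
    (branch (eq (reg 7) (const 0))
      (set 12 (const 0))
      (seq (set 12 (const 1)) (seq (set 7 (const 0)) (set 8 (reg 6)))))
    (branch (lt (reg 11) (const 2))
      (seq (set 12 (const 2)) (seq (set 7 (const 0)) (set 8 (reg 6))))
      (branch (eq (reg 11) (const 2))
        (seq (set 12 (const 4)) (seq (set 7 (const 0)) (set 8 (reg 6))))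
        (branch (and (eq (reg 10) (const 1)) (eq (reg 11) (const 3)))
          (seq (set 12 (const 5)) (seq (set 7 (const 0)) (set 8 (reg 6))))
          (branch (and (eq (reg 10) (const 1)) (and (eq (reg 11) (const 4)) (eq (reg 7) (const 0))))
            (set 12 (const 5))
            (seq (set 12 (const 0)) (seq (set 7 (const 1)) (set 8 (reg 6))))))))

/-- The entry of the label is stored in array `7`, and register `9` is set to the level if the entry
is nonzero. -/
def levelWrite : Program :=
  seq (put 7 (reg 6) (reg 12)) <|
  seq (branch (eq (reg 12) (const 0)) skip (set 9 (reg 6))) <|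
  set 6 (add (reg 6) (const 1))

/-- One level of the computation of a label. The accumulators of the vertex are the parts of the
arrays `5` and `6` that start at the address in register `5`. -/
def levelStep : Program :=
  seq (set 10 (get 5 (add (reg 5) (reg 6)))) <|
  seq (set 11 (get 6 (add (reg 5) (reg 6)))) <|
  seq levelCases levelWrite

/-- Level `0` of the label of the vertex in register `3`. -/
def scanInit : Program :=
  seq (set 5 (get 4 (reg 3))) <|
  seq (set 10 (get 5 (reg 5))) <|
  seq (branch (eq (reg 10) (const 0))
    (seq (set 12 (const 1)) (set 7 (const 0)))
    (seq (set 12 (const 0)) (set 7 (const 1)))) <|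
  seq (put 7 (const 0) (reg 12)) <|
  seq (set 8 (const 0)) <|
  seq (set 9 (const 0)) <|
  set 6 (const 1)

/-- The label of the vertex in register `3`. -/
def scan : Program := seq scanInit (loop (lt (reg 6) (reg 1)) levelStep)

/-- The content of the machine after the first `k + 1` levels of the label with accumulators `m` and
`σ` have been computed, when it started in the state `s₀`. -/
structure ScanInv (s₀ : State) (B L : ℕ) (m σ : ℕ → ℕ) (k : ℕ) (s : State) : Prop where
  frame : ∀ r, r ≤ 4 → s.reg r = s₀.reg r
  arr : ∀ a, a ≠ 7 → s.arr a = s₀.arr a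
  base : s.reg 5 = B
  level : s.reg 6 = k + 1
  level_le : k + 1 ≤ L
  carry : s.reg 7 = (carry m σ k).toNat
  code : ∀ j, j ≤ k → s.arr 7 j = code m σ j
  cut_le : s.reg 8 ≤ k
  keeps : ∀ i, s.reg 8 ≤ i → i < k → Keeps m σ i
  not_keeps : ∀ i, s.reg 8 = i + 1 → ¬ Keeps m σ i
  top_le : s.reg 9 ≤ k
  top_code : s.reg 9 = 0 ∨ TreeLabel.code m σ (s.reg 9) ≠ 0
  above_top : ∀ j, s.reg 9 < j → j ≤ k → TreeLabel.code m σ j = 0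

lemma levelCode_le (c : Bool) (m s : ℕ) : levelCode c m s ≤ 5 := by
  unfold levelCode; split_ifs <;> norm_num

lemma levelWrite_spec {W B L k : ℕ} {m σ : ℕ → ℕ} {s₀ s s₁ : State} (h : ScanInv s₀ B L m σ k s)
    (hk : k + 1 < L) (hW : 6 ≤ W) (hBW : B + L < W) (h1 : ∀ r, r ≤ 4 → s₁.reg r = s₀.reg r)
    (h2 : s₁.arr = s.arr) (h3 : s₁.reg 5 = B) (h4 : s₁.reg 6 = k + 1)
    (h5 : s₁.reg 7 = (TreeLabel.carry m σ (k + 1)).toNat)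
    (h6 : s₁.reg 12 = TreeLabel.code m σ (k + 1)) (h7 : s₁.reg 9 = s.reg 9)
    (h8 : Keeps m σ k ∧ s₁.reg 8 = s.reg 8 ∨ ¬ Keeps m σ k ∧ s₁.reg 8 = k + 1) :
    levelWrite.wp W s₁ (ScanInv s₀ B L m σ (k + 1)) := by
  have hcode : TreeLabel.code m σ (k + 1) < W := (levelCode_le _ _ _).trans_lt (by omega)
  -- the clauses that do not depend on whether the entry vanishes
  have key : ∀ s' : State, (∀ r, r ≠ 6 → r ≠ 9 → s'.reg r = s₁.reg r) → s'.reg 6 = k + 2 →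
      s'.arr = Function.update s₁.arr 7
        (Function.update (s₁.arr 7) (k + 1) (TreeLabel.code m σ (k + 1))) →
      s'.reg 9 ≤ k + 1 → (s'.reg 9 = 0 ∨ TreeLabel.code m σ (s'.reg 9) ≠ 0) →
      (∀ j, s'.reg 9 < j → j ≤ k + 1 → TreeLabel.code m σ j = 0) →
      ScanInv s₀ B L m σ (k + 1) s' := by
    intro s' g1 g2 g3 g4 g5 g6
    refine ⟨fun r hr => by rw [g1 r (by omega) (by omega), h1 r hr], fun a ha => ?_,
      by rw [g1 5 (by omega) (by omega), h3], g2, hk, by rw [g1 7 (by omega) (by omega), h5],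
      fun j hj => ?_, ?_, ?_, ?_, g4, g5, g6⟩
    · rw [g3, Function.update_of_ne ha, h2, h.arr a ha]
    · rw [g3, Function.update_self]
      by_cases hjk : j = k + 1
      · rw [hjk, Function.update_self]
      · rw [Function.update_of_ne hjk, h2, h.code j (by omega)]
    all_goals rw [g1 8 (by omega) (by omega)]
    · have := h.cut_le
      rcases h8 with h8 | h8 <;> omega
    · intro i hi hik
      rcases h8 with h8 | h8
      · by_cases hik' : i = k
        · exact hik' ▸ h8.1
        · exact h.keeps i (by omega) (by omega)
      · omega
    · intro i hi
      rcases h8 with h8 | h8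
      · exact h.not_keeps i (h8.2 ▸ hi)
      · obtain rfl : i = k := by omega
        exact h8.1
  have htop := h.top_le
  simp only [levelWrite, Program.wp, Expr.Fits, Expr.eval, Test.Fits, Test.Holds, h4, h6]
  refine ⟨by omega, hcode, ⟨hcode, by omega⟩, fun h0 => ⟨⟨by omega, by omega, by omega⟩, ?_⟩,
    fun h0 => ⟨by omega, ?_⟩⟩
  · refine key _ (fun r hr hr' => Function.update_of_ne hr _ _) (by simp) rfl ?_ ?_ ?_
    all_goals simp only [ne_eq, Nat.reduceEqDiff, not_false_eq_true,
      Function.update_of_ne, h7]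
    · omega
    · exact h.top_code
    · intro j hj hjk
      by_cases hjk' : j = k + 1
      · rw [hjk', h0]
      · exact h.above_top j hj (by omega)
  · refine ⟨⟨?_, by omega, ?_⟩, key _ (fun r hr hr' => ?_) ?_ rfl ?_ ?_ ?_⟩ <;>
      simp only [ne_eq, Nat.reduceEqDiff, not_false_eq_true,
        Function.update_of_ne, Function.update_self, h4]
    · omega
    · omega
    · rw [Function.update_of_ne hr, Function.update_of_ne hr']
    · omega
    · exact .inr h0
    · intro j hj hjk; omega

lemma levelStep_spec {W B L k : ℕ} {m σ : ℕ → ℕ} {s₀ s : State} (h : ScanInv s₀ B L m σ k s)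
    (hk : k + 1 < L) (hW : 6 ≤ W) (hBW : B + L < W)
    (hm : s₀.arr 5 (B + (k + 1)) = m (k + 1)) (hσ : s₀.arr 6 (B + (k + 1)) = σ (k + 1))
    (hmW : m (k + 1) < W) (hσW : σ (k + 1) < W) :
    levelStep.wp W s (ScanInv s₀ B L m σ (k + 1)) := by
  have h7 : s.reg 7 < W := by rw [h.carry]; cases TreeLabel.carry m σ k <;> simp <;> omega
  have h70 : s.reg 7 = 0 ↔ TreeLabel.carry m σ k = false := by
    rw [h.carry]; cases TreeLabel.carry m σ k <;> simp
  have hfr := h.frame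
  simp only [levelStep, levelCases, Program.wp, Expr.Fits, Expr.eval, Test.Fits, Test.Holds,
    ne_eq, Nat.reduceEqDiff, not_false_eq_true, Function.update_of_ne,
    Function.update_self, h.base, h.level, h.arr 5 (by norm_num), h.arr 6 (by norm_num), hm,
    hσ, h70]
  have hkeep : ∀ c, Keeps m σ k → TreeLabel.carry m σ (k + 1) = false →
      TreeLabel.code m σ (k + 1) = c → levelWrite.wp W ⟨Function.update (Function.update
        (Function.update s.reg 10 (m (k + 1))) 11 (σ (k + 1))) 12 c, s.arr⟩
        (ScanInv s₀ B L m σ (k + 1)) := fun c h1 h2 h3 =>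
    levelWrite_spec h hk hW hBW (fun r hr => by
      dsimp only
      rw [Function.update_of_ne, Function.update_of_ne, Function.update_of_ne, h.frame r hr] <;>
        omega) rfl (by simp [h.base]) (by simp [h.level]) (by simp [h.carry, h1.1, h2])
      (by simp [h3]) (by simp) (.inl ⟨h1, by simp⟩)
  have hcut : ∀ c d, ¬ Keeps m σ k → (TreeLabel.carry m σ (k + 1)).toNat = d →
      TreeLabel.code m σ (k + 1) = c → levelWrite.wp W ⟨Function.update (Function.update
        (Function.update (Function.update (Function.update s.reg 10 (m (k + 1))) 11 (σ (k + 1)))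
          12 c) 7 d) 8 (k + 1), s.arr⟩
        (ScanInv s₀ B L m σ (k + 1)) := fun c d h1 h2 h3 =>
    levelWrite_spec h hk hW hBW (fun r hr => by
      dsimp only
      rw [Function.update_of_ne, Function.update_of_ne, Function.update_of_ne,
        Function.update_of_ne, Function.update_of_ne, h.frame r hr] <;> omega) rfl
      (by simp [h.base]) (by simp [h.level]) (by simp [h2]) (by simp [h3]) (by simp)
      (.inr ⟨h1, by simp⟩)
  have hcode : TreeLabel.code m σ (k + 1) =
    levelCode (TreeLabel.carry m σ k) (m (k + 1)) (σ (k + 1)) := rfl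
  have hcarry : TreeLabel.carry m σ (k + 1) =
    levelCarry (TreeLabel.carry m σ k) (m (k + 1)) (σ (k + 1)) := rfl
  unfold levelCode at hcode
  unfold levelCarry at hcarry
  have hw : ∀ j, j ≤ 5 → j < W := fun j hj => by omega
  simp only [hw _ (show 0 ≤ 5 by norm_num), hw _ (show 1 ≤ 5 by norm_num),
    hw _ (show 2 ≤ 5 by norm_num), hw _ (show 3 ≤ 5 by norm_num), hw _ (show 4 ≤ 5 by norm_num),
    hw _ (le_refl 5), hmW, hσW, h7, show B < W by omega, show k + 1 < W by omega,
    show B + (k + 1) < W by omega, true_and, and_self]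
  refine ⟨fun h0 => ⟨fun hc => ?_, fun hc => ?_⟩, fun h0 => ⟨fun h1 => ?_, fun h1 => ⟨fun h2 => ?_,
    fun h2 => ⟨fun h3 => ?_, fun h3 => ⟨fun h4 => ?_, fun h4 => ?_⟩⟩⟩⟩⟩
  · exact hkeep _ ⟨hc, .inl h0⟩ (by simp [hcarry, h0]) (by simp [hcode, h0, hc])
  · exact hcut _ _ (fun hk => hc hk.1) (by simp [hcarry, h0]) (by simp [hcode, h0, hc])
  · exact hcut _ _ (fun hk => by have := hk.2; omega)
      (by rw [hcarry, decide_eq_false (by omega)]; rfl)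
      (by rw [hcode, if_neg h0, if_pos (by omega)])
  · exact hcut _ _ (fun hk => by have := hk.2; omega)
      (by rw [hcarry, decide_eq_false (by omega)]; rfl)
      (by rw [hcode, if_neg h0, if_neg (by omega), if_pos h2])
  · exact hcut _ _ (fun hk => by have := hk.2; omega)
      (by rw [hcarry, decide_eq_false (by tauto)]; rfl)
      (by rw [hcode, if_neg h0, if_neg (by omega), if_neg h2, if_pos h3])
  · exact hkeep _ ⟨h4.2.2, .inr ⟨h4.1, h4.2.1⟩⟩ (by rw [hcarry, decide_eq_false (by tauto)])
      (by rw [hcode, if_neg h0, if_neg (by omega), if_neg h2, if_neg h3, if_pos h4])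
  · exact hcut _ _ (fun hk => h4 (by have := hk.1; have := hk.2; tauto))
      (by rw [hcarry, decide_eq_true ⟨h0, by omega, h3, h4⟩]; rfl)
      (by rw [hcode, if_neg h0, if_neg (by omega), if_neg h2, if_neg h3, if_neg h4])

lemma scanInit_spec {W B L v : ℕ} {m σ : ℕ → ℕ} {s : State} (hL : 1 ≤ L) (hW : 6 ≤ W)
    (hBW : B + L < W) (hv : s.reg 3 = v) (hvW : v < W) (hB : s.arr 4 v = B)
    (hm : s.arr 5 B = m 0) (hmW : m 0 < W) : scanInit.wp W s (ScanInv s B L m σ 0) := by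
  have key : ∀ c d, TreeLabel.code m σ 0 = c → (TreeLabel.carry m σ 0).toNat = d →
      ScanInv s B L m σ 0 ⟨Function.update (Function.update (Function.update (Function.update
        (Function.update (Function.update (Function.update s.reg 5 B) 10 (m 0)) 12 c) 7 d) 8 0) 9 0)
        6 1, Function.update s.arr 7 (Function.update (s.arr 7) 0 c)⟩ := by
    intro c d hc hd
    refine ⟨fun r hr => ?_, fun a ha => ?_, by simp, by simp, hL, by simp [hd], fun j hj => ?_,
      by simp, fun i _ hi => by omega, fun i hi => ?_, by simp, .inl (by simp), fun j hj hj' => ?_⟩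
    · dsimp only
      rw [Function.update_of_ne, Function.update_of_ne, Function.update_of_ne,
        Function.update_of_ne, Function.update_of_ne, Function.update_of_ne,
        Function.update_of_ne] <;> omega
    · exact Function.update_of_ne ha _ _
    · obtain rfl : j = 0 := by omega
      simp [hc]
    · simp at hi
    · simp at hj; omega
  have hw : ∀ j, j ≤ 5 → j < W := fun j hj => by omega
  simp only [scanInit, Program.wp, Expr.Fits, Expr.eval, Test.Fits, Test.Holds,
    ne_eq, Nat.reduceEqDiff, not_false_eq_true, Function.update_of_ne,
    Function.update_self, hv, hB, hm, hw _ (show 0 ≤ 5 by norm_num),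
    hw _ (show 1 ≤ 5 by norm_num), hvW, hmW, show B < W by omega, true_and, and_self]
  refine ⟨fun h0 => ?_, fun h0 => ?_⟩
  · exact key 1 0 (by simp [TreeLabel.code, h0]) (by simp [TreeLabel.carry, h0])
  · exact key 0 1 (by simp [TreeLabel.code, h0]) (by simp [TreeLabel.carry, h0])

/-- A bound for the number of steps of the computation of a label with `L` levels. -/
def scanTime (L : ℕ) : ℕ := 100 * L + 100

lemma scanLoop_spec {W B L : ℕ} {m σ : ℕ → ℕ} {s s₁ : State} (hW : 6 ≤ W)
    (hBW : B + L < W) (hregL : s.reg 1 = L) (hm : ∀ k, k < L → s.arr 5 (B + k) = m k)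
    (hσ : ∀ k, k < L → s.arr 6 (B + k) = σ k) (hmW : ∀ k, m k < W) (hσW : ∀ k, σ k < W)
    (h : ScanInv s B L m σ 0 s₁) :
    Exec W (loop (lt (reg 6) (reg 1)) levelStep) s₁ (L * 100 + 3) (ScanInv s B L m σ (L - 1)) := by
  have hcost : levelStep.maxCost ≤ 97 := by decide
  have hloop := Exec.loop (W := W) (b := lt (reg 6) (reg 1)) (c := levelStep) (t := 97)
    (fun s' => ∃ k, ScanInv s B L m σ k s') (fun s' => L - s'.reg 6) ?_ ?_ ⟨0, h⟩
  · refine hloop.mono (Nat.add_le_add_right (Nat.mul_le_mul_right _ (Nat.sub_le _ _)) _) ?_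
    rintro s' ⟨⟨k, hk⟩, hge⟩
    simp only [Test.Holds, Expr.eval, hk.level, hk.frame 1 (by norm_num), hregL] at hge
    obtain rfl : k = L - 1 := by have := hk.level_le; omega
    exact hk
  · rintro s' ⟨k, hk⟩
    have := hk.level_le
    simp only [Test.Fits, Expr.Fits, hk.level, hk.frame 1 (by norm_num), hregL]
    omega
  · rintro s' ⟨k, hk⟩ hlt
    simp only [Test.Holds, Expr.eval, hk.level, hk.frame 1 (by norm_num), hregL] at hlt
    refine (Exec.of_wp (levelStep_spec hk hlt hW hBW (hm _ hlt) (hσ _ hlt) (hmW _) (hσW _))).mono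
      hcost fun s'' hs'' => ⟨⟨_, hs''⟩, ?_⟩
    rw [hs''.level, hk.level]
    omega

/-- The first `L` levels of the label are computed. -/
lemma scan_spec {W B L v : ℕ} {m σ : ℕ → ℕ} {s : State} (hL : 1 ≤ L) (hW : 6 ≤ W)
    (hBW : B + L < W) (hregL : s.reg 1 = L) (hv : s.reg 3 = v) (hvW : v < W)
    (hB : s.arr 4 v = B) (hm : ∀ k, k < L → s.arr 5 (B + k) = m k)
    (hσ : ∀ k, k < L → s.arr 6 (B + k) = σ k) (hmW : ∀ k, m k < W) (hσW : ∀ k, σ k < W) :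
    Exec W scan s (scanTime L) (ScanInv s B L m σ (L - 1)) := by
  have hcost : scanInit.maxCost ≤ 97 := by decide
  exact ((Exec.of_wp (scanInit_spec (σ := σ) hL hW hBW hv hvW hB (hm 0 hL) (hmW 0))).seq
    fun s₁ hs₁ => scanLoop_spec hW hBW hregL hm hσ hmW hσW hs₁).mono
      (by unfold scanTime; omega) fun _ h => h

/-! ### Passing a label on to the parent -/

/-- One level of the label in array `7` is added to the accumulators of the parent, which start at
the address in register `13`. -/
def pushStep : Program :=
  seq (set 12 (get 7 (reg 6))) <|
  seq (branch (eq (reg 12) (const 0)) skip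
    (seq (put 5 (add (reg 13) (reg 6)) (add (get 5 (add (reg 13) (reg 6))) (const 1)))
      (put 6 (add (reg 13) (reg 6))
        (add (get 6 (add (reg 13) (reg 6))) (sub (reg 12) (const 1)))))) <|
  set 6 (add (reg 6) (const 1))

/-- The label in array `7`, from the level in register `8` on, is added to the accumulators of the
vertex in register `4`. -/
def push : Program :=
  seq (seq (set 13 (get 4 (reg 4))) (set 6 (reg 8))) (loop (lt (reg 6) (reg 1)) pushStep)

/-- The content of the machine after the levels below `k` of the label `a` have been added, when it
started in the state `s₀`. -/
structure PushInv (s₀ : State) (B L : ℕ) (a : ℕ → ℕ) (k : ℕ) (s : State) : Prop where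
  frame : ∀ r, r ≤ 4 → s.reg r = s₀.reg r
  arr : ∀ a, a ≠ 5 → a ≠ 6 → s.arr a = s₀.arr a
  base : s.reg 13 = B
  level : s.reg 6 = k
  level_le : k ≤ L
  total : ∀ j, j < k → s.arr 5 (B + j) = s₀.arr 5 (B + j) + if a j = 0 then 0 else 1
  weight : ∀ j, j < k → s.arr 6 (B + j) = s₀.arr 6 (B + j) + (a j - 1)
  rest : ∀ i, (∀ j, j < k → i ≠ B + j) → s.arr 5 i = s₀.arr 5 i ∧ s.arr 6 i = s₀.arr 6 i

lemma pushStep_spec {W B L k : ℕ} {a : ℕ → ℕ} {s₀ s : State} (h : PushInv s₀ B L a k s)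
    (hk : k < L) (hW : 6 ≤ W) (hBW : B + L < W) (ha : s₀.arr 7 k = a k) (ha5 : a k ≤ 5)
    (h5 : s₀.arr 5 (B + k) + 1 < W) (h6 : s₀.arr 6 (B + k) + 4 < W) :
    pushStep.wp W s (PushInv s₀ B L a (k + 1)) := by
  have e5 := (h.rest (B + k) fun j hj => by omega).1
  have e6 := (h.rest (B + k) fun j hj => by omega).2
  simp only [pushStep, Program.wp, Expr.Fits, Expr.eval, Test.Fits, Test.Holds,
    ne_eq, Nat.reduceEqDiff, not_false_eq_true, Function.update_of_ne,
    Function.update_self, h.base, h.level, h.arr 7 (by norm_num) (by norm_num), ha, e5, e6]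
  refine ⟨by omega, by omega, fun h0 => ⟨by omega, ?_⟩, fun h0 => ⟨by omega, by omega, by omega,
    by omega, by omega, ?_⟩⟩
  · refine ⟨fun r hr => ?_, h.arr, by simp [h.base], by simp, hk, fun j hj => ?_, fun j hj => ?_,
      fun i hi => h.rest i fun j hj => hi j (by omega)⟩
    · dsimp only
      rw [Function.update_of_ne, Function.update_of_ne, h.frame r hr] <;> omega
    · by_cases hjk : j = k
      · subst hjk; simp [e5, h0]
      · exact h.total j (by omega)
    · by_cases hjk : j = k
      · subst hjk; simp [e6, h0]
      · exact h.weight j (by omega)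
  · refine ⟨fun r hr => ?_, fun b hb hb' => ?_, by simp [h.base], by simp, hk, fun j hj => ?_,
      fun j hj => ?_, fun i hi => ?_⟩
    · dsimp only
      rw [Function.update_of_ne, Function.update_of_ne, h.frame r hr] <;> omega
    · dsimp only
      rw [Function.update_of_ne hb', Function.update_of_ne hb, h.arr b hb hb']
    · by_cases hjk : j = k
      · subst hjk; simp [h0]
      · simpa [hjk] using h.total j (by omega)
    · by_cases hjk : j = k
      · subst hjk; simp
      · simpa [hjk] using h.weight j (by omega)
    · have := hi k (by omega)
      simpa [this] using h.rest i fun j hj => hi j (by omega)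

/-- A bound for the number of steps of passing on a label with `L` levels. -/
def pushTime (L : ℕ) : ℕ := 100 * L + 100

/-- The levels of the label below the level `q` in register `8` are treated as zero. -/
lemma push_spec {W B L q p : ℕ} {a : ℕ → ℕ} {s : State} (hW : 6 ≤ W) (hBW : B + L < W)
    (hregL : s.reg 1 = L) (hp : s.reg 4 = p) (hpW : p < W) (hB : s.arr 4 p = B)
    (hq : s.reg 8 = q) (hqL : q ≤ L) (ha0 : ∀ k, k < q → a k = 0)
    (ha : ∀ k, q ≤ k → k < L → s.arr 7 k = a k) (ha5 : ∀ k, a k ≤ 5)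
    (h5 : ∀ k, k < L → s.arr 5 (B + k) + 1 < W) (h6 : ∀ k, k < L → s.arr 6 (B + k) + 4 < W) :
    Exec W push s (pushTime L) (PushInv s B L a L) := by
  have hcost : pushStep.maxCost ≤ 97 := by decide
  have hinit : (seq (set 13 (get 4 (reg 4))) (set 6 (reg 8))).wp W s
      fun s' => ∃ k, q ≤ k ∧ PushInv s B L a k s' := by
    simp only [Program.wp, Expr.Fits, Expr.eval, ne_eq, Nat.reduceEqDiff, not_false_eq_true,
      Function.update_of_ne, hp, hB, hq]
    refine ⟨by omega, by omega, q, le_rfl, fun r hr => ?_, fun _ _ _ => rfl, by simp, by simp, hqL,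
      fun j hj => by simp [ha0 j hj], fun j hj => by simp [ha0 j hj], fun _ _ => ⟨rfl, rfl⟩⟩
    dsimp only
    rw [Function.update_of_ne, Function.update_of_ne] <;> omega
  refine ((Exec.of_wp hinit).seq (t₂ := L * 100 + 3) fun s₁ hs₁ => ?_).mono
    (show 5 + (L * 100 + 3) ≤ pushTime L by unfold pushTime; omega) fun _ h => h
  have hloop := Exec.loop (W := W) (b := lt (reg 6) (reg 1)) (c := pushStep) (t := 97)
    (fun s' => ∃ k, q ≤ k ∧ PushInv s B L a k s') (fun s' => L - s'.reg 6) ?_ ?_ hs₁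
  · refine hloop.mono (Nat.add_le_add_right (Nat.mul_le_mul_right _ (Nat.sub_le _ _)) _) ?_
    rintro s' ⟨⟨k, -, hk⟩, hge⟩
    simp only [Test.Holds, Expr.eval, hk.level, hk.frame 1 (by norm_num), hregL] at hge
    obtain rfl : k = L := by have := hk.level_le; omega
    exact hk
  · rintro s' ⟨k, -, hk⟩
    have := hk.level_le
    simp only [Test.Fits, Expr.Fits, hk.level, hk.frame 1 (by norm_num), hregL]
    omega
  · rintro s' ⟨k, hqk, hk⟩ hlt
    simp only [Test.Holds, Expr.eval, hk.level, hk.frame 1 (by norm_num), hregL] at hlt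
    refine (Exec.of_wp (pushStep_spec hk hlt hW hBW (ha _ hqk hlt) (ha5 k) (h5 _ hlt)
      (h6 _ hlt))).mono hcost fun s'' hs'' => ⟨⟨_, by omega, hs''⟩, ?_⟩
    rw [hs''.level, hk.level]
    omega

end RAM

namespace RAM
open TreeLabel RAM.Expr RAM.Test RAM.Program

/-! ### Reading the graph -/

section Input

variable {n : ℕ} (adj : Fin n → List (Fin n))

/-- The position in the concatenation of the adjacency lists where the list of `v` starts. -/
def offset (v : ℕ) : ℕ := ((List.ofFn adj).take v).flatten.length

/-- The entries of the concatenation of the adjacency lists. -/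
def entry (j : ℕ) : ℕ := ((List.ofFn adj).flatten.map Fin.val).getD j 0

/-- The adjacency list of `v`, as a list of numbers. -/
def row (v : ℕ) : List ℕ := if h : v < n then (adj ⟨v, h⟩).map Fin.val else []

lemma offset_zero : offset adj 0 = 0 := by simp [offset]

lemma flatten_take_succ (v : ℕ) : (((List.ofFn adj).take (v + 1)).flatten.map Fin.val) =
    ((List.ofFn adj).take v).flatten.map Fin.val ++ row adj v := by
  rw [List.take_add_one]
  unfold row
  split_ifs with h
  · simp [h]
  · simp [h]

lemma offset_succ (v : ℕ) : offset adj (v + 1) = offset adj v + (row adj v).length := by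
  have := congrArg List.length (flatten_take_succ adj v)
  rwa [List.length_append, List.length_map, List.length_map] at this

lemma offset_mono {u v : ℕ} (h : u ≤ v) : offset adj u ≤ offset adj v :=
  monotone_nat_of_le_succ (fun v => by rw [offset_succ]; omega) h

lemma entry_offset_add {v t : ℕ} (ht : t < (row adj v).length) :
    entry adj (offset adj v + t) = (row adj v)[t] := by
  have h1 : (List.ofFn adj).flatten.map Fin.val =
      (((List.ofFn adj).take (v + 1)).flatten.map Fin.val) ++
        ((List.ofFn adj).drop (v + 1)).flatten.map Fin.val := by
    rw [← List.map_append, ← List.flatten_append, List.take_append_drop]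
  have h2 : offset adj v = (((List.ofFn adj).take v).flatten.map Fin.val).length :=
    (List.length_map _).symm
  rw [entry, h1, flatten_take_succ, List.append_assoc, h2,
    List.getD_append_right _ _ _ _ (by omega), Nat.add_sub_cancel_left, List.getD_append _ _ _ _ ht,
    List.getD_eq_getElem]

lemma row_lt {v x : ℕ} (hx : x ∈ row adj v) : x < n := by
  unfold row at hx
  split_ifs at hx
  · obtain ⟨y, -, rfl⟩ := List.mem_map.1 hx
    exact y.2
  · simp at hx

end Input

/-- Registers `1` and `14` are set to the number `L` of levels and to `2 ^ L`, where `L` is the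
least number with `n < 2 ^ L`. -/
def levels : Program :=
  seq (set 14 (const 1)) <|
  loop (lt (reg 14) (add (reg 0) (const 1)))
    (seq (set 14 (add (reg 14) (reg 14))) (set 1 (add (reg 1) (const 1))))

lemma levels_spec {W n : ℕ} {s : State} (hn : 1 ≤ n) (hW : 2 * n + 2 < W) (h0 : s.reg 0 = n)
    (h1 : s.reg 1 = 0) : Exec W levels s (20 * n + 20) fun s' =>
      s'.reg 1 = Nat.log 2 n + 1 ∧ s'.arr = s.arr ∧ ∀ r, r ≠ 1 → r ≠ 14 → s'.reg r = s.reg r := by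
  have hinit : (set 14 (const 1)).wp W s fun s' => ∃ L, s'.reg 1 = L ∧ s'.reg 14 = 2 ^ L ∧
      (∀ i, L = i + 1 → 2 ^ i ≤ n) ∧ s'.arr = s.arr ∧
        ∀ r, r ≠ 1 → r ≠ 14 → s'.reg r = s.reg r := by
    simp only [Program.wp, Expr.Fits, Expr.eval]
    exact ⟨by omega, 0, by simp [h1], by simp, by simp, trivial,
      fun r _ hr => Function.update_of_ne hr _ _⟩
  refine ((Exec.of_wp hinit).seq (t₂ := n * 15 + 5) fun s₁ hs₁ => ?_).mono
    (show 2 + (n * 15 + 5) ≤ _ by omega) fun _ h => h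
  have hloop := Exec.loop (W := W) (b := lt (reg 14) (add (reg 0) (const 1)))
    (c := seq (set 14 (add (reg 14) (reg 14))) (set 1 (add (reg 1) (const 1)))) (t := 8)
    (fun s' => ∃ L, s'.reg 1 = L ∧ s'.reg 14 = 2 ^ L ∧ (∀ i, L = i + 1 → 2 ^ i ≤ n) ∧
      s'.arr = s.arr ∧ ∀ r, r ≠ 1 → r ≠ 14 → s'.reg r = s.reg r) (fun s' => n + 1 - s'.reg 14)
    ?_ ?_ hs₁
  · refine hloop.mono ?_ ?_
    · obtain ⟨L, -, h2, -⟩ := hs₁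
      have := Nat.one_le_two_pow (n := L)
      exact Nat.add_le_add_right (Nat.mul_le_mul (by omega) (by decide)) _
    · rintro s' ⟨⟨L, h1', h2, h3, h4, h5⟩, hge⟩
      simp only [Test.Holds, Expr.eval, h2, h5 0 (by norm_num) (by norm_num), h0] at hge
      refine ⟨?_, h4, h5⟩
      obtain ⟨L, rfl⟩ : ∃ L', L = L' + 1 := by
        refine ⟨L - 1, ?_⟩
        rcases L with _ | L
        · simp at hge; omega
        · simp
      rw [h1', Nat.log_eq_of_pow_le_of_lt_pow (h3 L rfl) (by omega)]
  · rintro s' ⟨L, h1', h2, h3, h4, h5⟩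
    have : 2 ^ L ≤ 2 * n := by
      rcases L with _ | L
      · simp; omega
      · have := h3 L rfl
        rw [pow_succ]; omega
    simp only [Test.Fits, Expr.Fits, Expr.eval, h2, h5 0 (by norm_num) (by norm_num), h0]
    omega
  · rintro s' ⟨L, h1', h2, h3, h4, h5⟩ hlt
    simp only [Test.Holds, Expr.eval, h2, h5 0 (by norm_num) (by norm_num), h0] at hlt
    have hL : L < 2 ^ L := L.lt_two_pow_self
    refine Exec.of_wp (p := seq _ _) ?_
    simp only [Program.wp, Expr.Fits, Expr.eval, ne_eq, OfNat.one_ne_ofNat, OfNat.ofNat_ne_one,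
      not_false_eq_true, Function.update_of_ne, Function.update_self, h1', h2]
    refine ⟨by omega, by omega, ⟨L + 1, rfl, by rw [pow_succ]; omega, fun i hi => ?_, h4,
      fun r hr hr' => ?_⟩, ?_⟩
    · obtain rfl : L = i := by omega
      omega
    · rw [Function.update_of_ne hr, Function.update_of_ne hr', h5 r hr hr']
    · omega

/-- The arrays `2`, `3` and `4` are filled with the degrees, with the sums of the neighbours, and
with the addresses of the accumulators of the vertices. Register `3` runs through the vertices,
register `15` through the concatenation of the adjacency lists. -/
def readStep : Program :=
  branch (lt (reg 15) (get 0 (add (reg 3) (const 1))))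
    (seq (put 3 (reg 3) (add (get 3 (reg 3)) (get 1 (reg 15)))) (set 15 (add (reg 15) (const 1))))
    (seq (put 4 (reg 3) (reg 14)) <|
      seq (set 14 (add (reg 14) (reg 1))) <|
      seq (put 2 (reg 3) (sub (get 0 (add (reg 3) (const 1))) (get 0 (reg 3)))) <|
      set 3 (add (reg 3) (const 1)))

/-- The content of the machine after the vertices below `v` and the first `t` neighbours of `v` have
been processed. -/
structure ReadInv {n : ℕ} (adj : Fin n → List (Fin n)) (L v t : ℕ) (s : State) : Prop where
  reg_zero : s.reg 0 = n
  reg_one : s.reg 1 = L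
  reg_two : s.reg 2 = 0
  reg_three : s.reg 3 = v
  reg_four : s.reg 4 = 0
  acc : s.reg 14 = v * L
  pos : s.reg 15 = offset adj v + t
  le : v ≤ n
  pos_le : t ≤ (row adj v).length
  off : ∀ i, i ≤ n → s.arr 0 i = offset adj i
  entries : s.arr 1 = entry adj
  deg : ∀ u, u < v → s.arr 2 u = (row adj u).length
  sum : ∀ u, u < v → s.arr 3 u = (row adj u).sum
  sum_self : s.arr 3 v = ((row adj v).take t).sum
  sum_above : ∀ u, v < u → s.arr 3 u = 0
  base : ∀ u, u < v → s.arr 4 u = u * L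
  five : s.arr 5 = fun _ => 0
  six : s.arr 6 = fun _ => 0

lemma sum_take_row_le {n : ℕ} {adj : Fin n → List (Fin n)} {v : ℕ}
    (h : (row adj v).length ≤ n) (t : ℕ) : ((row adj v).take t).sum ≤ n * n := by
  refine (List.sum_le_card_nsmul _ n fun x hx => (row_lt adj (List.mem_of_mem_take hx)).le).trans ?_
  rw [smul_eq_mul]
  exact Nat.mul_le_mul_right _ (by rw [List.length_take]; omega)

lemma readStep_spec {W n L v t : ℕ} {adj : Fin n → List (Fin n)} {s : State}
    (h : ReadInv adj L v t s) (hv : v < n) (hW : n * n + n * L + 2 * n + 2 < W)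
    (hoff : offset adj n ≤ 2 * n) (hlen : (row adj v).length ≤ n) :
    readStep.wp W s fun s' => (∃ v' t', ReadInv adj L v' t' s') ∧
      s'.reg 3 + s'.reg 15 = s.reg 3 + s.reg 15 + 1 := by
  have h1 := offset_mono adj hv.le
  have h2 : offset adj (v + 1) ≤ offset adj n := offset_mono adj hv
  have h3 := offset_succ adj v
  have h4 := sum_take_row_le hlen
  have h5 := h.pos_le
  have hvL : v * L + L ≤ n * L := by
    rw [← Nat.succ_mul]; exact Nat.mul_le_mul_right _ hv
  simp only [readStep, Program.wp, Expr.Fits, Expr.eval, Test.Fits, Test.Holds, ne_eq,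
    OfNat.zero_ne_ofNat, Nat.reduceEqDiff,
    not_false_eq_true, Function.update_of_ne, Function.update_self, h.reg_three, h.pos, h.acc,
    h.reg_one, h.off v hv.le, h.off (v + 1) hv, h.entries, h.sum_self]
  refine ⟨by omega, fun hlt => ?_, fun hge => ?_⟩
  · have ht : t < (row adj v).length := by omega
    have hx := row_lt adj (List.getElem_mem ht)
    rw [entry_offset_add adj ht]
    have hs : ((row adj v).take t).sum + (row adj v)[t] = ((row adj v).take (t + 1)).sum := by
      rw [List.sum_take_succ _ _ ht]
    have h6 := h4 t
    have h7 := h4 (t + 1)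
    refine ⟨by omega, by omega, by omega, ⟨v, t + 1, ?_⟩, by omega⟩
    refine ⟨by simp [h.reg_zero], by simp [h.reg_one], by simp [h.reg_two], by simp [h.reg_three],
      by simp [h.reg_four], by simp [h.acc], by simp; omega, h.le, ht, by simpa using h.off,
      by simpa using h.entries, by simpa using h.deg, fun u hu => ?_, by simp [hs], fun u hu => ?_,
      by simpa using h.base, by simpa using h.five, by simpa using h.six⟩
    · simpa [hu.ne] using h.sum u hu
    · simpa [hu.ne'] using h.sum_above u hu
  · obtain rfl : t = (row adj v).length := by omega
    refine ⟨by omega, by omega, by omega, by omega, by omega, by omega, ⟨v + 1, 0, ?_⟩, by omega⟩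
    refine ⟨by simp [h.reg_zero], by simp [h.reg_one], by simp [h.reg_two], by simp,
      by simp [h.reg_four], by simp [Nat.succ_mul], by simp [h.pos, h3], hv, Nat.zero_le _,
      by simpa using h.off, by simpa using h.entries, fun u hu => ?_, fun u hu => ?_, ?_,
      fun u hu => ?_, fun u hu => ?_, by simpa using h.five, by simpa using h.six⟩
    · by_cases huv : u = v
      · subst huv; simp; omega
      · simpa [huv] using h.deg u (by omega)
    · by_cases huv : u = v
      · subst huv; simpa using h.sum_self
      · simpa using h.sum u (by omega)
    · simpa using h.sum_above (v + 1) (by omega)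
    · simpa using h.sum_above u (by omega)
    · by_cases huv : u = v
      · subst huv; simp
      · simpa [huv] using h.base u (by omega)

/-- The initialization: the number of levels is computed and the graph is read. -/
def prepare : Program := seq levels (seq (set 14 (const 0)) (loop (lt (reg 3) (reg 0)) readStep))

lemma prepare_spec {W n L : ℕ} {adj : Fin n → List (Fin n)} (hn : 1 ≤ n)
    (hL : L = Nat.log 2 n + 1) (hW : n * n + n * L + 2 * n + 2 < W)
    (hoff : offset adj n ≤ 2 * n) (hlen : ∀ v, (row adj v).length ≤ n) :
    Exec W prepare (graphInput adj) (200 * n + 200) (ReadInv adj L n 0) := by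
  have h1 := levels_spec (W := W) (s := graphInput adj) hn (by omega) rfl rfl
  have hcost : readStep.maxCost ≤ 47 := by decide
  refine (h1.seq (t₂ := 2 + ((n + 2 * n) * 50 + 3)) fun s₁ hs₁ => ?_).mono (by omega) fun _ h => h
  obtain ⟨g1, g2, g3⟩ := hs₁
  have hinit : (set 14 (const 0)).wp W s₁ fun s' => ∃ v t, ReadInv adj L v t s' := by
    simp only [Program.wp, Expr.Fits, Expr.eval]
    refine ⟨by omega, 0, 0, ?_⟩
    refine ⟨?_, by simp [g1, hL], ?_, ?_, ?_, by simp, ?_, by omega, Nat.zero_le _,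
      fun i hi => ?_, ?_,
      by simp, by simp, ?_, fun u hu => ?_, by simp, ?_, ?_⟩
    · simp [g3, graphInput]
    · simp [g3, graphInput]
    · simp [g3, graphInput]
    · simp [g3, graphInput]
    · simp [g3, graphInput, offset_zero]
    · simp only [g2, graphInput, if_true, if_pos hi, offset]
    · funext j; simp [g2, graphInput, entry]
    · simp [g2, graphInput]
    · simp [g2, graphInput]
    · funext j; simp [g2, graphInput]
    · funext j; simp [g2, graphInput]
  refine (Exec.of_wp hinit).seq fun s₂ hs₂ => ?_
  have hpos : ∀ v t s', ReadInv adj L v t s' → offset adj v + t ≤ offset adj n := by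
    intro v t s' h
    have h5 := h.pos_le
    rw [← Nat.add_le_add_iff_left (n := offset adj v), ← offset_succ] at h5
    rcases h.le.lt_or_eq with hv | rfl
    · exact h5.trans (offset_mono adj hv)
    · refine h5.trans ?_
      rw [offset_succ]
      simp [row]
  have hloop := Exec.loop (W := W) (b := lt (reg 3) (reg 0)) (c := readStep) (t := 47)
    (fun s' => ∃ v t, ReadInv adj L v t s')
    (fun s' => (n - s'.reg 3) + (offset adj n - s'.reg 15)) ?_ ?_ hs₂
  · refine hloop.mono (Nat.add_le_add_right (Nat.mul_le_mul_right _ (by omega)) _) ?_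
    rintro s' ⟨⟨v, t, hk⟩, hge⟩
    simp only [Test.Holds, Expr.eval, hk.reg_zero, hk.reg_three] at hge
    obtain rfl : v = n := by have := hk.le; omega
    have := hk.pos_le
    simp only [row, lt_irrefl, dite_false, List.length_nil] at this
    obtain rfl : t = 0 := by omega
    exact hk
  · rintro s' ⟨v, t, hk⟩
    have := hk.le
    simp only [Test.Fits, Expr.Fits, hk.reg_zero, hk.reg_three]
    omega
  · rintro s' ⟨v, t, hk⟩ hlt
    simp only [Test.Holds, Expr.eval, hk.reg_zero, hk.reg_three] at hlt
    refine (Exec.of_wp (readStep_spec hk hlt hW hoff (hlen v))).mono hcost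
      fun s'' ⟨⟨v', t', h'⟩, hs''⟩ => ⟨⟨v', t', h'⟩, ?_⟩
    have e1 := hpos _ _ _ hk
    have e2 := hpos _ _ _ h'
    have e3 := h'.le
    rw [hk.reg_three, hk.pos, h'.reg_three, h'.pos] at hs''
    rw [hk.reg_three, hk.pos, h'.reg_three, h'.pos]
    omega

end RAM

namespace RAM
open TreeLabel SimpleGraph RAM.Expr RAM.Test RAM.Program

/-! ### The elimination of leaves on the machine -/

/-- After a leaf in register `3` has been passed on to its neighbour in register `4`, the degrees
and the sums of the neighbours are updated, and the neighbour is inspected next. -/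
def absorbEnd : Program :=
  seq (put 2 (reg 3) (const 0)) <|
  seq (put 2 (reg 4) (sub (get 2 (reg 4)) (const 1))) <|
  seq (put 3 (reg 4) (sub (get 3 (reg 4)) (reg 3))) <|
  set 3 (reg 4)

/-- The leaf in register `3` is removed. Its only neighbour is the sum of its neighbours. -/
def absorb : Program :=
  seq scan (seq (set 4 (get 3 (reg 3))) (seq push absorbEnd))

/-- Register `2` runs through all vertices. From each of them a chain of removals is started, which
continues with the neighbour of the removed leaf as long as this is a leaf that has been inspected
before. -/
def elimStep : Program :=
  branch (and (eq (get 2 (reg 3)) (const 1)) (not (lt (reg 2) (reg 3)))) absorb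
    (seq (set 2 (add (reg 2) (const 1))) (set 3 (reg 2)))

/-- The program that computes the linear induced matching width of a tree. -/
def lmwProgram : Program :=
  seq prepare <|
  seq (set 3 (const 0)) <|
  seq (loop (lt (reg 2) (reg 0)) elimStep) <|
  seq (set 3 (reg 4)) <|
  seq scan (set 0 (reg 9))

variable {n : ℕ} {G : SimpleGraph (Fin n)}

/-- The content of the machine during the elimination of the leaves. The remaining tree has the
vertex set `A`. Arrays `2` and `3` hold the degrees in it and the sums of the neighbours in it; a
removed vertex has degree `0`, so it is not mistaken for a leaf. The labels absorbed by the vertex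
`u` have been added up to `m u` and `σ u` in the parts of the arrays `5` and `6` that start at
`u * L`. The vertices up to `i`, except possibly `v`, are no leaves of the remaining tree. -/
structure ElimInv (G : SimpleGraph (Fin n)) (L : ℕ) (A : Finset (Fin n)) (m σ : Fin n → ℕ → ℕ)
    (i v : ℕ) (s : State) : Prop where
  reg_zero : s.reg 0 = n
  reg_one : s.reg 1 = L
  reg_two : s.reg 2 = i
  reg_three : s.reg 3 = v
  reg_four : ∃ p ∈ A, s.reg 4 = (p : Fin n)
  le : i ≤ n
  lt : i < n → v < n
  last : i = n → v = n
  elim : ∃ F, G.Elimination A F m σ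
  base : ∀ u, u < n → s.arr 4 u = u * L
  deg : ∀ u ∈ A, s.arr 2 u = (G.nbrs A u).card
  sum : ∀ u ∈ A, s.arr 3 u = ∑ w ∈ G.nbrs A u, (w : ℕ)
  removed : ∀ u, u ∉ A → s.arr 2 (u : Fin n) = 0
  total : ∀ u ∈ A, ∀ k, k < L → s.arr 5 (u * L + k) = m u k
  weight : ∀ u ∈ A, ∀ k, k < L → s.arr 6 (u * L + k) = σ u k
  inspected : ∀ u ∈ A, (u : ℕ) ≤ i → (u : ℕ) ≠ v → (G.nbrs A u).card ≠ 1

lemma label_le (m σ : ℕ → ℕ) (k : ℕ) : label m σ k ≤ 5 := by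
  unfold label
  split_ifs
  · cases k with
    | zero => unfold TreeLabel.code; split_ifs <;> norm_num
    | succ k => exact levelCode_le _ _ _
  · norm_num

/-- What the computation of a label has found is the label. -/
lemma ScanInv.label_eq {s₀ s : State} {B L : ℕ} {m σ : ℕ → ℕ} {S : Finset (Fin n)} {r : Fin n}
    (h : ScanInv s₀ B L m σ (L - 1) s) (hR : G.Rooted S r m σ) (hS : S.card < 2 ^ L) :
    (∀ k, k < s.reg 8 → label m σ k = 0) ∧
      ∀ k, s.reg 8 ≤ k → k < L → s.arr 7 k = label m σ k := by
  have hL := h.level_le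
  have hq := h.cut_le
  constructor
  · intro k hk
    refine if_neg fun hal => ?_
    obtain ⟨i, hi⟩ : ∃ i, s.reg 8 = i + 1 := ⟨s.reg 8 - 1, by omega⟩
    exact h.not_keeps i hi (hal i (by omega))
  · intro k hk hkL
    rw [label, if_pos, h.code k (by omega)]
    exact (hR.alive_iff_lt hS k).2 fun j hj hjL => h.keeps j (by omega) (by omega)

lemma index_ne {L u w k j : ℕ} (huw : u ≠ w) (hk : k < L) (hj : j < L) :
    u * L + k ≠ w * L + j := by
  intro h
  have h1 : (u * L + k) / L = u := by
    rw [Nat.mul_comm, Nat.mul_add_div (by omega), Nat.div_eq_of_lt hk, Nat.add_zero]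
  have h2 : (w * L + j) / L = w := by
    rw [Nat.mul_comm, Nat.mul_add_div (by omega), Nat.div_eq_of_lt hj, Nat.add_zero]
  exact huw (by rw [← h1, ← h2, h])

lemma index_add_le {L u : ℕ} (hu : u < n) : u * L + L ≤ n * L := by
  rw [← Nat.succ_mul]; exact Nat.mul_le_mul_right _ hu

lemma ElimInv.label_bounds {L : ℕ} {A : Finset (Fin n)} {m σ : Fin n → ℕ → ℕ} {i v : ℕ} {s : State}
    (h : ElimInv G L A m σ i v s) {u : Fin n} (hu : u ∈ A) (k : ℕ) : m u k ≤ n ∧ σ u k ≤ 4 * n := by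
  obtain ⟨F, hF⟩ := h.elim
  have h1 := (hF.rooted u hu).le_card k
  have h2 := (hF.rooted u hu).bounded k
  have h3 : (F u).card ≤ n := by simpa using Finset.card_le_univ (F u)
  omega

lemma ElimInv.scan_spec {W L : ℕ} {A : Finset (Fin n)} {m σ : Fin n → ℕ → ℕ} {i v : ℕ}
    {s₀ s : State} (h : ElimInv G L A m σ i v s₀) (hL : 1 ≤ L)
    (hW : n * n + n * L + 8 * n + 8 < W) (h1 : s.reg 1 = s₀.reg 1) (h2 : s.arr = s₀.arr)
    {u : Fin n} (hu : u ∈ A) (h3 : s.reg 3 = u) :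
    Exec W scan s (scanTime L) (ScanInv s (u * L) L (m u) (σ u) (L - 1)) := by
  have hn := u.2
  have := index_add_le (L := L) hn
  refine RAM.scan_spec hL (by omega) (by omega) (by rw [h1, h.reg_one]) h3 (by omega)
    (by rw [h2, h.base u hn]) (fun k hk => by rw [h2, h.total u hu k hk])
    (fun k hk => by rw [h2, h.weight u hu k hk]) (fun k => ?_) fun k => ?_
  · have := (h.label_bounds hu k).1; omega
  · have := (h.label_bounds hu k).2; omega

/-- The invariant after the removal of the leaf `v` with the neighbour `p`. -/
lemma ElimInv.absorb {L : ℕ} {A : Finset (Fin n)} {m σ : Fin n → ℕ → ℕ} {i : ℕ} {v p : Fin n}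
    {s₀ s : State} (h : ElimInv G L A m σ i v s₀) (hvA : v ∈ A) (hv : G.nbrs A v = {p})
    (hin : i < n)
    (hreg : ∀ r, r ≤ 2 → s.reg r = s₀.reg r) (h3 : s.reg 3 = p) (h4 : s.reg 4 = p)
    (harr4 : s.arr 4 = s₀.arr 4)
    (harr2 : s.arr 2 = Function.update (Function.update (s₀.arr 2) v 0) p (s₀.arr 2 p - 1))
    (harr3 : s.arr 3 = Function.update (s₀.arr 3) p (s₀.arr 3 p - v))
    (harr5 : ∀ j, j < L → s.arr 5 (p * L + j) =
      s₀.arr 5 (p * L + j) + if label (m v) (σ v) j = 0 then 0 else 1)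
    (harr6 : ∀ j, j < L → s.arr 6 (p * L + j) = s₀.arr 6 (p * L + j) + (label (m v) (σ v) j - 1))
    (hrest : ∀ i, (∀ j, j < L → i ≠ p * L + j) → s.arr 5 i = s₀.arr 5 i ∧ s.arr 6 i = s₀.arr 6 i) :
    ElimInv G L (A.erase v)
      (Function.update m p fun k => m p k + if label (m v) (σ v) k = 0 then 0 else 1)
      (Function.update σ p fun k => σ p k + (label (m v) (σ v) k - 1)) i p s := by
  have hp := mem_nbrs.1 (show p ∈ G.nbrs A v by rw [hv]; simp)
  have hpv : p ≠ v := hp.2.ne'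
  have hval : ∀ {u w : Fin n}, u ≠ w → (u : ℕ) ≠ w := fun h h' => h (Fin.ext h')
  obtain ⟨F, hF⟩ := h.elim
  have hnbr : ∀ u ∈ A, u ≠ p → G.nbrs (A.erase v) u = G.nbrs A u := fun u hu hup =>
    Elimination.nbrs_erase_eq hv hu hup
  refine ⟨by rw [hreg 0 (by omega), h.reg_zero], by rw [hreg 1 (by omega), h.reg_one],
    by rw [hreg 2 le_rfl, h.reg_two], h3, ⟨p, Finset.mem_erase.2 ⟨hpv, hp.1⟩, h4⟩, h.le,
    fun _ => p.2, fun h => by omega, ⟨_, hF.step hvA hv⟩, by rw [harr4]; exact h.base,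
    fun u hu => ?_, fun u hu => ?_, fun u hu => ?_, fun u hu k hk => ?_, fun u hu k hk => ?_,
    fun u hu hui hup => ?_⟩
  · obtain ⟨huv, huA⟩ := Finset.mem_erase.1 hu
    rw [harr2]
    by_cases hup : u = p
    · subst hup
      rw [Function.update_self, h.deg u huA, nbrs_erase,
        Finset.card_erase_of_mem (Elimination.mem_nbrs_of_eq hv hvA)]
    · rw [Function.update_of_ne (hval hup), Function.update_of_ne (hval huv), h.deg u huA,
        hnbr u huA hup]
  · obtain ⟨huv, huA⟩ := Finset.mem_erase.1 hu
    rw [harr3]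
    by_cases hup : u = p
    · subst hup
      rw [Function.update_self, h.sum u huA, nbrs_erase,
        ← Finset.add_sum_erase _ _ (Elimination.mem_nbrs_of_eq hv hvA), Nat.add_sub_cancel_left]
    · rw [Function.update_of_ne (hval hup), h.sum u huA, hnbr u huA hup]
  · rw [harr2]
    have hup : u ≠ p := by
      rintro rfl
      exact hu (Finset.mem_erase.2 ⟨hpv, hp.1⟩)
    rw [Function.update_of_ne (hval hup)]
    by_cases huv : u = v
    · rw [huv, Function.update_self]
    · rw [Function.update_of_ne (hval huv)]
      exact h.removed u fun huA => hu (Finset.mem_erase.2 ⟨huv, huA⟩)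
  · obtain ⟨huv, huA⟩ := Finset.mem_erase.1 hu
    by_cases hup : u = p
    · subst hup
      rw [Function.update_self, harr5 k hk, h.total u huA k hk]
    · rw [Function.update_of_ne hup, (hrest _ fun j hj => index_ne (hval hup) hk hj).1,
        h.total u huA k hk]
  · obtain ⟨huv, huA⟩ := Finset.mem_erase.1 hu
    by_cases hup : u = p
    · subst hup
      rw [Function.update_self, harr6 k hk, h.weight u huA k hk]
    · rw [Function.update_of_ne hup, (hrest _ fun j hj => index_ne (hval hup) hk hj).2,
        h.weight u huA k hk]
  · obtain ⟨huv, huA⟩ := Finset.mem_erase.1 hu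
    have hup' : u ≠ p := fun h => hup (congrArg _ h)
    rw [hnbr u huA hup']
    exact h.inspected u huA hui (hval huv)

/-- A bound for the number of steps of the removal of a leaf. -/
def absorbTime (L : ℕ) : ℕ := 200 * L + 250

lemma absorb_spec {W L : ℕ} {A : Finset (Fin n)} {m σ : Fin n → ℕ → ℕ} {i : ℕ} {v p : Fin n}
    {s : State} (h : ElimInv G L A m σ i v s) (hL : 1 ≤ L) (hnL : n < 2 ^ L)
    (hW : n * n + n * L + 8 * n + 8 < W) (hvA : v ∈ A) (hv : G.nbrs A v = {p}) (hin : i < n) :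
    Exec W absorb s (absorbTime L) fun s' => ∃ m' σ', ElimInv G L (A.erase v) m' σ' i p s' := by
  obtain ⟨F, hF⟩ := h.elim
  have hp := mem_nbrs.1 (show p ∈ G.nbrs A v by rw [hv]; simp)
  have hpv : p ≠ v := hp.2.ne'
  have hsum : s.arr 3 v = p := by rw [h.sum v hvA, hv, Finset.sum_singleton]
  have hcard : ∀ u ∈ A, s.arr 2 u ≤ n := fun u hu => by
    rw [h.deg u hu]; simpa using Finset.card_le_univ (G.nbrs A u)
  have hsum_le : ∀ u ∈ A, s.arr 3 u ≤ n * n := fun u hu => by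
    rw [h.sum u hu]
    refine (Finset.sum_le_card_nsmul _ _ n fun w _ => w.2.le).trans ?_
    rw [smul_eq_mul]
    exact Nat.mul_le_mul_right _ (by simpa using Finset.card_le_univ (G.nbrs A u))
  have hFv : (F v).card < 2 ^ L := lt_of_le_of_lt (by simpa using Finset.card_le_univ (F v)) hnL
  have hpn := p.2
  have hvn := v.2
  have hpL := index_add_le (L := L) hpn
  refine ((h.scan_spec hL hW rfl rfl hvA h.reg_three).seq (t₂ := 3 + (pushTime L + 40))
    fun s₁ hs₁ => ?_).mono (by unfold absorbTime scanTime pushTime; omega) fun _ h => h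
  obtain ⟨hl0, hl1⟩ := hs₁.label_eq (hF.rooted v hvA) hFv
  have hset : (set 4 (get 3 (reg 3))).wp W s₁ fun s' =>
      s' = ⟨Function.update s₁.reg 4 p, s₁.arr⟩ := by
    simp only [Program.wp, Expr.Fits, Expr.eval, hs₁.frame 3 (by norm_num), h.reg_three,
      hs₁.arr 3 (by norm_num), hsum]
    exact ⟨by omega, trivial⟩
  refine (Exec.of_wp hset).seq fun s₂ hs₂ => ?_
  have hr2 : ∀ r, r ≤ 3 → s₂.reg r = s.reg r := fun r hr => by
    rw [hs₂, ← hs₁.frame r (by omega)]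
    exact Function.update_of_ne (by omega) _ _
  have ha2 : ∀ a, a ≠ 7 → s₂.arr a = s.arr a := fun a ha => by rw [hs₂, ← hs₁.arr a ha]
  have h24 : s₂.reg 4 = p := by rw [hs₂]; simp
  have h28 : s₂.reg 8 = s₁.reg 8 := by rw [hs₂]; simp
  have hq := hs₁.cut_le
  have hpush := push_spec (W := W) (L := L) (p := (p : ℕ)) (q := s₁.reg 8) (B := p * L)
    (a := label (m v) (σ v)) (s := s₂) (by omega)
    (by omega) (by rw [hr2 1 (by omega), h.reg_one]) h24 (by omega)
    (by rw [ha2 4 (by norm_num), h.base p hpn]) h28 (by omega) hl0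
    (fun k hk hkL => by rw [hs₂]; exact hl1 k hk hkL) (label_le _ _)
    (fun k hk => by
      rw [ha2 5 (by norm_num), h.total p hp.1 k hk]
      have := (h.label_bounds hp.1 k).1
      omega)
    (fun k hk => by
      rw [ha2 6 (by norm_num), h.weight p hp.1 k hk]
      have := (h.label_bounds hp.1 k).2
      omega)
  refine (hpush.seq (t₂ := 40) fun s₃ hs₃ => ?_)
  have hend : absorbEnd.wp W s₃ fun s' => ∃ m' σ', ElimInv G L (A.erase v) m' σ' i p s' := by
    have hvp : (p : ℕ) ≠ v := fun h => hpv (Fin.ext h)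
    have e2 : s₃.arr 2 = s.arr 2 := by
      rw [hs₃.arr 2 (by norm_num) (by norm_num), ha2 2 (by norm_num)]
    have e3 : s₃.arr 3 = s.arr 3 := by
      rw [hs₃.arr 3 (by norm_num) (by norm_num), ha2 3 (by norm_num)]
    have e4 : s₃.arr 4 = s.arr 4 := by
      rw [hs₃.arr 4 (by norm_num) (by norm_num), ha2 4 (by norm_num)]
    have r3 : s₃.reg 3 = v := by rw [hs₃.frame 3 (by norm_num), hr2 3 le_rfl, h.reg_three]
    have r4 : s₃.reg 4 = p := by rw [hs₃.frame 4 le_rfl, h24]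
    have b2 := hcard p hp.1
    have b3 := hsum_le p hp.1
    simp only [absorbEnd, Program.wp, Expr.Fits, Expr.eval, ne_eq, Nat.reduceEqDiff,
      not_false_eq_true, Function.update_of_ne, Function.update_self, r3, r4, e2, e3, hvp]
    refine ⟨by omega, by omega, by omega, by omega, by omega, by omega, by omega, _, _,
      h.absorb hvA hv hin (fun r hr => ?_) (by simp) (by simp [r4]) (by simpa using e4)
      (by simp) (by simp) ?_ ?_ ?_⟩
    · dsimp only
      rw [Function.update_of_ne (by omega), hs₃.frame r (by omega), hr2 r (by omega)]
    · intro j hj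
      simpa [ha2] using hs₃.total j hj
    · intro j hj
      simpa [ha2] using hs₃.weight j hj
    · intro j hj
      simpa [ha2] using hs₃.rest j hj
  exact (Exec.of_wp hend).mono (by decide) fun _ h => h

end RAM

namespace RAM
open TreeLabel SimpleGraph RAM.Expr RAM.Test RAM.Program

variable {n : ℕ} {G : SimpleGraph (Fin n)}

/-- A bound for the number of steps of one round of the elimination. -/
def elimStepTime (L : ℕ) : ℕ := 200 * L + 270

/-- A round removes a leaf or inspects the next vertex, so the number of remaining vertices plus the
number of vertices that have not been inspected decreases. -/
lemma elimStep_spec {W L : ℕ} {A : Finset (Fin n)} {m σ : Fin n → ℕ → ℕ} {i v : ℕ} {s : State}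
    (h : ElimInv G L A m σ i v s) (hL : 1 ≤ L) (hnL : n < 2 ^ L)
    (hW : n * n + n * L + 8 * n + 8 < W) (hin : i < n) :
    Exec W elimStep s (elimStepTime L) fun s' => ∃ A' m' σ' i' v',
      A'.card + (n - i') < A.card + (n - i) ∧ ElimInv G L A' m' σ' i' v' s' := by
  obtain ⟨v, rfl⟩ : ∃ w : Fin n, v = w := ⟨⟨v, h.lt hin⟩, rfl⟩
  have hvn := v.2
  have hdeg : s.arr 2 v ≤ n := by
    by_cases hvA : v ∈ A
    · rw [h.deg v hvA]; simpa using Finset.card_le_univ (G.nbrs A v)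
    · rw [h.removed v hvA]; exact Nat.zero_le _
  refine (Exec.branch (t := absorbTime L) ?_ (fun hb => ?_) fun hb => ?_).mono
    (by simp only [Test.cost, Expr.cost, absorbTime, elimStepTime]; omega) fun _ h => h
  · simp only [Test.Fits, Expr.Fits, Expr.eval, h.reg_two, h.reg_three]
    omega
  · simp only [Test.Holds, Expr.eval, h.reg_two, h.reg_three] at hb
    have hvA : v ∈ A := by
      by_contra hvA
      have := h.removed v hvA
      omega
    obtain ⟨p, hp⟩ := Finset.card_eq_one.1 ((h.deg v hvA).symm.trans hb.1)
    refine (absorb_spec h hL hnL hW hvA hp hin).mono le_rfl ?_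
    rintro s' ⟨m', σ', h'⟩
    have := Finset.card_erase_lt_of_mem hvA
    exact ⟨A.erase v, m', σ', i, p, by omega, h'⟩
  · simp only [Test.Holds, Expr.eval, h.reg_two, h.reg_three, not_and, not_not] at hb
    have hwp : (seq (set 2 (add (reg 2) (const 1))) (set 3 (reg 2))).wp W s
        (ElimInv G L A m σ (i + 1) (i + 1)) := by
      simp only [Program.wp, Expr.Fits, Expr.eval, Function.update_self, h.reg_two]
      refine ⟨by omega, by omega, ?_⟩
      refine ⟨by simp [h.reg_zero], by simp [h.reg_one], by simp, by simp,
        by simpa using h.reg_four, hin, id, id, h.elim, h.base, h.deg, h.sum, h.removed, h.total,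
        h.weight,
        fun u hu hui hne => ?_⟩
      by_cases huv : u = v
      · subst huv
        rw [← h.deg u hu]
        intro h1
        have := hb h1
        omega
      · exact h.inspected u hu (by omega) fun h => huv (Fin.ext h)
    refine (Exec.of_wp hwp).mono (show 6 ≤ absorbTime L by unfold absorbTime; omega)
      fun s' h' => ⟨A, m, σ, i + 1, i + 1, by omega, h'⟩

/-- When all vertices have been inspected there is no leaf left, so only one vertex remains. -/
lemma ElimInv.eq_singleton {L : ℕ} {A : Finset (Fin n)} {m σ : Fin n → ℕ → ℕ} {v : ℕ} {s : State}
    (h : ElimInv G L A m σ n v s) : ∃ p : Fin n, s.reg 4 = p ∧ A = {p} := by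
  obtain ⟨p, hpA, hp⟩ := h.reg_four
  obtain ⟨F, hF⟩ := h.elim
  refine ⟨p, hp, ?_⟩
  have hcard : A.card ≤ 1 := by
    by_contra! hA
    obtain ⟨u, hu, hu1⟩ := hF.exists_leaf hA
    have := h.last rfl
    exact h.inspected u hu u.2.le (by omega) hu1
  exact (Finset.eq_of_subset_of_card_le (Finset.singleton_subset_iff.2 hpA)
    (by simpa using hcard)).symm

lemma elimLoop_spec {W L : ℕ} {A : Finset (Fin n)} {m σ : Fin n → ℕ → ℕ} {i v : ℕ} {s : State}
    (h : ElimInv G L A m σ i v s) (hL : 1 ≤ L) (hnL : n < 2 ^ L)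
    (hW : n * n + n * L + 8 * n + 8 < W) :
    Exec W (loop (lt (reg 2) (reg 0)) elimStep) s (2 * n * (3 + elimStepTime L) + 3) fun s' =>
      ∃ (p : Fin n) (m' σ' : Fin n → ℕ → ℕ), s'.reg 4 = p ∧ ElimInv G L {p} m' σ' n n s' := by
  have hA : A.card ≤ n := by simpa using Finset.card_le_univ A
  refine (Exec.loop_of_index (W := W) (b := lt (reg 2) (reg 0)) (c := elimStep)
    (t := elimStepTime L) (N := A.card + (n - i)) (fun N s => ∃ A m σ i v,
      ElimInv G L A m σ i v s ∧ N = A.card + (n - i)) ?_ ?_ ⟨A, m, σ, i, v, h, rfl⟩).mono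
    (Nat.add_le_add_right (Nat.mul_le_mul_right _ (by omega)) _) ?_
  · rintro N s ⟨A, m, σ, i, v, h, -⟩
    have := h.le
    simp only [Test.Fits, Expr.Fits, h.reg_two, h.reg_zero]
    omega
  · rintro N s ⟨A, m, σ, i, v, h, rfl⟩ hb
    simp only [Test.Holds, Expr.eval, h.reg_two, h.reg_zero] at hb
    refine (elimStep_spec h hL hnL hW hb).mono le_rfl ?_
    rintro s' ⟨A', m', σ', i', v', hlt, h'⟩
    exact ⟨_, hlt, A', m', σ', i', v', h', rfl⟩
  · rintro s' ⟨⟨N, A, m, σ, i, v, h, -⟩, hb⟩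
    simp only [Test.Holds, Expr.eval, h.reg_two, h.reg_zero] at hb
    obtain rfl : i = n := le_antisymm h.le (by omega)
    obtain ⟨p, hp, rfl⟩ := h.eq_singleton
    obtain rfl := h.last rfl
    exact ⟨p, m, σ, hp, h⟩

end RAM

namespace SimpleGraph
open RAM
variable {n : ℕ} {G : SimpleGraph (Fin n)} {adj : Fin n → List (Fin n)}

/-! ### Adjacency lists of trees -/

lemma IsAdjacencyList.toFinset (h : G.IsAdjacencyList adj) (u : Fin n) :
    (adj u).toFinset = G.nbrs Finset.univ u := by
  ext w; simp [mem_nbrs, (h u).2 w]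

lemma IsAdjacencyList.length_row (h : G.IsAdjacencyList adj) (u : Fin n) :
    (row adj u).length = (G.nbrs Finset.univ u).card := by
  rw [← h.toFinset, List.toFinset_card_of_nodup (h u).1, row, dif_pos u.2, List.length_map]

lemma IsAdjacencyList.sum_row (h : G.IsAdjacencyList adj) (u : Fin n) :
    (row adj u).sum = ∑ w ∈ G.nbrs Finset.univ u, (w : ℕ) := by
  rw [← h.toFinset, List.sum_toFinset _ (h u).1, row, dif_pos u.2]

lemma IsAdjacencyList.length_row_le (h : G.IsAdjacencyList adj) (v : ℕ) :
    (row adj v).length ≤ n := by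
  by_cases hv : v < n
  · rw [h.length_row ⟨v, hv⟩]
    simpa using Finset.card_le_univ (G.nbrs Finset.univ (⟨v, hv⟩ : Fin n))
  · simp [row, hv]

lemma offset_eq_sum (adj : Fin n → List (Fin n)) (v : ℕ) :
    offset adj v = ∑ u ∈ Finset.range v, (row adj u).length := by
  induction v with
  | zero => exact offset_zero adj
  | succ v ih => rw [offset_succ, ih, Finset.sum_range_succ]

lemma IsAdjacencyList.offset_le (h : G.IsAdjacencyList adj) (hG : G.IsTree) :
    offset adj n ≤ 2 * n := by
  have hdeg := (Elimination.init hG).deg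
  rw [offset_eq_sum, Finset.sum_range, Finset.sum_congr rfl fun u _ => h.length_row u]
  rw [Finset.card_univ, Fintype.card_fin] at hdeg
  omega

end SimpleGraph

namespace RAM
open TreeLabel SimpleGraph RAM.Expr RAM.Test RAM.Program

variable {n : ℕ} {G : SimpleGraph (Fin n)} {adj : Fin n → List (Fin n)}

/-! ### Correctness and running time of the program -/

lemma ReadInv.elimInv {L : ℕ} {s : State} (h : ReadInv adj L n 0 s) (hn : 1 ≤ n)
    (hG : G.IsTree) (hadj : G.IsAdjacencyList adj) :
    ElimInv G L Finset.univ (fun _ _ => 0) (fun _ _ => 0) 0 0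
      ⟨Function.update s.reg 3 0, s.arr⟩ where
  reg_zero := by simp [h.reg_zero]
  reg_one := by simp [h.reg_one]
  reg_two := by simp [h.reg_two]
  reg_three := by simp
  reg_four := ⟨⟨0, hn⟩, Finset.mem_univ _, by simp [h.reg_four]⟩
  le := Nat.zero_le _
  lt := id
  last := id
  elim := ⟨_, .init hG⟩
  base := h.base
  deg u _ := by simpa only [← hadj.length_row u] using h.deg u u.2
  sum u _ := by simpa only [← hadj.sum_row u] using h.sum u u.2
  removed u hu := absurd (Finset.mem_univ u) hu
  total u _ k _ := by simp [h.five]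
  weight u _ k _ := by simp [h.six]
  inspected u _ h0 h1 := absurd (Nat.le_zero.1 h0) h1

/-- The level that the computation of the label of the root has found is the width. -/
lemma ScanInv.lmw_eq {s₀ s : State} {B L : ℕ} {m σ : ℕ → ℕ} {r : Fin n}
    (h : ScanInv s₀ B L m σ (L - 1) s) (hL : n < 2 ^ L) (hR : G.Rooted Finset.univ r m σ) :
    G.lmw = s.reg 9 := by
  have habove : ∀ k, s.reg 9 < k → TreeLabel.code m σ k = 0 := by
    intro k hk
    by_cases hkL : k ≤ L - 1
    · exact h.above_top k hk hkL
    · refine hR.code_eq_zero (lt_of_lt_of_le (by simpa using hL) ?_)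
      exact Nat.pow_le_pow_right (by norm_num) (by omega)
  refine hR.lmw_eq (h.top_code.elim (fun h0 => ?_) id) habove
  obtain ⟨k, hk⟩ := hR.exists_code_ne_zero fun x _ y hy _ => absurd (Finset.mem_univ y) hy
  -- no nonzero entry above level `0` has been found, so the nonzero entry is at level `0`
  obtain rfl : k = 0 := by
    by_contra hk0
    exact hk (habove k (by omega))
  rwa [h0]

/-- A bound for the number of steps of the program on a tree with `n` vertices. -/
def lmwTime (n : ℕ) : ℕ := 2000 * (n + 1) * (Nat.log 2 n + 2)

/-- The bound on `W` has room for the sums of neighbours, which are at most `n * n`, for the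
addresses of the accumulators, which are below `n * L`, and for their contents, which are at most
`4 * n`. -/
theorem lmwProgram_spec {W : ℕ} (hW : n * n + n * (Nat.log 2 n + 1) + 8 * n + 8 < W)
    (hG : G.IsTree) (hadj : G.IsAdjacencyList adj) :
    Exec W lmwProgram (graphInput adj) (lmwTime n) fun s => s.reg 0 = G.lmw := by
  have hn : 1 ≤ n := by
    obtain ⟨v⟩ := hG.connected.nonempty
    exact (Nat.zero_le _).trans_lt v.2
  have hnL : n < 2 ^ (Nat.log 2 n + 1) := Nat.lt_pow_succ_log_self (by norm_num) n
  generalize hL : Nat.log 2 n + 1 = L at hW hnL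
  have hL1 : 1 ≤ L := by omega
  have hprep := prepare_spec (W := W) (L := L) hn hL.symm (by omega) (hadj.offset_le hG)
    hadj.length_row_le
  refine (hprep.seq (t₂ := 2 + ((2 * n * (3 + elimStepTime L) + 3) + (2 + (scanTime L + 2))))
    fun s₁ h₁ => ?_).mono ?_ fun _ h => h
  · have hset : (set 3 (const 0)).wp W s₁
        (ElimInv G L Finset.univ (fun _ _ => 0) (fun _ _ => 0) 0 0) :=
      ⟨show 0 < W by omega, h₁.elimInv hn hG hadj⟩
    refine (Exec.of_wp hset).seq fun s₂ h₂ => (elimLoop_spec h₂ hL1 hnL hW).seq ?_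
    rintro s₃ ⟨p, m, σ, h4, h₃⟩
    have hp := p.2
    have hset' : (set 3 (reg 4)).wp W s₃ fun s => s = ⟨Function.update s₃.reg 3 p, s₃.arr⟩ := by
      simp only [Program.wp, Expr.Fits, Expr.eval, h4]
      exact ⟨by omega, trivial⟩
    refine (Exec.of_wp hset').seq fun s₄ h₄ => (h₃.scan_spec hL1 hW (by simp [h₄]) (by simp [h₄])
      (Finset.mem_singleton_self p) (by simp [h₄])).seq fun s₅ h₅ => ?_
    obtain ⟨F, hF⟩ := h₃.elim
    have htop := h₅.top_le
    have hLn : L ≤ n := hL ▸ Nat.log_lt_self 2 (by omega)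
    refine Exec.of_wp ⟨show s₅.reg 9 < W by omega, ?_⟩
    rw [h₅.lmw_eq hnL hF.rooted_univ]
    exact Function.update_self (0 : ℕ) (s₅.reg 9) s₅.reg
  · have : lmwTime n = 2000 * (n * L) + 2000 * n + 2000 * L + 2000 := by
      rw [lmwTime, ← hL]; ring
    rw [this, elimStepTime, scanTime]
    have : 2 * n * (3 + (200 * L + 270)) = 400 * (n * L) + 546 * n := by ring
    omega

lemma lmwTime_isBigO : (fun n : ℕ => (lmwTime n : ℝ)) =O[atTop]
    fun n : ℕ => (n : ℝ) * Real.log n := by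
  refine IsBigO.of_bound (12000 / Real.log 2) ?_
  filter_upwards [eventually_ge_atTop 2] with n hn
  have hlog2 : 0 < Real.log 2 := Real.log_pos (by norm_num)
  have hn' : (2 : ℝ) ≤ n := by exact_mod_cast hn
  have hl1 : 1 ≤ Nat.log 2 n := Nat.log_pos (by norm_num) hn
  have hl : (Nat.log 2 n : ℝ) ≤ Real.log n / Real.log 2 := Real.natLog_le_logb n 2
  have hln : 0 ≤ Real.log n := Real.log_nonneg (by linarith)
  have h1 : lmwTime n ≤ 12000 * (n * Nat.log 2 n) := by
    unfold lmwTime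
    calc 2000 * (n + 1) * (Nat.log 2 n + 2) ≤ 2000 * (2 * n) * (3 * Nat.log 2 n) := by
          gcongr <;> omega
      _ = _ := by ring
  rw [Real.norm_of_nonneg (Nat.cast_nonneg _), Real.norm_of_nonneg (by positivity)]
  calc (lmwTime n : ℝ) ≤ 12000 * (n * Nat.log 2 n) := by exact_mod_cast h1
    _ ≤ 12000 * (n * (Real.log n / Real.log 2)) := by gcongr
    _ = _ := by ring

end RAM

/-- There are a single program `P`, a constant `c` and a time bound `f n = O(n log n)` such that `P`,
given adjacency lists of any tree `T` with `n` vertices, halts within `f n` steps with `lmw(T)` in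
register `0`, on words of `O(log n)` bits (numbers smaller than `(n + 2) ^ c`). -/
theorem mainTheorem2 :
    ∃ (P : RAM.Program) (c : ℕ) (f : ℕ → ℕ),
      (fun n : ℕ => (f n : ℝ)) =O[atTop] (fun n : ℕ => (n : ℝ) * Real.log (n : ℝ)) ∧
      ∀ (n : ℕ) (T : SimpleGraph (Fin n)), T.IsTree →
        ∀ adj : Fin n → List (Fin n), T.IsAdjacencyList adj →
          ∃ (t : ℕ) (s : RAM.State), t ≤ f n ∧
            RAM.Run ((n + 2) ^ c) P (RAM.graphInput adj) t s ∧ s.reg 0 = T.lmw := by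
  refine ⟨RAM.lmwProgram, 4, RAM.lmwTime, RAM.lmwTime_isBigO, fun n T hT adj hadj => ?_⟩
  refine RAM.lmwProgram_spec ?_ hT hadj
  have h1 : n * (Nat.log 2 n + 1) ≤ n * (n + 1) :=
    Nat.mul_le_mul_left _ (Nat.succ_le_succ (Nat.log_le_self 2 n))
  nlinarith [Nat.zero_le (n ^ 4), Nat.zero_le (n ^ 3), Nat.zero_le (n ^ 2)]
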